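/- Notation. For a function $v$ on $\mathbb R$ and $z=(z_0,\dots,z_3)$, write $f(\partial_x^3\mathbf v)=f(z,x,t)$ with $z_j=\partial_x^jv(x)$; $f_{z_j}=\partial f/\partial z_j$; $\|v\|_{H^s}=\|(1+|\xi|^2)^{s/2}\hat v\|_{L^2}$. Sobolev functions are identified with their continuous versions. Let $T_0>0$ and let $f=f(z,x,t)$ be real-valued, $z\in\mathbb R^4$, $x\in\mathbb R$, $t\in[-T_0,T_0]$, such that: (A1) $f\in C^1_tC^{11}_zW^{11,\infty}_x$, in the sense that for all $\alpha\le1$, $|\beta|\le11$, $\gamma\le 11$ there is a positive increasing function $C_{\alpha,\beta,\gamma}$ with $\|\partial_t^\alpha\partial_z^\beta\partial_x^\gamma f(z,\cdot,\cdot)\|_{L^\infty(\mathbb R\times[-T_0,T_0])}\le C_{\alpha,\beta,\gamma}(|z|)$. (A2) There are $g_D(z_0,z_1,z_2,x,t)\in C^1_tC^0_zL^\infty_x$ and $g_H(z_0,\dots,z_3,x,t)\in C^1_tC^2_zL^\infty_x$ (with bounds of the same kind as in (A1), for the corresponding derivatives) such that, along every $v\in C^3(\mathbb R)$ and wherever $f_{z_3}\neq0$,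 $$\frac{f_{z_2}}{f_{z_3}}(\partial_x^3\mathbf v)=\partial_x\big[g_D(\partial_x^2\mathbf v)\big]+g_H(\partial_x^3\mathbf v),$$ and $g_H(0,x,t)=\partial_{z_j}g_H(0,x,t)=0$ for $j=0,\dots,3$ and all $x$, $t$. (A3) $f(0,x,t)=0$ for all $x$, $t$. Let $0<T'\le T_0$. Then there exist functions $C_2:\mathbb R^2\to[1,\infty)$ and $C_4:\mathbb R\to[1,\infty)$, nondecreasing (in each variable), such that the following holds for every $\varepsilon\ge0$, every $0<\delta\le1$, every $u_0\in H^7(\mathbb R)$ and every even $\phi\in C^\infty(\mathbb R;[0,1])$ with $\phi=1$ on $[-1,1]$ and $\phi=0$ outside $(-2,2)$. Let $(u_0)_\delta$ be given by $\widehat{(u_0)_\delta}(\xi)=\phi(\delta|\xi|)\hat u_0(\xi)$, and let $u\in C^1([0,T'];H^8)\cap C^0([0,T'];H^{12})$ be a real-valued solution of $$\partial_tu+f(\partial_x^3u,\partial_x^2u,\partial_xu,u,x,t)=-\varepsilon\,\partial_x^4u,\qquad u(\cdot,0)=(u_0)_\delta .$$ Put $$M_\varepsilon(t)=\sup_{0\le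 t'\le t}\|u(t')\|_{H^7}+\varepsilon\sup_{0\le t'\le t}\|u(t')\|_{H^8},\qquad k(t)=\sup_{0\le t'\le t}\max\Big\{\|u(t')\|_{H^4},\ \Big\|\frac1{f_{z_3}(\partial_x^3\mathbf u(t'))}\Big\|_{L^\infty_x}\Big\}.$$ Then for every $t\in[0,T']$ with $k(t)<\infty$, $M_\varepsilon(t)$ is finite and $$M_\varepsilon(t)\le C_2\big(k(t),\,tC_4(M_\varepsilon(t))\big)\,\big[M_\varepsilon(0)+tC_4(M_\varepsilon(t))\big].$$ In particular $C_2$ and $C_4$ do not depend on $\varepsilon$, $\delta$, $u_0$, $\phi$ or $u$. -/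

import Mathlib

open MeasureTheory Filter Topology FourierTransform
open scoped ENNReal ContDiff

noncomputable section

namespace KdVType

/-- The `H^s(ℝ)` norm `‖(1 + |ξ|²)^{s/2} v̂(ξ)‖_{L²}` of a real-valued function on the line, for
`s ≥ 0`, with value `∞` when `v` is not in `L²`; `v̂` is the `L²` Fourier transform. -/
def sobolevENorm (s : ℝ) (v : ℝ → ℝ) : ℝ≥0∞ :=
  open Classical in
  if h : MemLp (fun x => (v x : ℂ)) 2 volume then
    eLpNorm (fun ξ : ℝ =>
      (((1 + ξ ^ 2) ^ (s / 2) : ℝ) : ℂ) * (𝓕 (h.toLp _) : Lp ℂ 2 (volume : Measure ℝ)) ξ) 2 volume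
  else ⊤

/-- `v ∈ H^s(ℝ)`, for `s ≥ 0`. -/
def MemH (s : ℝ) (v : ℝ → ℝ) : Prop := sobolevENorm s v < ⊤

/-- `u ∈ C^0(I; H^s)`; `u t` is the function at time `t`. -/
def ContinuousInH (s : ℝ) (I : Set ℝ) (u : ℝ → ℝ → ℝ) : Prop :=
  (∀ t ∈ I, MemH s (u t)) ∧
  ∀ t₀ ∈ I, Tendsto (fun t => sobolevENorm s (fun x => u t x - u t₀ x)) (𝓝[I] t₀) (𝓝 0)

/-- `u ∈ C^1(I; H^s)` with time derivative `u'`: the difference quotients converge in `H^s`, and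
the limit is continuous with values in `H^s`. -/
def C1InH (s : ℝ) (I : Set ℝ) (u u' : ℝ → ℝ → ℝ) : Prop :=
  ContinuousInH s I u ∧ ContinuousInH s I u' ∧
  ∀ t₀ ∈ I, Tendsto
    (fun t => sobolevENorm s (fun x => (u t x - u t₀ x) / (t - t₀) - u' t₀ x))
    (𝓝[I \ {t₀}] t₀) (𝓝 0)

/-- The jet `(v, ∂ₓv, …, ∂ₓ^{d-1}v)` at `x`. -/
def jet (d : ℕ) (v : ℝ → ℝ) (x : ℝ) : Fin d → ℝ := fun j => iteratedDeriv (j : ℕ) v x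

/-- The partial derivative `F_{z_i}` of `F(z, x, t)`. -/
def partialZ {d : ℕ} (i : Fin d) (F : (Fin d → ℝ) → ℝ → ℝ → ℝ) :
    (Fin d → ℝ) → ℝ → ℝ → ℝ :=
  fun z x t => deriv (fun s => F (Function.update z i s) x t) (z i)

/-- The class `C^1_t C^m_z W^{n,∞}_x` of functions `F(z, x, t)`, `z ∈ ℝ^d`, `x ∈ ℝ`, `t ∈ I`, which
may grow in `z` but are bounded in `x` and `t`. Here `D α β γ` is `∂_t^α ∂_z^β ∂_x^γ F`, for
`α ≤ 1`, `|β| ≤ m`, `γ ≤ n`. The derivatives in `t` and `z` are classical; the derivatives in `x`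
are weak (bounded functions whose integrals are the increments of the function), so that the
derivative of top order in `x` is only bounded and measurable in `x`. -/
def MixedRegularity {d : ℕ} (m n : ℕ) (I : Set ℝ) (F : (Fin d → ℝ) → ℝ → ℝ → ℝ) : Prop :=
  ∃ D : ℕ → (Fin d → ℕ) → ℕ → (Fin d → ℝ) → ℝ → ℝ → ℝ,
    (∀ z x, ∀ t ∈ I, D 0 0 0 z x t = F z x t) ∧
    (∀ β γ, ∑ i, β i ≤ m → γ ≤ n → ∀ z x, ∀ t ∈ I,
      HasDerivWithinAt (fun s => D 0 β γ z x s) (D 1 β γ z x t) I t) ∧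
    (∀ α β γ, α ≤ 1 → ∑ i, β i < m → γ ≤ n → ∀ i z x, ∀ t ∈ I,
      HasDerivAt (fun s => D α β γ (Function.update z i s) x t)
        (D α (β + Pi.single i 1) γ z x t) (z i)) ∧
    (∀ α β γ, α ≤ 1 → ∑ i, β i ≤ m → γ < n → ∀ z, ∀ t ∈ I, ∀ a b : ℝ,
      D α β γ z b t - D α β γ z a t = ∫ x in a..b, D α β (γ + 1) z x t) ∧
    (∀ α β γ, α ≤ 1 → ∑ i, β i ≤ m → γ ≤ n →
      (∀ z, ∀ t ∈ I, AEStronglyMeasurable (fun x => D α β γ z x t) volume) ∧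
      (∀ x, ContinuousOn (fun p : (Fin d → ℝ) × ℝ => D α β γ p.1 x p.2) (Set.univ ×ˢ I)) ∧
      ∃ C : ℝ → ℝ, Monotone C ∧ (∀ s, 0 < C s) ∧
        ∀ z x, ∀ t ∈ I, |D α β γ z x t| ≤ C ‖z‖)

/-- The regularity assumption `f ∈ C^1_t C^{11}_z W^{11,∞}_x`. The variable `z j` of `f` stands for
`∂ₓ^j u`, `j = 0, …, 3`. -/
def ConditionA1 (I : Set ℝ) (f : (Fin 4 → ℝ) → ℝ → ℝ → ℝ) : Prop :=
  MixedRegularity 11 11 I f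

/-- The assumption on the modified diffusion ratio: `f_{z₂}/f_{z₃}`, evaluated along an arbitrary
function `v`, equals `∂ₓ[g_D(∂ₓ²v, ∂ₓv, v, x, t)] + g_H(∂ₓ³v, …, v, x, t)` wherever it is defined,
that is where `f_{z₃} ≠ 0`; and `g_H` vanishes to second order at `z = 0`. -/
def ConditionA2 (I : Set ℝ) (f : (Fin 4 → ℝ) → ℝ → ℝ → ℝ) : Prop :=
  ∃ (gD : (Fin 3 → ℝ) → ℝ → ℝ → ℝ) (gH : (Fin 4 → ℝ) → ℝ → ℝ → ℝ),
    MixedRegularity 0 0 I gD ∧ MixedRegularity 2 0 I gH ∧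
    (∀ x, ∀ t ∈ I, gH 0 x t = 0 ∧ ∀ j, partialZ j gH 0 x t = 0) ∧
    ∀ v : ℝ → ℝ, ContDiff ℝ 3 v → ∀ x, ∀ t ∈ I, partialZ 3 f (jet 4 v x) x t ≠ 0 →
      HasDerivAt (fun y => gD (jet 3 v y) y t)
        (partialZ 2 f (jet 4 v x) x t / partialZ 3 f (jet 4 v x) x t - gH (jet 4 v x) x t) x

/-- The function `f` vanishes at `z = 0`. -/
def ConditionA3 (I : Set ℝ) (f : (Fin 4 → ℝ) → ℝ → ℝ → ℝ) : Prop :=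
  ∀ x, ∀ t ∈ I, f 0 x t = 0

/-- A radial smooth bump function `0 ≤ φ ≤ 1`, equal to `1` for `|ξ| ≤ 1` and to `0` for
`|ξ| ≥ 2`. -/
def IsCutoff (φ : ℝ → ℝ) : Prop :=
  ContDiff ℝ ∞ φ ∧ (∀ ξ, 0 ≤ φ ξ ∧ φ ξ ≤ 1) ∧ (∀ ξ, φ (-ξ) = φ ξ) ∧
  (∀ ξ, |ξ| ≤ 1 → φ ξ = 1) ∧ (∀ ξ, 2 ≤ |ξ| → φ ξ = 0)

/-- `v = (u₀)_δ`, that is `v̂(ξ) = φ(δ|ξ|) û₀(ξ)`. -/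
def IsMollification (φ : ℝ → ℝ) (δ : ℝ) (u₀ v : ℝ → ℝ) : Prop :=
  ∃ (h₀ : MemLp (fun x => (u₀ x : ℂ)) 2 volume) (h : MemLp (fun x => (v x : ℂ)) 2 volume),
    ∀ᵐ ξ : ℝ, (𝓕 (h.toLp _) : Lp ℂ 2 (volume : Measure ℝ)) ξ =
      (φ (δ * |ξ|) : ℂ) * (𝓕 (h₀.toLp _) : Lp ℂ 2 (volume : Measure ℝ)) ξ

/-- `u ∈ C^1([0,T]; H^8) ∩ C^0([0,T]; H^12)` solves
`∂_t u + f(∂ₓ³u, …, u, x, t) = -ε ∂ₓ⁴u` with `u(0) = (u₀)_δ`. For each `t`, `u t` is the version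
of class `C^{11}` that Sobolev embedding provides. -/
structure IsRegularizedSolution (f : (Fin 4 → ℝ) → ℝ → ℝ → ℝ) (φ : ℝ → ℝ) (ε δ T : ℝ)
    (u₀ : ℝ → ℝ) (u : ℝ → ℝ → ℝ) : Prop where
  smooth : ∀ t ∈ Set.Icc 0 T, ContDiff ℝ 11 (u t)
  continuous_H12 : ContinuousInH 12 (Set.Icc 0 T) u
  equation : ∃ u' : ℝ → ℝ → ℝ, C1InH 8 (Set.Icc 0 T) u u' ∧
    ∀ t ∈ Set.Icc 0 T, ∀ x,
      u' t x + f (jet 4 (u t) x) x t = -ε * iteratedDeriv 4 (u t) x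
  initial : IsMollification φ δ u₀ (u 0)

/-- `λ = ‖1 / f_{z₃}(∂ₓ³v, …, v, x, t)‖_{L^∞_x}`, with `1 / 0 = ∞`. -/
def dispersion (f : (Fin 4 → ℝ) → ℝ → ℝ → ℝ) (v : ℝ → ℝ) (t : ℝ) : ℝ≥0∞ :=
  essSup (fun x => ‖partialZ 3 f (jet 4 v x) x t‖ₑ⁻¹) volume

/-- `M_ε(t) = sup_{[0,t]} ‖u‖_{H^7} + ε sup_{[0,t]} ‖u‖_{H^8}`. -/
def highNorm (ε : ℝ) (u : ℝ → ℝ → ℝ) (t : ℝ) : ℝ≥0∞ :=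
  (⨆ t' ∈ Set.Icc 0 t, sobolevENorm 7 (u t')) +
    ENNReal.ofReal ε * ⨆ t' ∈ Set.Icc 0 t, sobolevENorm 8 (u t')

/-- `k(t)`, the supremum over `[0,t]` of `‖u‖_{H^4}` and of `λ`. -/
def lowNorm (f : (Fin 4 → ℝ) → ℝ → ℝ → ℝ) (u : ℝ → ℝ → ℝ) (t : ℝ) : ℝ≥0∞ :=
  ⨆ t' ∈ Set.Icc 0 t, max (sobolevENorm 4 (u t')) (dispersion f (u t') t')

end KdVType

end

open KdVType

/-! The proof is an energy estimate with a gauge weight. Write `a = f_{z₃}` and `b = f_{z₂}` along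
the solution and let primes denote total derivatives in `x`. Differentiating `f` in space `N` times
gives `a ∂^{N+3}u + (b + N a') ∂^{N+2}u + c ∂^{N+1}u + r`; for `N = 7, 8` this is recorded in
`JetExpansion`, with the first two coefficients known exactly. In the evolution of `∫ ρ (∂^N u)²`
the two leading terms have the form `∫ α w w₃ + β w w₂` with `w = ∂^N u`, `α = ρ a`, `β = ρ (b + N
a')`. Integration by parts leaves a multiple of `∫ w₁²`, a loss of one derivative, and this multiple
vanishes when `α' = (2/3) β` (`integral_dispersive`). Solved for the weight, the condition reads `ρ
= |a|^{2N/3-1} exp((2/3) ∫ b/a)`; see `hasDerivAt_weight`.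

The weight is useful only if it is bounded above and below in terms of the low norms. This is the
role of (A2): a primitive of `b/a` is `g_D` plus a primitive of `g_H`; the first is bounded along
bounded jets, and the second is bounded because `g_H` is quadratically small, so that its integral
is controlled by an `H³` norm squared (`primitive_bound`). The weight must also be Lipschitz in
time. Here `g_D` is only continuous in `z`, but (A2) prescribes its derivative along every curve of
jets. Comparing two functions whose jets differ at `x₀` and agree at `x₀ - 1` gives Lipschitz
continuity where the equation is dispersive (`gD_lipschitz`). The time derivative of `u` is bounded
in `H⁴` by `M_ε` (`l2_deriv_le`), so the weight moves at a bounded rate (`weight_lipschitz`).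

Two energies are used: order `7`, and order `8` multiplied by `ε²`. At order `8` the expansion
contains a term quadratic in `∂⁷u`; it costs an `H⁸` norm, which the factor `ε` pays for
(`l2_rem₈_le`). For `ε ≤ 1` both energies carry their weights (`weighted_slice_seven`,
`weighted_slice_eight`). For `ε ≥ 1` the viscosity absorbs everything at order `8` without a weight
(`slice_eight_of_one_le`), and `‖u‖_{H⁷} ≤ ε ‖u‖_{H⁸}` makes order `7` superfluous.

The weight need not be differentiable in time, so the energies are differentiated in the sense of
upper Dini derivatives; a bound by a constant times the square root of the energy makes that root
grow at most linearly (`sqrt_le_of_diniLE`). Comparing energies with norms costs a factor depending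
on `k` only, whereas the rate of growth may depend on `k` and `M_ε`. The latter dependence is split
into a product of a function of `k` and a function of `M_ε` (`exists_monotone_mul_ge`), and the
first factor is moved into `C₂`. -/

namespace KdVType
-- Derivatives and Sobolev norms on the Fourier side.
open Complex in
-- The function `v'` is not known to be square integrable beforehand. The candidate `g`, the inverse
-- transform of `2πiξ v̂`, is, and Plancherel shows that `g` and `v'` have the same integrals
-- against test functions.
lemma exists_memLp_deriv_fourier {v v' : ℝ → ℂ} (hv : ∀ x, HasDerivAt v (v' x) x)
    (hc : Continuous v') (h : MemLp v 2 volume)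
    (hξ : MemLp (fun ξ : ℝ => (2 * Real.pi * I * ξ) *
      (𝓕 (h.toLp v) : Lp ℂ 2 (volume : Measure ℝ)) ξ) 2 volume) :
    ∃ h' : MemLp v' 2 volume, (𝓕 (h'.toLp v') : Lp ℂ 2 (volume : Measure ℝ)) =ᵐ[volume]
      fun ξ : ℝ => (2 * Real.pi * I * ξ) * (𝓕 (h.toLp v) : Lp ℂ 2 (volume : Measure ℝ)) ξ := by
  set G : Lp ℂ 2 (volume : Measure ℝ) := hξ.toLp _ with hG
  set g : Lp ℂ 2 (volume : Measure ℝ) := 𝓕⁻ G with hg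
  have hFg : 𝓕 g = G := by rw [hg]; exact FourierTransform.fourier_fourierInv_eq G
  have hvc : Continuous v := continuous_iff_continuousAt.2 fun x => (hv x).continuousAt
  have key : ∀ᵐ x : ℝ, v' x = g x := by
    apply ae_eq_of_integral_contDiff_smul_eq hc.locallyIntegrable
      ((Lp.memLp g).locallyIntegrable (by norm_num))
    intro φ hφ hφc
    have h₁ : HasCompactSupport (fun x => (φ x : ℂ)) := hφc.comp_left (g := fun y : ℝ => (y : ℂ)) rfl
    have h₂ : ContDiff ℝ ∞ (fun x => (φ x : ℂ)) := ofRealCLM.contDiff.comp hφ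
    have hd : ∀ x, HasDerivAt (fun x => (φ x : ℂ)) ((deriv φ x : ℝ) : ℂ) x := fun x =>
      ((hφ.differentiable (by simp)).differentiableAt.hasDerivAt).ofReal_comp
    set ψ : SchwartzMap ℝ ℂ := h₁.toSchwartzMap h₂ with hψ
    have hψx : ∀ x, ψ x = (φ x : ℂ) := fun x => rfl
    set ψ' : SchwartzMap ℝ ℂ := SchwartzMap.derivCLM ℂ ℂ ψ with hψ'
    have hψ'x : ∀ x, ψ' x = ((deriv φ x : ℝ) : ℂ) := fun x => by
      rw [hψ', SchwartzMap.derivCLM_apply]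
      exact (hd x).deriv
    have e1 : inner ℂ (ψ.toLp 2) g = ∫ x, φ x • g x := by
      rw [L2.inner_def]
      apply integral_congr_ae
      filter_upwards [ψ.coeFn_toLp 2 volume] with x hx
      rw [hx, hψx]; simp [mul_comm]
    have e2 : inner ℂ (ψ'.toLp 2) (h.toLp v) = ∫ x, deriv φ x • v x := by
      rw [L2.inner_def]
      apply integral_congr_ae
      filter_upwards [ψ'.coeFn_toLp 2 volume, h.coeFn_toLp] with x hx hx2
      rw [hx, hψ'x, hx2]; simp [mul_comm]
    -- On the Fourier side the factor `2πiξ` passes to the test function; conjugation of `I`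
    -- produces the minus sign.
    have e3 : inner ℂ (ψ.toLp 2) g = - inner ℂ (ψ'.toLp 2) (h.toLp v) := by
      have i1 := Lp.inner_fourier_eq (ψ.toLp 2) g
      have i2 := Lp.inner_fourier_eq (ψ'.toLp 2) (h.toLp v)
      refine i1.symm.trans (Eq.trans ?_ (congrArg Neg.neg i2))
      rw [hFg, SchwartzMap.toLp_fourier_eq,
        SchwartzMap.toLp_fourier_eq, L2.inner_def, L2.inner_def, ← integral_neg]
      apply integral_congr_ae
      filter_upwards [(𝓕 ψ).coeFn_toLp 2 volume, (𝓕 ψ').coeFn_toLp 2 volume, hξ.coeFn_toLp]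
        with x hx hx2 hx3
      rw [hx, hx2, hG, hx3]
      have : (𝓕 ψ') x = (2 * Real.pi * I * x) * (𝓕 ψ) x := by
        have h0 := Real.fourier_deriv (f := (ψ : ℝ → ℂ)) ψ.integrable ψ.differentiable
          (by
            have : deriv (ψ : ℝ → ℂ) = ψ' := by
              ext x; rw [hψ', SchwartzMap.derivCLM_apply]
            rw [this]; exact ψ'.integrable)
        have h1 := congrFun h0 x
        rw [SchwartzMap.fourier_coe, SchwartzMap.fourier_coe]
        have hdd : (ψ' : ℝ → ℂ) = deriv (ψ : ℝ → ℂ) := by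
          ext y; rw [hψ', SchwartzMap.derivCLM_apply]
        rw [hdd, h1, smul_eq_mul]
      have h2 : (starRingEnd ℂ) 2 = 2 := Complex.conj_ofNat 2
      rw [this]
      simp [h2]
      ring
    rw [← e1, e3, e2]
    have := integral_mul_deriv_eq_deriv_mul_of_integrable (u := fun x => (φ x : ℂ)) (v := v)
      (u' := fun x => ((deriv φ x : ℝ) : ℂ)) (v' := v') (fun x _ => hd x) (fun x _ => hv x)
      (Continuous.integrable_of_hasCompactSupport (by fun_prop) h₁.mul_right)
      (Continuous.integrable_of_hasCompactSupport
        (by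
          have := (hφ.continuous_deriv (by simp))
          fun_prop)
        (HasCompactSupport.mul_right (hφc.deriv.comp_left (g := fun y : ℝ => (y : ℂ)) rfl)))
      (Continuous.integrable_of_hasCompactSupport (by fun_prop) h₁.mul_right)
    simpa using this
  have h' : MemLp v' 2 volume := (memLp_congr_ae key).2 (Lp.memLp g)
  refine ⟨h', ?_⟩
  have : h'.toLp v' = g := by
    apply Lp.ext
    exact h'.coeFn_toLp.trans key
  rw [this, hFg]
  exact hξ.coeFn_toLp

/-- The Sobolev weight times the Fourier transform. -/
noncomputable def weightedFourier (s : ℝ) {v : ℝ → ℝ} (h : MemLp (fun x => (v x : ℂ)) 2 volume) :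
    ℝ → ℂ := fun ξ : ℝ =>
      (((1 + ξ ^ 2) ^ (s / 2) : ℝ) : ℂ) * (𝓕 (h.toLp _) : Lp ℂ 2 (volume : Measure ℝ)) ξ

lemma sobolevENorm_of_memLp (s : ℝ) {v : ℝ → ℝ} (h : MemLp (fun x => (v x : ℂ)) 2 volume) :
    sobolevENorm s v = eLpNorm (weightedFourier s h) 2 volume := by
  unfold sobolevENorm
  rw [dif_pos h]; rfl

lemma MemH.memLp_ofReal {s : ℝ} {v : ℝ → ℝ} (h : MemH s v) :
    MemLp (fun x => (v x : ℂ)) 2 volume := by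
  by_contra hc
  unfold MemH sobolevENorm at h
  rw [dif_neg hc] at h
  exact lt_irrefl _ h

lemma aestronglyMeasurable_weightedFourier (s : ℝ) {v : ℝ → ℝ}
    (h : MemLp (fun x => (v x : ℂ)) 2 volume) :
    AEStronglyMeasurable (weightedFourier s h) volume := by
  unfold weightedFourier
  refine AEStronglyMeasurable.mul ?_ (Lp.aestronglyMeasurable _)
  have : Continuous fun ξ : ℝ => (((1 + ξ ^ 2) ^ (s / 2) : ℝ) : ℂ) := by
    refine Complex.continuous_ofReal.comp ?_
    refine Continuous.rpow_const (by fun_prop) fun x => Or.inl (by positivity)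
  exact this.aestronglyMeasurable

lemma abs_pow_le_weight {n : ℕ} {s : ℝ} (hs : (n : ℝ) ≤ s) (ξ : ℝ) :
    |ξ| ^ n ≤ (1 + ξ ^ 2) ^ (s / 2) := by
  have h1 : |ξ| ≤ (1 + ξ ^ 2) ^ (1 / 2 : ℝ) := by
    rw [← Real.sqrt_eq_rpow]
    exact Real.abs_le_sqrt (by linarith)
  calc |ξ| ^ n ≤ ((1 + ξ ^ 2) ^ (1 / 2 : ℝ)) ^ n := by gcongr
    _ = (1 + ξ ^ 2) ^ ((n : ℝ) / 2) := by
        rw [← Real.rpow_natCast _ n, ← Real.rpow_mul (by positivity)]; congr 1; ring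
    _ ≤ _ := by
        apply Real.rpow_le_rpow_of_exponent_le (by nlinarith [sq_nonneg ξ]); linarith

lemma weight_le (n : ℕ) (ξ : ℝ) :
    (1 + ξ ^ 2) ^ ((n : ℝ) / 2) ≤ 2 ^ n * (1 + |2 * Real.pi * ξ| ^ n) := by
  have h0 : (1 + ξ ^ 2) ^ (1 / 2 : ℝ) ≤ 1 + |ξ| := by
    rw [← Real.sqrt_eq_rpow, Real.sqrt_le_left (by positivity)]
    nlinarith [sq_abs ξ, abs_nonneg ξ]
  have h2 : |ξ| ≤ |2 * Real.pi * ξ| := by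
    rw [abs_mul, abs_of_pos (by positivity : (0 : ℝ) < 2 * Real.pi)]
    nlinarith [abs_nonneg ξ, Real.pi_gt_three]
  calc (1 + ξ ^ 2) ^ ((n : ℝ) / 2) = ((1 + ξ ^ 2) ^ (1 / 2 : ℝ)) ^ n := by
        rw [← Real.rpow_natCast _ n, ← Real.rpow_mul (by positivity)]; congr 1; ring
    _ ≤ (1 + |ξ|) ^ n := by gcongr
    _ ≤ 2 ^ n * (1 + |ξ| ^ n) := by
        rcases le_total |ξ| 1 with h | h
        · calc (1 + |ξ|) ^ n ≤ 2 ^ n := by gcongr; linarith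
            _ ≤ _ := le_mul_of_one_le_right (by positivity) (by linarith [pow_nonneg (abs_nonneg ξ) n])
        · calc (1 + |ξ|) ^ n ≤ (2 * |ξ|) ^ n := by gcongr; linarith
            _ = 2 ^ n * |ξ| ^ n := by rw [mul_pow]
            _ ≤ _ := by gcongr; linarith
    _ ≤ _ := by gcongr

lemma norm_symbol_pow_le {n : ℕ} {s : ℝ} (hs : (n : ℝ) ≤ s) (ξ : ℝ) :
    ‖(2 * Real.pi * Complex.I * ξ : ℂ) ^ n‖ ≤
      (2 * Real.pi) ^ n * ‖(((1 + ξ ^ 2) ^ (s / 2) : ℝ) : ℂ)‖ := by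
  have : ‖(2 * Real.pi * Complex.I * ξ : ℂ)‖ = 2 * Real.pi * |ξ| := by
    simp [abs_of_pos Real.pi_pos]
  have h2 : (0 : ℝ) ≤ (1 + ξ ^ 2) ^ (s / 2) := by positivity
  rw [norm_pow, this, mul_pow, Complex.norm_real, Real.norm_eq_abs, abs_of_nonneg h2]
  exact mul_le_mul_of_nonneg_left (abs_pow_le_weight hs ξ) (by positivity)

/-- Induction with `exists_memLp_deriv_fourier`: at each order the Sobolev weight dominates the
power of the symbol, and this supplies the square integrability required for the next derivative. -/
lemma exists_memLp_iteratedDeriv_fourier {v : ℝ → ℝ} {s : ℝ} (hm : MemH s v) :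
    ∀ n : ℕ, ContDiff ℝ n v → (n : ℝ) ≤ s →
    ∃ hn : MemLp (fun x => ((iteratedDeriv n v x : ℝ) : ℂ)) 2 volume,
      (𝓕 (hn.toLp _) : Lp ℂ 2 (volume : Measure ℝ)) =ᵐ[volume]
      fun ξ : ℝ => (2 * Real.pi * Complex.I * ξ) ^ n *
        (𝓕 (hm.memLp_ofReal.toLp _) : Lp ℂ 2 (volume : Measure ℝ)) ξ := by
  intro n
  induction n with
  | zero =>
    intro _ _
    simp only [iteratedDeriv_zero, pow_zero, one_mul]
    exact ⟨hm.memLp_ofReal, ae_eq_refl _⟩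
  | succ n ih =>
    intro hv hs
    push_cast at hs
    obtain ⟨hn, hF⟩ := ih (hv.of_le (by norm_cast; omega)) (by linarith)
    have hd : ∀ x, HasDerivAt (fun x => ((iteratedDeriv n v x : ℝ) : ℂ))
        ((iteratedDeriv (n + 1) v x : ℝ) : ℂ) x := by
      intro x
      have h1 : Differentiable ℝ (iteratedDeriv n v) :=
        hv.differentiable_iteratedDeriv n (by norm_cast; omega)
      have := (h1 x).hasDerivAt.ofReal_comp
      rwa [← iteratedDeriv_succ] at this
    have hc : Continuous fun x => ((iteratedDeriv (n + 1) v x : ℝ) : ℂ) :=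
      Complex.continuous_ofReal.comp (hv.continuous_iteratedDeriv (n + 1) le_rfl)
    have hmem : MemLp (fun ξ : ℝ => (2 * Real.pi * Complex.I * ξ) *
        (𝓕 (hn.toLp _) : Lp ℂ 2 (volume : Measure ℝ)) ξ) 2 volume := by
      have hW : MemLp (weightedFourier s hm.memLp_ofReal) 2 volume := by
        refine ⟨aestronglyMeasurable_weightedFourier s _, ?_⟩
        rw [← sobolevENorm_of_memLp]; exact hm
      refine hW.of_le_mul (c := (2 * Real.pi) ^ (n + 1)) ?_ ?_
      · refine AEStronglyMeasurable.mul ?_ (Lp.aestronglyMeasurable _)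
        exact Continuous.aestronglyMeasurable (by fun_prop)
      · filter_upwards [hF] with ξ hξ
        rw [hξ, ← mul_assoc, ← pow_succ', weightedFourier, norm_mul, norm_mul, ← mul_assoc]
        gcongr
        exact norm_symbol_pow_le (by push_cast; linarith) ξ
    obtain ⟨h', hF'⟩ := exists_memLp_deriv_fourier hd hc hn hmem
    refine ⟨h', hF'.trans ?_⟩
    filter_upwards [hF] with ξ hξ
    rw [hξ]; ring

lemma eLpNorm_fourier {v : ℝ → ℂ} (h : MemLp v 2 volume) :
    eLpNorm (𝓕 (h.toLp _) : Lp ℂ 2 (volume : Measure ℝ)) 2 volume = eLpNorm v 2 volume := by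
  rw [← Lp.enorm_def, ← eLpNorm_congr_ae h.coeFn_toLp, ← Lp.enorm_def,
    ← ofReal_norm, ← ofReal_norm, Lp.norm_fourier_eq]

lemma eLpNorm_ofReal (v : ℝ → ℝ) :
    eLpNorm (fun x => (v x : ℂ)) 2 volume = eLpNorm v 2 volume :=
  eLpNorm_congr_norm_ae (Eventually.of_forall fun x => by simp)

lemma MemLp.re_of_ofReal {v : ℝ → ℝ} (h : MemLp (fun x => (v x : ℂ)) 2 volume) :
    MemLp v 2 volume := by
  simpa using h.re

lemma memLp_iteratedDeriv {v : ℝ → ℝ} {s : ℝ} (hm : MemH s v) {n : ℕ} (hv : ContDiff ℝ n v)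
    (hs : (n : ℝ) ≤ s) : MemLp (iteratedDeriv n v) 2 volume := by
  obtain ⟨hn, -⟩ := exists_memLp_iteratedDeriv_fourier hm n hv hs
  exact MemLp.re_of_ofReal hn

lemma eLpNorm_iteratedDeriv_le {v : ℝ → ℝ} {s : ℝ} {n : ℕ} (hv : ContDiff ℝ n v)
    (hs : (n : ℝ) ≤ s) :
    eLpNorm (iteratedDeriv n v) 2 volume ≤
      ENNReal.ofReal ((2 * Real.pi) ^ n) * sobolevENorm s v := by
  by_cases hm : MemH s v
  · obtain ⟨hn, hF⟩ := exists_memLp_iteratedDeriv_fourier hm n hv hs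
    rw [← eLpNorm_ofReal, ← eLpNorm_fourier hn, sobolevENorm_of_memLp s hm.memLp_ofReal]
    apply eLpNorm_le_mul_eLpNorm_of_ae_le_mul
    filter_upwards [hF] with ξ hξ
    rw [hξ, weightedFourier, norm_mul, norm_mul, ← mul_assoc]
    gcongr
    exact norm_symbol_pow_le hs ξ
  · have : sobolevENorm s v = ⊤ := by
      unfold MemH at hm; exact not_lt_top_iff.1 hm
    rw [this, ENNReal.mul_top (by simp; positivity)]
    exact le_top

/-- The weight is pointwise at most `2^n (1 + |2πξ|^n)`, so the extreme derivatives suffice. The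
energies therefore need only `u` itself and its top derivative. -/
lemma sobolevENorm_le {v : ℝ → ℝ} {s : ℝ} {n : ℕ} (hm : MemH s v) (hv : ContDiff ℝ n v)
    (hs : (n : ℝ) ≤ s) :
    sobolevENorm n v ≤ ENNReal.ofReal (2 ^ n) *
      (eLpNorm v 2 volume + eLpNorm (iteratedDeriv n v) 2 volume) := by
  obtain ⟨hn, hF⟩ := exists_memLp_iteratedDeriv_fourier hm n hv hs
  have h0 := hm.memLp_ofReal
  rw [← eLpNorm_ofReal v, ← eLpNorm_ofReal (iteratedDeriv n v), ← eLpNorm_fourier hn,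
    ← eLpNorm_fourier h0, sobolevENorm_of_memLp n h0,
    ← eLpNorm_norm (𝓕 (h0.toLp _) : Lp ℂ 2 (volume : Measure ℝ)),
    ← eLpNorm_norm (𝓕 (hn.toLp _) : Lp ℂ 2 (volume : Measure ℝ))]
  refine le_trans ?_ (mul_le_mul_right (eLpNorm_add_le (Lp.aestronglyMeasurable _).norm
    (Lp.aestronglyMeasurable _).norm (by norm_num)) _)
  apply eLpNorm_le_mul_eLpNorm_of_ae_le_mul
  filter_upwards [hF] with ξ hξ
  have : ‖(2 * Real.pi * Complex.I * ξ : ℂ)‖ = |2 * Real.pi * ξ| := by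
    simp [abs_of_pos Real.pi_pos]
  rw [Pi.add_apply, hξ, weightedFourier, norm_mul, norm_mul, norm_pow, this, Complex.norm_real,
    Real.norm_eq_abs, abs_of_nonneg (by positivity), Real.norm_eq_abs,
    abs_of_nonneg (by positivity)]
  calc _ ≤ 2 ^ n * (1 + |2 * Real.pi * ξ| ^ n) * _ := by gcongr; exact weight_le n ξ
    _ = _ := by ring

lemma sobolevENorm_mono {s s' : ℝ} (h : s ≤ s') (v : ℝ → ℝ) :
    sobolevENorm s v ≤ sobolevENorm s' v := by
  by_cases h0 : MemLp (fun x => (v x : ℂ)) 2 volume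
  · rw [sobolevENorm_of_memLp s h0, sobolevENorm_of_memLp s' h0]
    apply eLpNorm_mono
    intro ξ
    rw [weightedFourier, weightedFourier, norm_mul, norm_mul, Complex.norm_real,
      Complex.norm_real, Real.norm_eq_abs, Real.norm_eq_abs, abs_of_nonneg (by positivity),
      abs_of_nonneg (by positivity)]
    gcongr
    nlinarith [sq_nonneg ξ]
  · unfold sobolevENorm; rw [dif_neg h0, dif_neg h0]

lemma sobolevENorm_of_not_memLp (s : ℝ) {v : ℝ → ℝ}
    (h : ¬ MemLp (fun x => (v x : ℂ)) 2 volume) : sobolevENorm s v = ⊤ := by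
  unfold sobolevENorm; rw [dif_neg h]

lemma sobolevENorm_add_le (s : ℝ) (v w : ℝ → ℝ) :
    sobolevENorm s (fun x => v x + w x) ≤ sobolevENorm s v + sobolevENorm s w := by
  by_cases hv : MemLp (fun x => (v x : ℂ)) 2 volume
  swap
  · rw [sobolevENorm_of_not_memLp s hv]; simp
  by_cases hw : MemLp (fun x => (w x : ℂ)) 2 volume
  swap
  · rw [sobolevENorm_of_not_memLp s hw]; simp
  have hvw : MemLp (fun x => ((v x + w x : ℝ) : ℂ)) 2 volume := by
    have := hv.add hw
    refine (memLp_congr_ae (Eventually.of_forall fun x => ?_)).1 this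
    simp
  rw [sobolevENorm_of_memLp s hv, sobolevENorm_of_memLp s hw, sobolevENorm_of_memLp s hvw]
  have e : hvw.toLp _ = hv.toLp _ + hw.toLp _ := by
    rw [← MemLp.toLp_add hv hw]
    congr 1
    ext x; simp
  refine le_trans (le_of_eq ?_) (eLpNorm_add_le (aestronglyMeasurable_weightedFourier s hv)
    (aestronglyMeasurable_weightedFourier s hw) (by norm_num))
  apply eLpNorm_congr_ae
  unfold weightedFourier
  rw [e, FourierTransform.fourier_add]
  filter_upwards [Lp.coeFn_add (𝓕 (hv.toLp _) : Lp ℂ 2 (volume : Measure ℝ)) (𝓕 (hw.toLp _))]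
    with ξ hξ
  simp only [hξ, Pi.add_apply]; ring

lemma sobolevENorm_const_mul_le (s c : ℝ) (v : ℝ → ℝ) (hv : MemLp (fun x => (v x : ℂ)) 2 volume) :
    sobolevENorm s (fun x => c * v x) ≤ ENNReal.ofReal |c| * sobolevENorm s v := by
  have hvw : MemLp (fun x => ((c * v x : ℝ) : ℂ)) 2 volume := by
    refine (memLp_congr_ae (Eventually.of_forall fun x => ?_)).1 (hv.const_mul (c : ℂ))
    simp
  rw [sobolevENorm_of_memLp s hv, sobolevENorm_of_memLp s hvw]
  have e : hvw.toLp _ = (c : ℂ) • hv.toLp _ := by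
    rw [← MemLp.toLp_const_smul]
    congr 1
    ext x; simp
  apply eLpNorm_le_mul_eLpNorm_of_ae_le_mul
  unfold weightedFourier
  rw [e, FourierTransform.fourier_smul]
  filter_upwards [Lp.coeFn_smul (c : ℂ) (𝓕 (hv.toLp _) : Lp ℂ 2 (volume : Measure ℝ))]
    with ξ hξ
  rw [hξ]
  simp only [Pi.smul_apply, smul_eq_mul, norm_mul, Complex.norm_real, Real.norm_eq_abs]
  apply le_of_eq; ring


/-! ### Real-valued `L²` calculus on the line. -/

/-- The `L²(ℝ)` norm as a real number. -/
noncomputable def l2 (v : ℝ → ℝ) : ℝ := (eLpNorm v 2 volume).toReal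

lemma l2_nonneg (v : ℝ → ℝ) : 0 ≤ l2 v := ENNReal.toReal_nonneg

lemma l2_sq {v : ℝ → ℝ} (h : MemLp v 2 volume) : ∫ x, v x ^ 2 = l2 v ^ 2 := by
  have h1 : eLpNorm v 2 volume = _ := h.eLpNorm_eq_integral_rpow_norm (by norm_num) (by norm_num)
  unfold l2
  rw [h1, ENNReal.toReal_ofReal (by positivity)]
  simp only [ENNReal.toReal_ofNat, Real.rpow_ofNat, Real.norm_eq_abs, sq_abs]
  rw [← Real.rpow_natCast, ← Real.rpow_mul (integral_nonneg fun x => sq_nonneg _)]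
  norm_num

lemma integrable_mul {v w : ℝ → ℝ} (hv : MemLp v 2 volume) (hw : MemLp w 2 volume) :
    Integrable (fun x => v x * w x) := hv.integrable_mul hw

lemma integral_abs_mul_le {v w : ℝ → ℝ} (hv : MemLp v 2 volume) (hw : MemLp w 2 volume) :
    ∫ x, |v x * w x| ≤ l2 v * l2 w := by
  have h := integral_mul_norm_le_Lp_mul_Lq (μ := volume) (f := v) (g := w)
    (p := 2) (q := 2) (by constructor <;> norm_num) (by simpa using hv) (by simpa using hw)
  have e : ∀ {u : ℝ → ℝ}, MemLp u 2 volume → (∫ x, ‖u x‖ ^ (2 : ℝ)) ^ (1 / 2 : ℝ) = l2 u := by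
    intro u hu
    have : ∀ x, ‖u x‖ ^ (2 : ℝ) = u x ^ 2 := fun x => by simp
    simp_rw [this]
    rw [l2_sq hu, ← Real.sqrt_eq_rpow, Real.sqrt_sq (l2_nonneg _)]
  rw [e hv, e hw] at h
  simpa [abs_mul] using h

lemma abs_integral_mul_le {v w : ℝ → ℝ} (hv : MemLp v 2 volume) (hw : MemLp w 2 volume) :
    |∫ x, v x * w x| ≤ l2 v * l2 w :=
  (abs_integral_le_integral_abs).trans (integral_abs_mul_le hv hw)

/-- The weighted Cauchy–Schwarz inequality. -/
lemma abs_integral_mul_mul_le {r v w : ℝ → ℝ} {C : ℝ} (hr : ∀ x, |r x| ≤ C)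
    (hv : MemLp v 2 volume) (hw : MemLp w 2 volume) :
    |∫ x, r x * (v x * w x)| ≤ C * (l2 v * l2 w) := by
  refine abs_integral_le_integral_abs.trans ?_
  calc ∫ x, |r x * (v x * w x)| ≤ ∫ x, C * |v x * w x| := by
        apply integral_mono_of_nonneg (Eventually.of_forall fun x => abs_nonneg _)
          ((integrable_mul hv hw).abs.const_mul C)
        refine Eventually.of_forall fun x => ?_
        simp only [abs_mul]
        exact mul_le_mul_of_nonneg_right (hr x) (by positivity)
    _ = C * ∫ x, |v x * w x| := integral_const_mul _ _
    _ ≤ _ := mul_le_mul_of_nonneg_left (integral_abs_mul_le hv hw) ((abs_nonneg _).trans (hr 0))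

lemma l2_add_le {v w : ℝ → ℝ} (hv : MemLp v 2 volume) (hw : MemLp w 2 volume) :
    l2 (fun x => v x + w x) ≤ l2 v + l2 w := by
  unfold l2
  rw [← ENNReal.toReal_add hv.2.ne hw.2.ne]
  exact ENNReal.toReal_mono (by simp [hv.2.ne, hw.2.ne])
    (eLpNorm_add_le hv.1 hw.1 (by norm_num))

lemma l2_le_of_abs_le {v w : ℝ → ℝ} (hw : MemLp w 2 volume) {C : ℝ}
    (h : ∀ x, |v x| ≤ C * |w x|) (hC : 0 ≤ C) : l2 v ≤ C * l2 w := by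
  unfold l2
  rw [← ENNReal.toReal_ofReal hC, ← ENNReal.toReal_mul]
  refine ENNReal.toReal_mono (ENNReal.mul_ne_top ENNReal.ofReal_ne_top hw.2.ne) ?_
  exact eLpNorm_le_mul_eLpNorm_of_ae_le_mul (Eventually.of_forall fun x => by simpa using h x) 2

lemma l2_const_mul (c : ℝ) (v : ℝ → ℝ) : l2 (fun x => c * v x) = |c| * l2 v := by
  unfold l2
  have := eLpNorm_const_smul c v 2 (volume : Measure ℝ)
  rw [show (fun x => c * v x) = c • v from rfl, this]
  simp

lemma l2_abs (v : ℝ → ℝ) : l2 (fun x => |v x|) = l2 v := by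
  unfold l2
  rw [← eLpNorm_norm v]; rfl

lemma memLp_of_bdd_mul {r v : ℝ → ℝ} {C : ℝ} (hr : Continuous r) (hC : ∀ x, |r x| ≤ C)
    (hv : MemLp v 2 volume) : MemLp (fun x => r x * v x) 2 volume := by
  refine MemLp.of_le_mul (c := C) hv (hr.aestronglyMeasurable.mul hv.1)
    (Eventually.of_forall fun x => ?_)
  rw [Real.norm_eq_abs, Real.norm_eq_abs, abs_mul]
  exact mul_le_mul_of_nonneg_right (hC x) (abs_nonneg _)

lemma memLp_of_abs_le {v w : ℝ → ℝ} {C : ℝ} (hv : Continuous v) (hC : ∀ x, |v x| ≤ C * |w x|)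
    (hw : MemLp w 2 volume) : MemLp v 2 volume :=
  MemLp.of_le_mul (c := C) hw hv.aestronglyMeasurable (Eventually.of_forall fun x => hC x)

lemma integrable_bdd_mul {r F : ℝ → ℝ} {C : ℝ} (hr : Continuous r) (hC : ∀ x, |r x| ≤ C)
    (hF : Integrable F) : Integrable (fun x => r x * F x) :=
  hF.bdd_mul (c := C) hr.aestronglyMeasurable (Eventually.of_forall fun x => hC x)

/-- The one-dimensional Sobolev inequality. -/
lemma abs_le_l2_add_l2 {v v' : ℝ → ℝ} (hd : ∀ x, HasDerivAt v (v' x) x)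
    (hv : MemLp v 2 volume) (hv' : MemLp v' 2 volume) (x : ℝ) : |v x| ≤ l2 v + l2 v' := by
  have hd2 : ∀ y, HasDerivAt (fun y => v y ^ 2) (2 * (v y * v' y)) y := fun y => by
    have := ((hd y).fun_mul (hd y)).congr_deriv (g' := 2 * (v y * v' y)) (by ring)
    simpa only [← sq] using this
  have hi2 : Integrable (fun y => v y ^ 2) := hv.integrable_sq
  have hi : Integrable (fun y => 2 * (v y * v' y)) := (integrable_mul hv hv').const_mul 2
  -- Both `v²` and its derivative are integrable, which forces decay at `-∞`; thus `v(x)²` is the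
  -- integral of `2 v v'` up to `x`.
  have ht : Tendsto (fun y => v y ^ 2) atBot (𝓝 0) :=
    tendsto_zero_of_hasDerivAt_of_integrableOn_Iic (a := x) (fun y _ => hd2 y)
      hi.integrableOn hi2.integrableOn
  have hint := integral_Iic_of_hasDerivAt_of_tendsto' (a := x) (fun y _ => hd2 y)
    hi.integrableOn ht
  rw [sub_zero] at hint
  have hle : v x ^ 2 ≤ 2 * (l2 v * l2 v') := by
    rw [← hint]
    calc ∫ y in Set.Iic x, 2 * (v y * v' y) ≤ ∫ y in Set.Iic x, 2 * |v y * v' y| := by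
          apply integral_mono hi.integrableOn
            ((integrable_mul hv hv').abs.const_mul 2).integrableOn
          intro y; exact mul_le_mul_of_nonneg_left (le_abs_self _) (by norm_num)
      _ ≤ ∫ y, 2 * |v y * v' y| := by
          apply setIntegral_le_integral ((integrable_mul hv hv').abs.const_mul 2)
          exact Eventually.of_forall fun y => by positivity
      _ = 2 * ∫ y, |v y * v' y| := integral_const_mul _ _
      _ ≤ _ := by gcongr; exact integral_abs_mul_le hv hv'
  apply abs_le_of_sq_le_sq _ (add_nonneg (l2_nonneg _) (l2_nonneg _))
  nlinarith [sq_nonneg (l2 v), sq_nonneg (l2 v')]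

/-- In the energy estimates, integrations by parts are carried out by exhibiting an integrable
primitive of the difference of the two sides. -/
lemma integral_eq_zero_of_deriv {F F' : ℝ → ℝ} (hd : ∀ x, HasDerivAt F (F' x) x)
    (hF : Integrable F) (hF' : Integrable F') : ∫ x, F' x = 0 :=
  integral_eq_zero_of_hasDerivAt_of_integrable (fun x => hd x) hF' hF

/-- Interpolation of the first derivative between the function and its second derivative. -/
lemma l2_deriv_sq_le {w w₁ w₂ : ℝ → ℝ} (h : ∀ x, HasDerivAt w (w₁ x) x)
    (h₁ : ∀ x, HasDerivAt w₁ (w₂ x) x) (hw : MemLp w 2 volume) (hw₁ : MemLp w₁ 2 volume)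
    (hw₂ : MemLp w₂ 2 volume) : l2 w₁ ^ 2 ≤ l2 w * l2 w₂ := by
  have h0 := integral_eq_zero_of_deriv (fun x => (h x).mul (h₁ x)) (integrable_mul hw hw₁)
    ((integrable_mul hw₁ hw₁).add (integrable_mul hw hw₂))
  rw [integral_add (integrable_mul hw₁ hw₁) (integrable_mul hw hw₂)] at h0
  have h2 : ∫ x, w₁ x * w₁ x = l2 w₁ ^ 2 := by
    rw [← l2_sq hw₁]; congr 1; ext x; ring
  have := abs_le.1 (abs_integral_mul_le hw hw₂)
  linarith [this.1]

/-- A bound by the `H^s` norm, for functions of class `C^n` with `n ≤ s`. -/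
lemma l2_iteratedDeriv_le {v : ℝ → ℝ} {s : ℝ} {n : ℕ} (hv : ContDiff ℝ n v)
    (hs : (n : ℝ) ≤ s) (hm : MemH s v) :
    l2 (iteratedDeriv n v) ≤ (2 * Real.pi) ^ n * (sobolevENorm s v).toReal := by
  have h1 := eLpNorm_iteratedDeriv_le hv hs
  have h2 := ENNReal.toReal_mono (ENNReal.mul_ne_top ENNReal.ofReal_ne_top hm.ne) h1
  rwa [ENNReal.toReal_mul, ENNReal.toReal_ofReal (by positivity)] at h2

lemma hasDerivAt_iteratedDeriv {v : ℝ → ℝ} {m n : ℕ} (hv : ContDiff ℝ m v) (h : n < m) (x : ℝ) :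
    HasDerivAt (iteratedDeriv n v) (iteratedDeriv (n + 1) v x) x := by
  have h1 : Differentiable ℝ (iteratedDeriv n v) :=
    hv.differentiable_iteratedDeriv n (by exact_mod_cast h)
  rw [iteratedDeriv_succ]
  exact (h1 x).hasDerivAt

lemma toReal_sobolevENorm_le {v : ℝ → ℝ} {s : ℝ} {n : ℕ} (hm : MemH s v) (hv : ContDiff ℝ n v)
    (hs : (n : ℝ) ≤ s) :
    (sobolevENorm n v).toReal ≤ 2 ^ n * (l2 v + l2 (iteratedDeriv n v)) := by
  have h1 := sobolevENorm_le hm hv hs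
  have a := memLp_iteratedDeriv hm (n := 0) (hv.of_le (by norm_cast; omega))
    (le_trans (by simp) hs)
  rw [iteratedDeriv_zero] at a
  have b := memLp_iteratedDeriv hm hv hs
  have h2 := ENNReal.toReal_mono (ENNReal.mul_ne_top ENNReal.ofReal_ne_top
    (ENNReal.add_ne_top.2 ⟨a.2.ne, b.2.ne⟩)) h1
  rwa [ENNReal.toReal_mul, ENNReal.toReal_ofReal (by positivity),
    ENNReal.toReal_add a.2.ne b.2.ne] at h2


/-! ### Calculus in the classes of mixed regularity. -/

/-- `D` is a family of derivatives of `F` as required in `MixedRegularity`. -/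
def IsDerivFamily {d : ℕ} (m n : ℕ) (I : Set ℝ) (F : (Fin d → ℝ) → ℝ → ℝ → ℝ)
    (D : ℕ → (Fin d → ℕ) → ℕ → (Fin d → ℝ) → ℝ → ℝ → ℝ) : Prop :=
    (∀ z x, ∀ t ∈ I, D 0 0 0 z x t = F z x t) ∧
    (∀ β γ, ∑ i, β i ≤ m → γ ≤ n → ∀ z x, ∀ t ∈ I,
      HasDerivWithinAt (fun s => D 0 β γ z x s) (D 1 β γ z x t) I t) ∧
    (∀ α β γ, α ≤ 1 → ∑ i, β i < m → γ ≤ n → ∀ i z x, ∀ t ∈ I,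
      HasDerivAt (fun s => D α β γ (Function.update z i s) x t)
        (D α (β + Pi.single i 1) γ z x t) (z i)) ∧
    (∀ α β γ, α ≤ 1 → ∑ i, β i ≤ m → γ < n → ∀ z, ∀ t ∈ I, ∀ a b : ℝ,
      D α β γ z b t - D α β γ z a t = ∫ x in a..b, D α β (γ + 1) z x t) ∧
    (∀ α β γ, α ≤ 1 → ∑ i, β i ≤ m → γ ≤ n →
      (∀ z, ∀ t ∈ I, AEStronglyMeasurable (fun x => D α β γ z x t) volume) ∧
      (∀ x, ContinuousOn (fun p : (Fin d → ℝ) × ℝ => D α β γ p.1 x p.2) (Set.univ ×ˢ I)) ∧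
      ∃ C : ℝ → ℝ, Monotone C ∧ (∀ s, 0 < C s) ∧
        ∀ z x, ∀ t ∈ I, |D α β γ z x t| ≤ C ‖z‖)

lemma MixedRegularity.exists_family {d m n : ℕ} {I : Set ℝ} {F : (Fin d → ℝ) → ℝ → ℝ → ℝ}
    (h : MixedRegularity m n I F) : ∃ D, IsDerivFamily m n I F D := h

lemma sum_add_single {d : ℕ} (β : Fin d → ℕ) (i : Fin d) :
    ∑ j, (β + Pi.single i 1 : Fin d → ℕ) j = ∑ j, β j + 1 := by
  simp [Finset.sum_add_distrib]

variable {d m n : ℕ} {I : Set ℝ} {F : (Fin d → ℝ) → ℝ → ℝ → ℝ}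
  {D : ℕ → (Fin d → ℕ) → ℕ → (Fin d → ℝ) → ℝ → ℝ → ℝ}

lemma IsDerivFamily.bound (h : IsDerivFamily m n I F D) {α γ : ℕ} {β : Fin d → ℕ} (hα : α ≤ 1)
    (hβ : ∑ i, β i ≤ m) (hγ : γ ≤ n) (R : ℝ) :
    ∃ C, 0 < C ∧ ∀ z x, ∀ t ∈ I, ‖z‖ ≤ R → |D α β γ z x t| ≤ C := by
  obtain ⟨-, -, C, hC, hpos, hb⟩ := h.2.2.2.2 α β γ hα hβ hγ
  exact ⟨C R, hpos R, fun z x t ht hz => (hb z x t ht).trans (hC hz)⟩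

lemma IsDerivFamily.lipschitz_x (h : IsDerivFamily m n I F D) {α γ : ℕ} {β : Fin d → ℕ}
    (hα : α ≤ 1) (hβ : ∑ i, β i ≤ m) (hγ : γ < n) (R : ℝ) :
    ∃ C, 0 < C ∧ ∀ z, ∀ t ∈ I, ‖z‖ ≤ R → ∀ a b,
      |D α β γ z b t - D α β γ z a t| ≤ C * |b - a| := by
  obtain ⟨C, hC, hb⟩ := h.bound hα hβ (γ := γ + 1) hγ R
  refine ⟨C, hC, fun z t ht hz a b => ?_⟩
  rw [h.2.2.2.1 α β γ hα hβ hγ z t ht a b]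
  rw [← Real.norm_eq_abs]
  exact intervalIntegral.norm_integral_le_of_norm_le_const fun x _ => hb z x t ht hz

/-- Continuity in `z` is given for fixed `x` only. The Lipschitz bound in `x`, locally uniform in
`z`, makes it joint; this uses one further weak derivative, hence `γ < n`. -/
lemma IsDerivFamily.continuous (h : IsDerivFamily m n I F D) {α γ : ℕ} {β : Fin d → ℕ}
    (hα : α ≤ 1) (hβ : ∑ i, β i ≤ m) (hγ : γ < n) {t : ℝ} (ht : t ∈ I) :
    Continuous fun p : (Fin d → ℝ) × ℝ => D α β γ p.1 p.2 t := by
  rw [continuous_iff_continuousAt]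
  rintro ⟨z₀, x₀⟩
  obtain ⟨C, hC, hL⟩ := h.lipschitz_x hα hβ hγ (‖z₀‖ + 1)
  have hz : Continuous fun z => D α β γ z x₀ t := by
    have := (h.2.2.2.2 α β γ hα hβ hγ.le).2.1 x₀
    exact continuousOn_univ.1 (this.comp (g := fun p : (Fin d → ℝ) × ℝ => D α β γ p.1 x₀ p.2)
      (f := fun z : Fin d → ℝ => (z, t)) (s := Set.univ) (by fun_prop)
      (fun z _ => ⟨trivial, ht⟩))
  have h1 : Tendsto (fun p : (Fin d → ℝ) × ℝ => D α β γ p.1 x₀ t) (𝓝 (z₀, x₀))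
      (𝓝 (D α β γ z₀ x₀ t)) := ((hz.comp continuous_fst).tendsto (z₀, x₀))
  have h2 : Tendsto (fun p : (Fin d → ℝ) × ℝ => D α β γ p.1 p.2 t - D α β γ p.1 x₀ t)
      (𝓝 (z₀, x₀)) (𝓝 0) := by
    apply squeeze_zero_norm' (a := fun p : (Fin d → ℝ) × ℝ => C * |p.2 - x₀|)
    · have : ∀ᶠ p : (Fin d → ℝ) × ℝ in 𝓝 (z₀, x₀), ‖p.1‖ < ‖z₀‖ + 1 :=
        (continuous_fst.norm.tendsto (z₀, x₀)).eventually (gt_mem_nhds (by simp))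
      filter_upwards [this] with p hp
      exact hL p.1 t ht hp.le x₀ p.2
    · have : Continuous fun p : (Fin d → ℝ) × ℝ => C * |p.2 - x₀| := by fun_prop
      simpa using this.tendsto (z₀, x₀)
  have := h2.add h1
  simpa [ContinuousAt] using this

/-- A weak derivative in `x` is classical once it is continuous, so two orders below the top are
needed: one for the derivative and one for its continuity. -/
lemma IsDerivFamily.hasDerivAt_x (h : IsDerivFamily m n I F D) {α γ : ℕ} {β : Fin d → ℕ}
    (hα : α ≤ 1) (hβ : ∑ i, β i ≤ m) (hγ : γ + 1 < n) {t : ℝ} (ht : t ∈ I)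
    (z : Fin d → ℝ) (x : ℝ) :
    HasDerivAt (fun y => D α β γ z y t) (D α β (γ + 1) z x t) x := by
  have hc : Continuous fun y => D α β (γ + 1) z y t :=
    (h.continuous hα hβ hγ ht).comp (by fun_prop : Continuous fun y : ℝ => (z, y))
  have h1 : HasDerivAt (fun y => D α β γ z x t + ∫ s in x..y, D α β (γ + 1) z s t)
      (D α β (γ + 1) z x t) x :=
    (hc.integral_hasStrictDerivAt x x).hasDerivAt.const_add _
  convert h1 using 1
  ext y
  rw [← h.2.2.2.1 α β γ hα hβ (by omega) z t ht x y]
  ring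

lemma IsDerivFamily.hasDerivAt_z (h : IsDerivFamily m n I F D) {α γ : ℕ} {β : Fin d → ℕ}
    (hα : α ≤ 1) (hβ : ∑ i, β i < m) (hγ : γ ≤ n) {t : ℝ} (ht : t ∈ I) (i : Fin d)
    (z : Fin d → ℝ) (x s : ℝ) :
    HasDerivAt (fun s => D α β γ (Function.update z i s) x t)
      (D α (β + Pi.single i 1) γ (Function.update z i s) x t) s := by
  have := h.2.2.1 α β γ hα hβ hγ i (Function.update z i s) x t ht
  simpa using this

lemma IsDerivFamily.lipschitz_t (h : IsDerivFamily m n I F D) (hI : Convex ℝ I) {γ : ℕ}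
    {β : Fin d → ℕ} (hβ : ∑ i, β i ≤ m) (hγ : γ ≤ n) (R : ℝ) :
    ∃ C, 0 < C ∧ ∀ z x, ‖z‖ ≤ R → ∀ t ∈ I, ∀ s ∈ I,
      |D 0 β γ z x t - D 0 β γ z x s| ≤ C * |t - s| := by
  obtain ⟨C, hC, hb⟩ := h.bound (α := 1) le_rfl hβ hγ R
  refine ⟨C, hC, fun z x hz t ht s hs => ?_⟩
  exact hI.norm_image_sub_le_of_norm_hasDerivWithin_le
    (fun r hr => h.2.1 β γ hβ hγ z x r hr) (fun r hr => hb z x r hr hz) hs ht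

/-- A function whose partial derivatives are bounded on a cube is Lipschitz there. -/
lemma abs_sub_le_of_partial {d : ℕ} {G : (Fin d → ℝ) → ℝ} {G' : Fin d → (Fin d → ℝ) → ℝ}
    {R L : ℝ}
    (hd : ∀ i z s, HasDerivAt (fun s => G (Function.update z i s)) (G' i (Function.update z i s)) s)
    (hL : ∀ i z, ‖z‖ ≤ R → |G' i z| ≤ L) {z w : Fin d → ℝ} (hz : ‖z‖ ≤ R) (hw : ‖w‖ ≤ R) :
    |G z - G w| ≤ L * ∑ i, |z i - w i| := by
  classical
  -- Coordinates are exchanged one at a time. The norm is the maximum norm, so the intermediate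
  -- points stay in the cube.
  have key : ∀ S : Finset (Fin d),
      |G (fun i => if i ∈ S then z i else w i) - G w| ≤ L * ∑ i ∈ S, |z i - w i| := by
    intro S
    induction S using Finset.induction_on with
    | empty => simp
    | insert j S hj ih =>
      set q : Fin d → ℝ := fun i => if i ∈ S then z i else w i with hq
      have e1 : (fun i => if i ∈ insert j S then z i else w i) = Function.update q j (z j) := by
        ext i
        by_cases hij : i = j
        · subst hij; simp
        · simp [hij, hq]
      have e2 : q = Function.update q j (w j) := by
        ext i
        by_cases hij : i = j
        · subst hij; simp [hq, hj]
        · simp [hij]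
      have hR : 0 ≤ R := (norm_nonneg z).trans hz
      have hqR : ∀ s, |s| ≤ R → ‖Function.update q j s‖ ≤ R := by
        intro s hs
        rw [pi_norm_le_iff_of_nonneg hR]
        intro i
        by_cases hij : i = j
        · subst hij; simpa using hs
        · simp only [ne_eq, hij, not_false_eq_true, Function.update_of_ne, hq]
          split_ifs
          · exact (norm_le_pi_norm z i).trans hz
          · exact (norm_le_pi_norm w i).trans hw
      have hstep : |G (Function.update q j (z j)) - G (Function.update q j (w j))|
          ≤ L * |z j - w j| := by
        refine (convex_Icc (-R) R).norm_image_sub_le_of_norm_hasDerivWithin_le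
          (f := fun s => G (Function.update q j s))
          (fun s _ => (hd j q s).hasDerivWithinAt)
          (fun s hs => hL j _ (hqR s (abs_le.2 hs))) ?_ ?_
        · exact abs_le.1 ((norm_le_pi_norm w j).trans hw)
        · exact abs_le.1 ((norm_le_pi_norm z j).trans hz)
      rw [e1, Finset.sum_insert hj, mul_add]
      calc |G (Function.update q j (z j)) - G w|
          ≤ |G (Function.update q j (z j)) - G (Function.update q j (w j))|
            + |G q - G w| := by
              rw [← e2]; exact abs_sub_le _ _ _
        _ ≤ _ := add_le_add hstep ih
  simpa using key Finset.univ

lemma IsDerivFamily.lipschitz_z (h : IsDerivFamily m n I F D) {α γ : ℕ} {β : Fin d → ℕ}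
    (hα : α ≤ 1) (hβ : ∑ i, β i < m) (hγ : γ ≤ n) (R : ℝ) :
    ∃ C, 0 < C ∧ ∀ z w x, ‖z‖ ≤ R → ‖w‖ ≤ R → ∀ t ∈ I,
      |D α β γ z x t - D α β γ w x t| ≤ C * ∑ i, |z i - w i| := by
  have hs : ∀ i : Fin d, ∑ j, (β + Pi.single i 1 : Fin d → ℕ) j ≤ m := fun i => by
    rw [sum_add_single]; omega
  choose C hC hb using fun i : Fin d => h.bound hα (hs i) hγ R
  refine ⟨∑ i, C i + 1, add_pos_of_nonneg_of_pos (Finset.sum_nonneg fun i _ => (hC i).le) one_pos,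
    fun z w x hz hw t ht => ?_⟩
  refine abs_sub_le_of_partial (G := fun z => D α β γ z x t)
    (G' := fun i z => D α (β + Pi.single i 1) γ z x t)
    (fun i z s => h.hasDerivAt_z hα hβ hγ ht i z x s) (fun i z hz => ?_) hz hw
  refine (hb i z x t ht hz).trans ?_
  have := Finset.single_le_sum (f := C) (fun i _ => (hC i).le) (Finset.mem_univ i)
  linarith

/-- The one-variable step in the chain rule for functions with continuous partial derivatives. -/
lemma hasDerivAt_sub_of_partial {X : Type*} [TopologicalSpace X] {H H' : X → ℝ → ℝ}
    (hd : ∀ w s, HasDerivAt (H w) (H' w s) s) (hc : Continuous fun p : X × ℝ => H' p.1 p.2)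
    {q : ℝ → X} (hq : Continuous q) {r : ℝ → ℝ} (hr : Continuous r) {r' x : ℝ}
    (hr' : HasDerivAt r r' x) :
    HasDerivAt (fun y => H (q y) (r y) - H (q y) (r x)) (H' (q x) (r x) * r') x := by
  -- `K` is the mean of `H'` over the segment from `r x` to `r y`. The increment factors as `(r y -
  -- r x) * K y` with `K` continuous, so only continuity of `q` enters.
  set K : ℝ → ℝ := fun y => ∫ θ in (0 : ℝ)..1, H' (q y) (r x + θ * (r y - r x)) with hK
  have hKc : Continuous K := by
    apply intervalIntegral.continuous_parametric_intervalIntegral_of_continuous'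
    exact hc.comp (f := fun p : ℝ × ℝ => (q p.1, r x + p.2 * (r p.1 - r x))) (by fun_prop)
  have hKx : K x = H' (q x) (r x) := by simp [hK]
  have hrep : ∀ y, H (q y) (r y) - H (q y) (r x) = (r y - r x) * K y := by
    intro y
    have h1 : ∀ θ : ℝ, HasDerivAt (fun θ => H (q y) (r x + θ * (r y - r x)))
        (H' (q y) (r x + θ * (r y - r x)) * (r y - r x)) θ := by
      intro θ
      have h2 : HasDerivAt (fun θ : ℝ => r x + θ * (r y - r x)) (r y - r x) θ := by
        simpa using ((hasDerivAt_id θ).mul_const (r y - r x)).const_add (r x)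
      exact (hd (q y) _).comp θ h2
    have hc' : Continuous fun θ : ℝ => H' (q y) (r x + θ * (r y - r x)) * (r y - r x) :=
      (hc.comp (f := fun θ : ℝ => (q y, r x + θ * (r y - r x))) (by fun_prop)).mul
        continuous_const
    have := intervalIntegral.integral_eq_sub_of_hasDerivAt (a := 0) (b := 1)
      (fun θ _ => h1 θ) (hc'.intervalIntegrable 0 1)
    rw [intervalIntegral.integral_mul_const] at this
    simp only [one_mul, add_sub_cancel, zero_mul, add_zero] at this
    rw [← this]; ring
  rw [funext hrep, hasDerivAt_iff_tendsto_slope]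
  have h3 := (hasDerivAt_iff_tendsto_slope.1 hr').mul
    ((hKc.tendsto x).mono_left (nhdsWithin_le_nhds (s := {x}ᶜ)))
  rw [hKx, mul_comm] at h3
  refine h3.congr fun y => ?_
  simp [slope_def_field]
  ring

/-- Only partial derivatives are available. The increment is telescoped: the arguments in `S` move
with `y` while the others stay frozen at `x`, and the explicit variable `x` is released last. Joint
continuity of each partial derivative makes every one-variable step legitimate. -/
lemma IsDerivFamily.hasDerivAt_comp (h : IsDerivFamily m n I F D) {α γ : ℕ} {β : Fin d → ℕ}
    (hα : α ≤ 1) (hβ : ∑ i, β i < m) (hγ : γ + 1 < n) {t : ℝ} (ht : t ∈ I)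
    {p : ℝ → Fin d → ℝ} (hp : Continuous p) {p' : Fin d → ℝ} {x : ℝ}
    (hp' : ∀ i, HasDerivAt (fun y => p y i) (p' i) x) :
    HasDerivAt (fun y => D α β γ (p y) y t)
      (∑ i, D α (β + Pi.single i 1) γ (p x) x t * p' i + D α β (γ + 1) (p x) x t) x := by
  classical
  have hs : ∀ i : Fin d, ∑ j, (β + Pi.single i 1 : Fin d → ℕ) j ≤ m := fun i => by
    rw [sum_add_single]; omega
  have key : ∀ S : Finset (Fin d),
      HasDerivAt (fun y => D α β γ (fun i => if i ∈ S then p y i else p x i) x t)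
        (∑ i ∈ S, D α (β + Pi.single i 1) γ (p x) x t * p' i) x := by
    intro S
    induction S using Finset.induction_on with
    | empty => simpa using hasDerivAt_const x _
    | insert j S hj ih =>
      set q : ℝ → Fin d → ℝ := fun y i => if i ∈ S then p y i else p x i with hq
      have hqc : Continuous q := by
        refine continuous_pi fun i => ?_
        by_cases hi : i ∈ S
        · have : Continuous fun y => p y i := (continuous_apply i).comp hp
          simpa [hq, hi] using this
        · simpa [hq, hi] using continuous_const
      have e1 : ∀ y, (fun i => if i ∈ insert j S then p y i else p x i)
          = Function.update (q y) j (p y j) := by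
        intro y
        ext i
        by_cases hij : i = j
        · subst hij; simp
        · simp [hij, hq]
      have e2 : ∀ y, q y = Function.update (q y) j (p x j) := by
        intro y
        ext i
        by_cases hij : i = j
        · subst hij; simp [hq, hj]
        · simp [hij]
      have e3 : q x = p x := by ext i; simp [hq]
      have h1 := hasDerivAt_sub_of_partial (X := Fin d → ℝ)
        (H := fun w s => D α β γ (Function.update w j s) x t)
        (H' := fun w s => D α (β + Pi.single j 1) γ (Function.update w j s) x t)
        (fun w s => h.hasDerivAt_z hα hβ (by omega) ht j w x s)
        ((h.continuous hα (hs j) (by omega) ht).comp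
          (f := fun p : (Fin d → ℝ) × ℝ => (Function.update p.1 j p.2, x))
          ((continuous_fst.update j continuous_snd).prodMk continuous_const))
        hqc ((continuous_apply j).comp hp) (hp' j)
      rw [Finset.sum_insert hj]
      have h2 := h1.add ih
      simp only [Function.comp_apply] at h2
      rw [← e2 x, e3] at h2
      refine h2.congr_of_eventuallyEq (Eventually.of_forall fun y => ?_)
      simp only [Pi.add_apply]
      rw [e1 y, ← e2 y]
      simp [hq]
  have h1 := hasDerivAt_sub_of_partial (X := Fin d → ℝ)
    (H := fun w s => D α β γ w s t) (H' := fun w s => D α β (γ + 1) w s t)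
    (fun w s => h.hasDerivAt_x hα hβ.le hγ ht w s) (h.continuous hα hβ.le (by omega) ht)
    hp continuous_id (hasDerivAt_id x)
  have h2 := h1.add (key Finset.univ)
  simp only [id_eq, Finset.mem_univ, if_true, mul_one] at h2
  rw [add_comm]
  refine h2.congr_of_eventuallyEq (Eventually.of_forall fun y => ?_)
  simp


/-! ### Differential polynomials and their total derivatives. -/

/-- The infinite jet of a function. -/
noncomputable def jetSeq (u : ℝ → ℝ) (x : ℝ) : ℕ → ℝ := fun j => iteratedDeriv j u x

/-- A coefficient of the family `D`, as a function of the jet. -/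
def jetCoef (D : (Fin 4 → ℕ) → ℕ → (Fin 4 → ℝ) → ℝ → ℝ → ℝ) (β : Fin 4 → ℕ) (γ : ℕ) :
    (ℕ → ℝ) → ℝ → ℝ → ℝ := fun z x t => D β γ (fun i => z i) x t

/-- Polynomials in `z_0, …, z_n` with coefficients in the family `D`, of total order at most `k`. -/
inductive JetFun (D : (Fin 4 → ℕ) → ℕ → (Fin 4 → ℝ) → ℝ → ℝ → ℝ) (n k : ℕ) :
    ((ℕ → ℝ) → ℝ → ℝ → ℝ) → Prop
  | coef (β : Fin 4 → ℕ) (γ : ℕ) (h : ∑ i, β i + γ ≤ k) (hn : 3 ≤ n) :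
      JetFun D n k (jetCoef D β γ)
  | var (j : ℕ) (h : j ≤ n) : JetFun D n k (fun z _ _ => z j)
  | const (c : ℝ) : JetFun D n k (fun _ _ _ => c)
  | add {F G : (ℕ → ℝ) → ℝ → ℝ → ℝ} (hF : JetFun D n k F) (hG : JetFun D n k G) :
      JetFun D n k (fun z x t => F z x t + G z x t)
  | mul {F G : (ℕ → ℝ) → ℝ → ℝ → ℝ} (hF : JetFun D n k F) (hG : JetFun D n k G) :
      JetFun D n k (fun z x t => F z x t * G z x t)

namespace JetFun

variable {D : (Fin 4 → ℕ) → ℕ → (Fin 4 → ℝ) → ℝ → ℝ → ℝ} {n k : ℕ}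
  {F G : (ℕ → ℝ) → ℝ → ℝ → ℝ}

lemma mono {n' k' : ℕ} (h : JetFun D n k F) (hn : n ≤ n') (hk : k ≤ k') : JetFun D n' k' F := by
  induction h with
  | coef β γ h h3 => exact coef β γ (h.trans hk) (h3.trans hn)
  | var j h => exact var j (h.trans hn)
  | const c => exact const c
  | add _ _ h1 h2 => exact h1.add h2
  | mul _ _ h1 h2 => exact h1.mul h2

lemma sum {ι : Type*} (S : Finset ι) {F : ι → (ℕ → ℝ) → ℝ → ℝ → ℝ}
    (h : ∀ i ∈ S, JetFun D n k (F i)) : JetFun D n k (fun z x t => ∑ i ∈ S, F i z x t) := by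
  classical
  induction S using Finset.induction_on with
  | empty => simpa using const 0
  | insert j S hj ih =>
    simp only [Finset.sum_insert hj]
    exact (h j (by simp)).add (ih fun i hi => h i (by simp [hi]))

lemma const_mul (c : ℝ) (h : JetFun D n k F) : JetFun D n k (fun z x t => c * F z x t) :=
  (const c).mul h

end JetFun

/-- Boundedness and Lipschitz continuity on bounded sets of jets. -/
lemma JetFun.bound_lipschitz {m p : ℕ} {I : Set ℝ} {f : (Fin 4 → ℝ) → ℝ → ℝ → ℝ}
    {D : ℕ → (Fin 4 → ℕ) → ℕ → (Fin 4 → ℝ) → ℝ → ℝ → ℝ} (hD : IsDerivFamily m p I f D)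
    {n k : ℕ} (hkm : k < m) (hkp : k ≤ p) {F : (ℕ → ℝ) → ℝ → ℝ → ℝ} (hF : JetFun (D 0) n k F)
    (R : ℝ) : ∃ C, 0 < C ∧ ∀ x, ∀ t ∈ I, ∀ z : ℕ → ℝ, (∀ j ≤ n, |z j| ≤ R) →
      |F z x t| ≤ C ∧ ∀ w : ℕ → ℝ, (∀ j ≤ n, |w j| ≤ R) →
        |F z x t - F w x t| ≤ C * ∑ j ∈ Finset.range (n + 1), |z j - w j| := by
  induction hF with
  | coef β γ h hn =>
    obtain ⟨C₁, h₁, hb⟩ := hD.bound (α := 0) (β := β) (γ := γ) (by norm_num) (by omega) (by omega) R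
    -- Lipschitz continuity in `z` costs one more derivative in `z`, which is why `k < m` is strict.
    obtain ⟨C₂, h₂, hl⟩ := hD.lipschitz_z (α := 0) (β := β) (γ := γ) (by norm_num) (by omega)
      (by omega) R
    have hnorm : ∀ z : ℕ → ℝ, (∀ j ≤ n, |z j| ≤ R) → ‖fun i : Fin 4 => z i‖ ≤ R := by
      intro z hz
      have hR : 0 ≤ R := (abs_nonneg _).trans (hz 0 (by omega))
      rw [pi_norm_le_iff_of_nonneg hR]
      intro i
      exact hz i (by omega)
    refine ⟨C₁ + C₂, by positivity, fun x t ht z hz => ⟨?_, fun w hw => ?_⟩⟩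
    · exact (hb _ x t ht (hnorm z hz)).trans (by linarith)
    · refine (hl _ _ x (hnorm z hz) (hnorm w hw) t ht).trans ?_
      have hle : ∑ i : Fin 4, |z i - w i| ≤ ∑ j ∈ Finset.range (n + 1), |z j - w j| := by
        rw [Fin.sum_univ_eq_sum_range (fun j => |z j - w j|) 4]
        exact Finset.sum_le_sum_of_subset_of_nonneg (by simpa using hn)
          fun _ _ _ => abs_nonneg _
      have h0 : 0 ≤ ∑ i : Fin 4, |z i - w i| := Finset.sum_nonneg fun _ _ => abs_nonneg _
      nlinarith
  | var j h =>
    refine ⟨|R| + 1, by positivity, fun x t ht z hz => ⟨?_, fun w hw => ?_⟩⟩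
    · exact (hz j h).trans ((le_abs_self R).trans (by linarith))
    · have := Finset.single_le_sum (f := fun j => |z j - w j|) (fun _ _ => abs_nonneg _)
        (Finset.mem_range.2 (Nat.lt_succ_of_le h))
      have h0 : 0 ≤ |z j - w j| := abs_nonneg _
      nlinarith [abs_nonneg R]
  | const c =>
    refine ⟨|c| + 1, by positivity, fun x t ht z hz => ⟨by linarith, fun w hw => ?_⟩⟩
    simp only [sub_self, abs_zero]
    positivity
  | @add F G _ _ h1 h2 =>
    obtain ⟨C₁, h₁, hb₁⟩ := h1
    obtain ⟨C₂, h₂, hb₂⟩ := h2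
    refine ⟨C₁ + C₂, by positivity, fun x t ht z hz => ⟨?_, fun w hw => ?_⟩⟩
    · exact (abs_add_le _ _).trans (add_le_add (hb₁ x t ht z hz).1 (hb₂ x t ht z hz).1)
    · have a := (hb₁ x t ht z hz).2 w hw
      have b := (hb₂ x t ht z hz).2 w hw
      rw [show F z x t + G z x t - (F w x t + G w x t)
        = (F z x t - F w x t) + (G z x t - G w x t) by ring, add_mul]
      exact (abs_add_le _ _).trans (add_le_add a b)
  | @mul F G _ _ h1 h2 =>
    obtain ⟨C₁, h₁, hb₁⟩ := h1
    obtain ⟨C₂, h₂, hb₂⟩ := h2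
    refine ⟨2 * (C₁ * C₂), by positivity, fun x t ht z hz => ⟨?_, fun w hw => ?_⟩⟩
    · rw [abs_mul]
      have a := (hb₁ x t ht z hz).1
      have b := (hb₂ x t ht z hz).1
      have := mul_le_mul a b (abs_nonneg _) h₁.le
      have : 0 < C₁ * C₂ := by positivity
      linarith
    · have a := (hb₁ x t ht z hz).2 w hw
      have b := (hb₂ x t ht z hz).2 w hw
      have a' := (hb₁ x t ht w hw).1
      have b' := (hb₂ x t ht z hz).1
      set S := ∑ j ∈ Finset.range (n + 1), |z j - w j| with hS
      have hS0 : 0 ≤ S := Finset.sum_nonneg fun _ _ => abs_nonneg _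
      rw [show F z x t * G z x t - F w x t * G w x t
        = (F z x t - F w x t) * G z x t + F w x t * (G z x t - G w x t) by ring]
      refine (abs_add_le _ _).trans ?_
      rw [abs_mul, abs_mul]
      have e1 := mul_le_mul a b' (abs_nonneg _) (by positivity)
      have e2 := mul_le_mul a' b (abs_nonneg _) h₁.le
      nlinarith

/-- `F'` is the total derivative of `F` along jets of functions of class `C^{11}`. -/
def TotalDeriv (I : Set ℝ) (F F' : (ℕ → ℝ) → ℝ → ℝ → ℝ) : Prop :=
  ∀ u : ℝ → ℝ, ContDiff ℝ 11 u → ∀ t ∈ I, ∀ x,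
    HasDerivAt (fun y => F (jetSeq u y) y t) (F' (jetSeq u x) x t) x

namespace TotalDeriv

variable {I : Set ℝ} {F F' G G' : (ℕ → ℝ) → ℝ → ℝ → ℝ}

lemma add (hF : TotalDeriv I F F') (hG : TotalDeriv I G G') :
    TotalDeriv I (fun z x t => F z x t + G z x t) (fun z x t => F' z x t + G' z x t) :=
  fun u hu t ht x => (hF u hu t ht x).add (hG u hu t ht x)

lemma mul (hF : TotalDeriv I F F') (hG : TotalDeriv I G G') :
    TotalDeriv I (fun z x t => F z x t * G z x t)
      (fun z x t => F' z x t * G z x t + F z x t * G' z x t) :=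
  fun u hu t ht x => (hF u hu t ht x).mul (hG u hu t ht x)

lemma const (c : ℝ) : TotalDeriv I (fun _ _ _ => c) (fun _ _ _ => 0) :=
  fun _ _ _ _ x => hasDerivAt_const x c

lemma const_mul (c : ℝ) (hF : TotalDeriv I F F') :
    TotalDeriv I (fun z x t => c * F z x t) (fun z x t => c * F' z x t) :=
  fun u hu t ht x => (hF u hu t ht x).const_mul c

lemma var {j : ℕ} (hj : j ≤ 10) : TotalDeriv I (fun z _ _ => z j) (fun z _ _ => z (j + 1)) :=
  fun _ hu _ _ x => hasDerivAt_iteratedDeriv (m := 11) (by exact_mod_cast hu) (by omega) x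

lemma congr (h : TotalDeriv I F F') (hF : ∀ z x t, F z x t = G z x t)
    (hF' : ∀ z x t, F' z x t = G' z x t) : TotalDeriv I G G' := by
  obtain rfl : F = G := by ext z x t; exact hF z x t
  obtain rfl : F' = G' := by ext z x t; exact hF' z x t
  exact h

/-- A total derivative vanishes at the zero jet when the function does. -/
lemma apply_zero (h : TotalDeriv I F F') {t : ℝ} (ht : t ∈ I) (h0 : ∀ x, F 0 x t = 0) (x : ℝ) :
    F' 0 x t = 0 := by
  have e : ∀ y, jetSeq (fun _ => 0) y = 0 := fun y => by
    ext j; simp [jetSeq]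
  have := h (fun _ => 0) contDiff_const t ht x
  simp only [e, h0] at this
  exact this.unique (hasDerivAt_const x 0)

end TotalDeriv

/-- The total derivative of a coefficient. -/
def totalCoef (D : (Fin 4 → ℕ) → ℕ → (Fin 4 → ℝ) → ℝ → ℝ → ℝ) (β : Fin 4 → ℕ) (γ : ℕ) :
    (ℕ → ℝ) → ℝ → ℝ → ℝ := fun z x t =>
  ∑ i : Fin 4, jetCoef D (β + Pi.single i 1) γ z x t * z (i + 1) + jetCoef D β (γ + 1) z x t

/-- The part of the total derivative of a coefficient that does not involve `z_4`. -/
def lowerTotalCoef (D : (Fin 4 → ℕ) → ℕ → (Fin 4 → ℝ) → ℝ → ℝ → ℝ) (β : Fin 4 → ℕ) (γ : ℕ) :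
    (ℕ → ℝ) → ℝ → ℝ → ℝ := fun z x t =>
  ∑ i : Fin 3, jetCoef D (β + Pi.single i.castSucc 1) γ z x t * z (i + 1)
    + jetCoef D β (γ + 1) z x t

section Family

variable {m p : ℕ} {I : Set ℝ} {f : (Fin 4 → ℝ) → ℝ → ℝ → ℝ}
    {D : ℕ → (Fin 4 → ℕ) → ℕ → (Fin 4 → ℝ) → ℝ → ℝ → ℝ}

lemma IsDerivFamily.totalDeriv_coef (hD : IsDerivFamily m p I f D) {β : Fin 4 → ℕ} {γ : ℕ}
    (hβ : ∑ i, β i < m) (hγ : γ + 1 < p) :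
    TotalDeriv I (jetCoef (D 0) β γ) (totalCoef (D 0) β γ) := by
  intro u hu t ht x
  have hd : ∀ i : Fin 4, ∀ y, HasDerivAt (iteratedDeriv i u) (iteratedDeriv (i + 1) u y) y :=
    fun i y => hasDerivAt_iteratedDeriv (m := 11) (by exact_mod_cast hu) (by omega) y
  exact hD.hasDerivAt_comp (p := fun y i => iteratedDeriv i u y) (α := 0) (by norm_num) hβ hγ ht
    (continuous_pi fun i => continuous_iff_continuousAt.2 fun y => (hd i y).continuousAt)
    (fun i => hd i x)

lemma jetFun_totalCoef (D : (Fin 4 → ℕ) → ℕ → (Fin 4 → ℝ) → ℝ → ℝ → ℝ) {β : Fin 4 → ℕ} {γ k : ℕ}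
    (h : ∑ i, β i + γ + 1 ≤ k) : JetFun D 4 k (totalCoef D β γ) := by
  refine JetFun.add (JetFun.sum _ fun i _ => ?_) (JetFun.coef _ _ (by omega) (by norm_num))
  refine JetFun.mul (JetFun.coef _ _ ?_ (by norm_num)) (JetFun.var _ (by omega))
  rw [sum_add_single]; omega

lemma jetFun_lowerTotalCoef (D : (Fin 4 → ℕ) → ℕ → (Fin 4 → ℝ) → ℝ → ℝ → ℝ) {β : Fin 4 → ℕ}
    {γ k : ℕ} (h : ∑ i, β i + γ + 1 ≤ k) : JetFun D 3 k (lowerTotalCoef D β γ) := by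
  refine JetFun.add (JetFun.sum _ fun i _ => ?_) (JetFun.coef _ _ (by omega) (by norm_num))
  refine JetFun.mul (JetFun.coef _ _ ?_ (by norm_num)) (JetFun.var _ (by omega))
  rw [sum_add_single]; omega

lemma totalCoef_eq (D : (Fin 4 → ℕ) → ℕ → (Fin 4 → ℝ) → ℝ → ℝ → ℝ) (β : Fin 4 → ℕ) (γ : ℕ)
    (z : ℕ → ℝ) (x t : ℝ) : totalCoef D β γ z x t =
      jetCoef D (β + Pi.single 3 1) γ z x t * z 4 + lowerTotalCoef D β γ z x t := by
  rw [totalCoef, Fin.sum_univ_castSucc, lowerTotalCoef]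
  simp only [Fin.val_castSucc, Fin.val_last]
  rw [show (Fin.last 3) = (3 : Fin 4) from rfl]
  ring

/-- By the chain rule a total derivative is affine in the one new variable `z (n + 1)`. This keeps
the top orders linear in the later expansions. Each differentiation raises the order `k` of the
derivatives of `f` by one. -/
lemma JetFun.exists_totalDeriv (hD : IsDerivFamily m p I f D) {n k : ℕ} (hn : n ≤ 10)
    (hkm : k < m) (hkp : k + 1 < p) {F : (ℕ → ℝ) → ℝ → ℝ → ℝ} (hF : JetFun (D 0) n k F) :
    ∃ G H, JetFun (D 0) n (k + 1) G ∧ JetFun (D 0) n (k + 1) H ∧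
      TotalDeriv I F (fun z x t => G z x t * z (n + 1) + H z x t) := by
  induction hF with
  | coef β γ h h3 =>
    have ht := hD.totalDeriv_coef (β := β) (γ := γ) (by omega) (by omega)
    -- A coefficient depends on `z_0, …, z_3`. Its derivative involves `z_4`, which is a new
    -- variable only if `n = 3`.
    rcases Nat.eq_or_lt_of_le h3 with h3 | h3
    · subst h3
      exact ⟨jetCoef (D 0) (β + Pi.single 3 1) γ, lowerTotalCoef (D 0) β γ,
        .coef _ _ (by rw [sum_add_single]; omega) le_rfl, jetFun_lowerTotalCoef (D 0) (by omega),
        ht.congr (fun _ _ _ => rfl) (totalCoef_eq _ _ _)⟩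
    · exact ⟨fun _ _ _ => 0, totalCoef (D 0) β γ, .const 0,
        (jetFun_totalCoef (D 0) (by omega)).mono (by omega) le_rfl,
        ht.congr (fun _ _ _ => rfl) fun z x t => by ring⟩
  | var j h =>
    rcases Nat.eq_or_lt_of_le h with h | h
    · exact ⟨fun _ _ _ => 1, fun _ _ _ => 0, .const 1, .const 0,
        (TotalDeriv.var (by omega)).congr (fun _ _ _ => rfl) fun z x t => by rw [h]; ring⟩
    · exact ⟨fun _ _ _ => 0, fun z _ _ => z (j + 1), .const 0, .var _ h,
        (TotalDeriv.var (by omega)).congr (fun _ _ _ => rfl) fun z x t => by ring⟩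
  | const c => exact ⟨fun _ _ _ => 0, fun _ _ _ => 0, .const 0, .const 0,
        (TotalDeriv.const c).congr (fun _ _ _ => rfl) fun z x t => by ring⟩
  | add _ _ h1 h2 =>
    obtain ⟨G₁, H₁, hG₁, hH₁, ht₁⟩ := h1
    obtain ⟨G₂, H₂, hG₂, hH₂, ht₂⟩ := h2
    exact ⟨_, _, hG₁.add hG₂, hH₁.add hH₂,
      (ht₁.add ht₂).congr (fun _ _ _ => rfl) fun z x t => by ring⟩
  | @mul F₁ F₂ hF₁ hF₂ h1 h2 =>
    obtain ⟨G₁, H₁, hG₁, hH₁, ht₁⟩ := h1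
    obtain ⟨G₂, H₂, hG₂, hH₂, ht₂⟩ := h2
    have m1 := hF₁.mono le_rfl (Nat.le_succ k)
    have m2 := hF₂.mono le_rfl (Nat.le_succ k)
    exact ⟨_, _, (hG₁.mul m2).add (m1.mul hG₂), (hH₁.mul m2).add (m1.mul hH₂),
      (ht₁.mul ht₂).congr (fun _ _ _ => rfl) fun z x t => by ring⟩

/-- The total derivative as a single function of a jet of one order more. -/
lemma JetFun.exists_totalDeriv' (hD : IsDerivFamily m p I f D) {n k : ℕ} (hn : n ≤ 10)
    (hkm : k < m) (hkp : k + 1 < p) {F : (ℕ → ℝ) → ℝ → ℝ → ℝ} (hF : JetFun (D 0) n k F) :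
    ∃ G, JetFun (D 0) (n + 1) (k + 1) G ∧ TotalDeriv I F G := by
  obtain ⟨G, H, hG, hH, h⟩ := hF.exists_totalDeriv hD hn hkm hkp
  exact ⟨_, ((hG.mono (Nat.le_succ n) le_rfl).mul (.var _ le_rfl)).add
    (hH.mono (Nat.le_succ n) le_rfl), h⟩

/-- The variable `z 5` arises only by differentiating `z 4`, so its coefficient can be read off
exactly. Exactness is needed because these terms contribute to the coefficient that determines the
weight. -/
lemma IsDerivFamily.exists_totalDeriv_totalCoef (hD : IsDerivFamily m p I f D) {β : Fin 4 → ℕ}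
    {γ k : ℕ} (h : ∑ i, β i + γ + 2 ≤ k) (hkm : k ≤ m) (hkp : k < p) :
    ∃ S, JetFun (D 0) 4 k S ∧ TotalDeriv I (totalCoef (D 0) β γ)
      (fun z x t => jetCoef (D 0) (β + Pi.single 3 1) γ z x t * z 5 + S z x t) := by
  have j₀ : JetFun (D 0) 3 (∑ i, β i + γ + 1) (lowerTotalCoef (D 0) β γ) :=
    jetFun_lowerTotalCoef (D 0) le_rfl
  obtain ⟨G, hG, htG⟩ := j₀.exists_totalDeriv' hD (by norm_num) (by omega) (by omega)
  have ht := hD.totalDeriv_coef (β := β + Pi.single 3 1) (γ := γ)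
    (by rw [sum_add_single]; omega) (by omega)
  have hk : ∑ j, (β + Pi.single 3 1 : Fin 4 → ℕ) j + γ + 1 ≤ k := by
    rw [sum_add_single]; omega
  have j₁ : JetFun (D 0) 4 k (totalCoef (D 0) (β + Pi.single 3 1) γ) := jetFun_totalCoef (D 0) hk
  have j₂ : JetFun (D 0) 4 k G := hG.mono (by norm_num) h
  refine ⟨fun z x t => totalCoef (D 0) (β + Pi.single 3 1) γ z x t * z 4 + G z x t,
    (j₁.mul (.var 4 le_rfl)).add j₂, ?_⟩
  refine ((ht.mul (TotalDeriv.var (j := 4) (by norm_num))).add htG).congr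
    (fun z x t => (totalCoef_eq _ _ _ z x t).symm) fun z x t => by ring

end Family


/-! ### Expansion of the first eight spatial derivatives of `f`. -/

/-- The leading coefficients `f_{z₃}` and `f_{z₂}` as functions of the jet. -/
abbrev dispCoef (D : (Fin 4 → ℕ) → ℕ → (Fin 4 → ℝ) → ℝ → ℝ → ℝ) : (ℕ → ℝ) → ℝ → ℝ → ℝ :=
  jetCoef D (Pi.single 3 1) 0

/-- The coefficient `f_{z₂}` as a function of the jet. -/
abbrev diffCoef (D : (Fin 4 → ℕ) → ℕ → (Fin 4 → ℝ) → ℝ → ℝ → ℝ) : (ℕ → ℝ) → ℝ → ℝ → ℝ :=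
  jetCoef D (Pi.single 2 1) 0

/-- The iterated total derivatives `Φ i` of `f`, `i ≤ 8`, with their leading terms. -/
structure JetExpansion (I : Set ℝ) (D : (Fin 4 → ℕ) → ℕ → (Fin 4 → ℝ) → ℝ → ℝ → ℝ) where
  Φ : ℕ → (ℕ → ℝ) → ℝ → ℝ → ℝ
  (a₁ a₂ a₃ b₁ b₂ r₄ c₆ d₆ r₆ c₇ c₇' p₇ h₇ c₈ c₈' p₈ q₈ s₈ h₈ : (ℕ → ℝ) → ℝ → ℝ → ℝ)
  Φ_zero : Φ 0 = jetCoef D 0 0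
  Φ_succ : ∀ i < 8, TotalDeriv I (Φ i) (Φ (i + 1))
  jetFun_Φ : ∀ i ≤ 3, JetFun D 6 9 (Φ i)
  total_a : TotalDeriv I (dispCoef D) a₁
  total_a₁ : TotalDeriv I a₁ a₂
  total_a₂ : TotalDeriv I a₂ a₃
  total_b : TotalDeriv I (diffCoef D) b₁
  total_b₁ : TotalDeriv I b₁ b₂
  jetFun_a₁ : JetFun D 4 9 a₁
  jetFun_a₂ : JetFun D 5 9 a₂
  jetFun_a₃ : JetFun D 6 9 a₃
  jetFun_b₁ : JetFun D 4 9 b₁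
  jetFun_b₂ : JetFun D 5 9 b₂
  Φ_four : ∀ z x t, Φ 4 z x t = dispCoef D z x t * z 7 + r₄ z x t
  jetFun_r₄ : JetFun D 6 9 r₄
  Φ_six : ∀ z x t, Φ 6 z x t =
    dispCoef D z x t * z 9 + c₆ z x t * z 8 + d₆ z x t * z 7 + r₆ z x t
  jetFun_c₆ : JetFun D 6 9 c₆
  jetFun_d₆ : JetFun D 6 9 d₆
  jetFun_r₆ : JetFun D 6 9 r₆
  -- The second coefficient must be exact since the weight is built from it, and `c₇` needs a total
  -- derivative since its term is integrated by parts. The remaining terms are only estimated.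
  Φ_seven : ∀ z x t, Φ 7 z x t = dispCoef D z x t * z 10
    + (diffCoef D z x t + 7 * a₁ z x t) * z 9 + c₇ z x t * z 8 + (p₇ z x t * z 7 + h₇ z x t)
  total_c₇ : TotalDeriv I c₇ c₇'
  jetFun_c₇ : JetFun D 6 9 c₇
  jetFun_c₇' : JetFun D 6 9 c₇'
  jetFun_p₇ : JetFun D 6 9 p₇
  jetFun_h₇ : JetFun D 6 9 h₇
  Φ_eight : ∀ z x t, Φ 8 z x t = dispCoef D z x t * z 11
    + (diffCoef D z x t + 8 * a₁ z x t) * z 10 + c₈ z x t * z 9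
    + (p₈ z x t * z 8 + q₈ z x t * z 7 ^ 2 + s₈ z x t * z 7 + h₈ z x t)
  total_c₈ : TotalDeriv I c₈ c₈'
  jetFun_c₈ : JetFun D 6 9 c₈
  jetFun_c₈' : JetFun D 6 9 c₈'
  jetFun_p₈ : JetFun D 6 9 p₈
  jetFun_q₈ : JetFun D 6 9 q₈
  jetFun_s₈ : JetFun D 6 9 s₈
  jetFun_h₈ : JetFun D 6 9 h₈

section

variable {I : Set ℝ} {f : (Fin 4 → ℝ) → ℝ → ℝ → ℝ}
    {D : ℕ → (Fin 4 → ℕ) → ℕ → (Fin 4 → ℝ) → ℝ → ℝ → ℝ}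

/-- The third total derivative, with its two leading terms. -/
lemma IsDerivFamily.exists_totalDeriv_three (hD : IsDerivFamily 11 11 I f D) :
    ∃ F₁ F₂ s, JetFun (D 0) 4 1 F₁ ∧ JetFun (D 0) 5 2 F₂ ∧ JetFun (D 0) 4 3 s ∧
      TotalDeriv I (jetCoef (D 0) 0 0) F₁ ∧ TotalDeriv I F₁ F₂ ∧
      TotalDeriv I F₂ (fun z x t => dispCoef (D 0) z x t * z 6 +
        (3 * totalCoef (D 0) (Pi.single 3 1) 0 z x t + diffCoef (D 0) z x t) * z 5 + s z x t) := by
  set e : Fin 4 → Fin 4 → ℕ := fun i => Pi.single i 1 with he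
  have hes : ∀ i, ∑ j, e i j = 1 := fun i => by simp [he]
  choose S hS hST using fun i : Fin 4 =>
    hD.exists_totalDeriv_totalCoef (β := e i) (γ := 0) (k := 3) (by rw [hes]) (by norm_num)
      (by norm_num)
  obtain ⟨S', hS', hST'⟩ :=
    hD.exists_totalDeriv_totalCoef (β := 0) (γ := 1) (k := 3) (by simp) (by norm_num)
      (by norm_num)
  have t0 := hD.totalDeriv_coef (β := 0) (γ := 0) (by simp) (by norm_num)
  have tc : ∀ i, TotalDeriv I (jetCoef (D 0) (e i) 0) (totalCoef (D 0) (e i) 0) := fun i =>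
    hD.totalDeriv_coef (by rw [hes]; norm_num) (by norm_num)
  have tx : TotalDeriv I (jetCoef (D 0) 0 1) (totalCoef (D 0) 0 1) :=
    hD.totalDeriv_coef (by simp) (by norm_num)
  have jc : ∀ i n k, 3 ≤ n → 1 ≤ k → JetFun (D 0) n k (jetCoef (D 0) (e i) 0) := fun i n k hn hk =>
    .coef _ _ (by rw [hes]; omega) hn
  have jt : ∀ i n k, 4 ≤ n → 2 ≤ k → JetFun (D 0) n k (totalCoef (D 0) (e i) 0) :=
    fun i n k hn hk => (jetFun_totalCoef (D 0) (k := k) (by rw [hes]; omega)).mono hn le_rfl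
  have e0 : ∀ z x t, totalCoef (D 0) 0 0 z x t = jetCoef (D 0) (e 0) 0 z x t * z 1 +
      jetCoef (D 0) (e 1) 0 z x t * z 2 + jetCoef (D 0) (e 2) 0 z x t * z 3 +
      jetCoef (D 0) (e 3) 0 z x t * z 4 + jetCoef (D 0) 0 1 z x t := by
    intro z x t
    rw [totalCoef, Fin.sum_univ_four]
    simp [he]
  have v : ∀ j, j ≤ 10 → TotalDeriv I (fun z _ _ => z j) (fun z _ _ => z (j + 1)) :=
    fun j hj => TotalDeriv.var hj
  have tF₁ := ((((((tc 0).mul (v 1 (by norm_num))).add ((tc 1).mul (v 2 (by norm_num)))).add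
    ((tc 2).mul (v 3 (by norm_num)))).add ((tc 3).mul (v 4 (by norm_num)))).add tx)
  have tF₂ := (((((((hST 0).mul (v 1 (by norm_num))).add ((tc 0).mul (v 2 (by norm_num)))).add
    (((hST 1).mul (v 2 (by norm_num))).add ((tc 1).mul (v 3 (by norm_num))))).add
    (((hST 2).mul (v 3 (by norm_num))).add ((tc 2).mul (v 4 (by norm_num))))).add
    (((hST 3).mul (v 4 (by norm_num))).add ((tc 3).mul (v 5 (by norm_num))))).add hST')
  refine ⟨_, _, fun z x t => S 0 z x t * z 1 + S 1 z x t * z 2 + S 2 z x t * z 3 + S 3 z x t * z 4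
      + S' z x t + 2 * (totalCoef (D 0) (e 0) 0 z x t * z 2)
      + 2 * (totalCoef (D 0) (e 1) 0 z x t * z 3) + 2 * (totalCoef (D 0) (e 2) 0 z x t * z 4)
      + jetCoef (D 0) (e 0) 0 z x t * z 3 + jetCoef (D 0) (e 1) 0 z x t * z 4,
    jetFun_totalCoef (D 0) (by simp), ?_, ?_, t0, tF₁.congr (fun z x t => (e0 z x t).symm)
      (fun _ _ _ => rfl), tF₂.congr (fun _ _ _ => rfl) ?_⟩
  · have w : ∀ i j, j ≤ 5 → JetFun (D 0) 5 2
        (fun z x t => totalCoef (D 0) (e i) 0 z x t * z j) := fun i j hj =>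
      (jt i 5 2 (by norm_num) le_rfl).mul (.var j hj)
    have w' : ∀ i j, j ≤ 5 → JetFun (D 0) 5 2
        (fun z x t => jetCoef (D 0) (e i) 0 z x t * z j) := fun i j hj =>
      (jc i 5 2 (by norm_num) (by norm_num)).mul (.var j hj)
    have w'' : JetFun (D 0) 5 2 (totalCoef (D 0) 0 1) :=
      (jetFun_totalCoef (D 0) (by simp)).mono (by norm_num) le_rfl
    exact ((((((w 0 1 (by norm_num)).add (w' 0 2 (by norm_num)))).add
      ((w 1 2 (by norm_num)).add (w' 1 3 (by norm_num)))).add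
      ((w 2 3 (by norm_num)).add (w' 2 4 (by norm_num)))).add
      ((w 3 4 (by norm_num)).add (w' 3 5 (by norm_num)))).add w''
  · have w : ∀ i j, j ≤ 4 → JetFun (D 0) 4 3
        (fun z x t => S i z x t * z j) := fun i j hj => (hS i).mul (.var j hj)
    have w' : ∀ i j, j ≤ 4 → JetFun (D 0) 4 3
        (fun z x t => 2 * (totalCoef (D 0) (e i) 0 z x t * z j)) := fun i j hj =>
      ((jt i 4 3 (by norm_num) (by norm_num)).mul (.var j hj)).const_mul 2
    have w'' : ∀ i j, j ≤ 4 → JetFun (D 0) 4 3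
        (fun z x t => jetCoef (D 0) (e i) 0 z x t * z j) := fun i j hj =>
      (jc i 4 3 (by norm_num) (by norm_num)).mul (.var j hj)
    exact (((((((((w 0 1 (by norm_num)).add (w 1 2 (by norm_num))).add (w 2 3 (by norm_num))).add
      (w 3 4 (by norm_num))).add hS').add (w' 0 2 (by norm_num))).add (w' 1 3 (by norm_num))).add
      (w' 2 4 (by norm_num))).add (w'' 0 3 (by norm_num))).add (w'' 1 4 (by norm_num))
  · intro z x t
    -- Mixed derivatives are indexed by multi-indices, so their symmetry is commutativity of
    -- addition. The second derivatives that multiply `z 5` thus assemble into one total derivative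
    -- of `f_{z₃}`; the product rule yields two more, hence the factor `3`.
    have hc : ∀ i, e 3 + Pi.single i 1 = e i + Pi.single 3 1 := fun i => add_comm _ _
    have e3 : totalCoef (D 0) (e 3) 0 z x t =
        jetCoef (D 0) (e 0 + Pi.single 3 1) 0 z x t * z 1
        + jetCoef (D 0) (e 1 + Pi.single 3 1) 0 z x t * z 2
        + jetCoef (D 0) (e 2 + Pi.single 3 1) 0 z x t * z 3
        + jetCoef (D 0) (e 3 + Pi.single 3 1) 0 z x t * z 4
        + jetCoef (D 0) (0 + Pi.single 3 1) 1 z x t := by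
      have h0 : (0 : Fin 4 → ℕ) + Pi.single 3 1 = e 3 := zero_add _
      rw [totalCoef, Fin.sum_univ_four, hc, hc, hc, hc, h0]
      rfl
    change _ = jetCoef (D 0) (e 3) 0 z x t * z 6 +
      (3 * totalCoef (D 0) (e 3) 0 z x t + jetCoef (D 0) (e 2) 0 z x t) * z 5 + _
    linear_combination (-(z 5)) * e3

/-- From order three on, the two leading terms reproduce themselves under total differentiation,
with one more copy of `a₁` each time. Of the other terms one only has to know that they are affine
in the newest variable, which `exists_totalDeriv` provides. -/
lemma IsDerivFamily.nonempty_jetExpansion (hD : IsDerivFamily 11 11 I f D) :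
    Nonempty (JetExpansion I (D 0)) := by
  obtain ⟨F₁, F₂, s, jF₁, jF₂, js, t0, t1, t2⟩ := hD.exists_totalDeriv_three
  set A := dispCoef (D 0) with hA
  set b := diffCoef (D 0) with hb
  set a₁ := totalCoef (D 0) (Pi.single 3 1) 0 with ha₁
  set b₁ := totalCoef (D 0) (Pi.single 2 1) 0 with hb₁
  have hs : ∀ i : Fin 4, ∑ j, (Pi.single i 1 : Fin 4 → ℕ) j = 1 := fun i => by simp
  have tA : TotalDeriv I A a₁ := hD.totalDeriv_coef (by rw [hs]; norm_num) (by norm_num)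
  have tb : TotalDeriv I b b₁ := hD.totalDeriv_coef (by rw [hs]; norm_num) (by norm_num)
  have jA : JetFun (D 0) 3 1 A := .coef _ _ (by rw [hs]) le_rfl
  have jb : JetFun (D 0) 3 1 b := .coef _ _ (by rw [hs]) le_rfl
  have ja₁ : JetFun (D 0) 4 2 a₁ := jetFun_totalCoef (D 0) (by rw [hs])
  have jb₁ : JetFun (D 0) 4 2 b₁ := jetFun_totalCoef (D 0) (by rw [hs])
  obtain ⟨a₂, ja₂, ta₁⟩ := ja₁.exists_totalDeriv' hD (by norm_num) (by norm_num) (by norm_num)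
  obtain ⟨b₂, jb₂, tb₁⟩ := jb₁.exists_totalDeriv' hD (by norm_num) (by norm_num) (by norm_num)
  obtain ⟨a₃, ja₃, ta₂⟩ := ja₂.exists_totalDeriv' hD (by norm_num) (by norm_num) (by norm_num)
  norm_num at ja₂ jb₂ ja₃
  have v : ∀ j, j ≤ 10 → TotalDeriv I (fun z _ _ => z j) (fun z _ _ => z (j + 1)) :=
    fun j hj => TotalDeriv.var hj
  obtain ⟨G₄, H₄, jG₄, jH₄, ts⟩ := js.exists_totalDeriv hD (by norm_num) (by norm_num) (by norm_num)
  set s₄ : (ℕ → ℝ) → ℝ → ℝ → ℝ := fun z x t =>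
    (3 * a₂ z x t + b₁ z x t) * z 5 + (G₄ z x t * z 5 + H₄ z x t) with hs₄
  have js₄ : JetFun (D 0) 5 4 s₄ :=
    ((((ja₂.mono le_rfl (by norm_num)).const_mul 3).add
      (jb₁.mono (by norm_num) (by norm_num))).mul (.var 5 le_rfl)).add
      (((jG₄.mono (by norm_num) le_rfl).mul (.var 5 le_rfl)).add (jH₄.mono (by norm_num) le_rfl))
  obtain ⟨G₅, H₅, jG₅, jH₅, ts₄⟩ :=
    js₄.exists_totalDeriv hD (by norm_num) (by norm_num) (by norm_num)
  set c₅ : (ℕ → ℝ) → ℝ → ℝ → ℝ := fun z x t => 4 * a₂ z x t + b₁ z x t + G₅ z x t with hc₅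
  have jd : ∀ r : ℝ, JetFun (D 0) 5 5 (fun z x t => r * a₂ z x t + b₁ z x t) := fun r =>
    ((ja₂.mono le_rfl (by norm_num)).const_mul r).add (jb₁.mono (by norm_num) (by norm_num))
  have jc₅ : JetFun (D 0) 5 5 c₅ := (jd 4).add jG₅
  obtain ⟨c₅', jc₅', tc₅⟩ := jc₅.exists_totalDeriv' hD (by norm_num) (by norm_num) (by norm_num)
  obtain ⟨H₅', jH₅', tH₅⟩ := jH₅.exists_totalDeriv' hD (by norm_num) (by norm_num) (by norm_num)
  norm_num at jc₅' jH₅'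
  set c₆ : (ℕ → ℝ) → ℝ → ℝ → ℝ := fun z x t => 5 * a₂ z x t + b₁ z x t + c₅ z x t with hc₆
  have jc₆ : JetFun (D 0) 5 5 c₆ := (jd 5).add jc₅
  set r₆ : (ℕ → ℝ) → ℝ → ℝ → ℝ := fun z x t => c₅' z x t * z 6 + H₅' z x t with hr₆
  have jr₆ : JetFun (D 0) 6 6 r₆ := (jc₅'.mul (.var 6 le_rfl)).add jH₅'
  obtain ⟨c₆', jc₆', tc₆⟩ := jc₆.exists_totalDeriv' hD (by norm_num) (by norm_num) (by norm_num)
  obtain ⟨G₇, H₇, jG₇, jH₇, tr₆⟩ :=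
    jr₆.exists_totalDeriv hD (by norm_num) (by norm_num) (by norm_num)
  norm_num at jc₆' jG₇ jH₇
  set c₇ : (ℕ → ℝ) → ℝ → ℝ → ℝ := fun z x t => 6 * a₂ z x t + b₁ z x t + c₆ z x t with hc₇
  have jc₇ : JetFun (D 0) 5 5 c₇ := (jd 6).add jc₆
  set p₇ : (ℕ → ℝ) → ℝ → ℝ → ℝ := fun z x t => c₆' z x t + G₇ z x t with hp₇
  have jp₇ : JetFun (D 0) 6 7 p₇ := (jc₆'.mono le_rfl (by norm_num)).add jG₇
  obtain ⟨c₇', jc₇', tc₇⟩ := jc₇.exists_totalDeriv' hD (by norm_num) (by norm_num) (by norm_num)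
  obtain ⟨P₁, P₂, jP₁, jP₂, tp₇⟩ :=
    jp₇.exists_totalDeriv hD (by norm_num) (by norm_num) (by norm_num)
  obtain ⟨K₁, K₂, jK₁, jK₂, tH₇⟩ :=
    jH₇.exists_totalDeriv hD (by norm_num) (by norm_num) (by norm_num)
  set c₈ : (ℕ → ℝ) → ℝ → ℝ → ℝ := fun z x t => 7 * a₂ z x t + b₁ z x t + c₇ z x t with hc₈
  have jc₈ : JetFun (D 0) 5 5 c₈ := (jd 7).add jc₇
  obtain ⟨c₈', jc₈', tc₈⟩ := jc₈.exists_totalDeriv' hD (by norm_num) (by norm_num) (by norm_num)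
  norm_num at jc₇' jc₈' jP₁ jP₂ jK₁ jK₂
  set F₃ : (ℕ → ℝ) → ℝ → ℝ → ℝ := fun z x t =>
    A z x t * z 6 + (3 * a₁ z x t + b z x t) * z 5 + s z x t with hF₃
  set F₄ : (ℕ → ℝ) → ℝ → ℝ → ℝ := fun z x t =>
    A z x t * z 7 + (4 * a₁ z x t + b z x t) * z 6 + s₄ z x t with hF₄
  set F₅ : (ℕ → ℝ) → ℝ → ℝ → ℝ := fun z x t =>
    A z x t * z 8 + (5 * a₁ z x t + b z x t) * z 7 + c₅ z x t * z 6 + H₅ z x t with hF₅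
  set F₆ : (ℕ → ℝ) → ℝ → ℝ → ℝ := fun z x t =>
    A z x t * z 9 + (6 * a₁ z x t + b z x t) * z 8 + c₆ z x t * z 7 + r₆ z x t with hF₆
  set F₇ : (ℕ → ℝ) → ℝ → ℝ → ℝ := fun z x t =>
    A z x t * z 10 + (7 * a₁ z x t + b z x t) * z 9 + c₇ z x t * z 8
      + (p₇ z x t * z 7 + H₇ z x t) with hF₇
  -- The square of `z 7` appears because `p₇` depends on `z_0, …, z_6`: its derivative contains `z
  -- 7` and multiplies the `z 7` of the previous step.
  set F₈ : (ℕ → ℝ) → ℝ → ℝ → ℝ := fun z x t =>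
    A z x t * z 11 + (8 * a₁ z x t + b z x t) * z 10 + c₈ z x t * z 9
      + ((c₇' z x t + p₇ z x t) * z 8 + P₁ z x t * z 7 ^ 2 + (P₂ z x t + K₁ z x t) * z 7
        + K₂ z x t) with hF₈
  -- The recursion for the two leading terms. The derivative of `r * a₁ + b` passes to the
  -- coefficient of the next lower variable.
  have lead : ∀ (N : ℕ) (r : ℝ), N ≤ 10 → 1 ≤ N → TotalDeriv I
      (fun z x t => A z x t * z N + (r * a₁ z x t + b z x t) * z (N - 1))
      (fun z x t => A z x t * z (N + 1) + ((r + 1) * a₁ z x t + b z x t) * z N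
        + (r * a₂ z x t + b₁ z x t) * z (N - 1)) := fun N r hN hN1 =>
    ((tA.mul (v N hN)).add (((ta₁.const_mul r).add tb).mul (v (N - 1) (by omega)))).congr
      (fun _ _ _ => rfl) fun z x t => by rw [Nat.sub_add_cancel hN1]; ring
  have t3 : TotalDeriv I F₃ F₄ := ((lead 6 3 (by norm_num) (by norm_num)).add ts).congr
    (fun _ _ _ => rfl) fun z x t => by simp only [hF₄, hs₄]; ring
  have t4 : TotalDeriv I F₄ F₅ := ((lead 7 4 (by norm_num) (by norm_num)).add ts₄).congr
    (fun _ _ _ => rfl) fun z x t => by simp only [hF₅, hc₅]; ring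
  have t5 : TotalDeriv I F₅ F₆ := (((lead 8 5 (by norm_num) (by norm_num)).add
    (tc₅.mul (v 6 (by norm_num)))).add tH₅).congr
    (fun _ _ _ => rfl) fun z x t => by simp only [hF₆, hc₆, hr₆]; ring
  have t6 : TotalDeriv I F₆ F₇ := (((lead 9 6 (by norm_num) (by norm_num)).add
    (tc₆.mul (v 7 (by norm_num)))).add tr₆).congr
    (fun _ _ _ => rfl) fun z x t => by simp only [hF₇, hc₇, hp₇]; ring
  have t7 : TotalDeriv I F₇ F₈ := (((lead 10 7 (by norm_num) (by norm_num)).add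
    (tc₇.mul (v 8 (by norm_num)))).add ((tp₇.mul (v 7 (by norm_num))).add tH₇)).congr
    (fun _ _ _ => rfl) fun z x t => by simp only [hF₈, hc₈]; ring
  have jAb : ∀ r : ℝ, JetFun (D 0) 6 9 (fun z x t => r * a₁ z x t + b z x t) := fun r =>
    ((ja₁.mono (by norm_num) (by norm_num)).const_mul r).add
      (jb.mono (by norm_num) (by norm_num))
  refine ⟨{
    Φ := fun i => [jetCoef (D 0) 0 0, F₁, F₂, F₃, F₄, F₅, F₆, F₇, F₈].getD i F₈
    a₁ := a₁, a₂ := a₂, a₃ := a₃, b₁ := b₁, b₂ := b₂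
    r₄ := fun z x t => (4 * a₁ z x t + b z x t) * z 6 + s₄ z x t
    c₆ := fun z x t => 6 * a₁ z x t + b z x t
    d₆ := c₆, r₆ := r₆, c₇ := c₇, c₇' := c₇', p₇ := p₇, h₇ := H₇, c₈ := c₈, c₈' := c₈'
    p₈ := fun z x t => c₇' z x t + p₇ z x t
    q₈ := P₁
    s₈ := fun z x t => P₂ z x t + K₁ z x t
    h₈ := K₂
    Φ_zero := rfl
    Φ_succ := ?_
    jetFun_Φ := ?_
    total_a := tA, total_a₁ := ta₁, total_a₂ := ta₂, total_b := tb, total_b₁ := tb₁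
    jetFun_a₁ := ja₁.mono le_rfl (by norm_num)
    jetFun_a₂ := ja₂.mono le_rfl (by norm_num)
    jetFun_a₃ := ja₃.mono le_rfl (by norm_num)
    jetFun_b₁ := jb₁.mono le_rfl (by norm_num)
    jetFun_b₂ := jb₂.mono le_rfl (by norm_num)
    Φ_four := fun z x t => by simp only [List.getD_cons_succ, List.getD_cons_zero, hF₄]; ring
    jetFun_r₄ := ((jAb 4).mul (.var 6 le_rfl)).add (js₄.mono (by norm_num) (by norm_num))
    Φ_six := fun z x t => by simp only [List.getD_cons_succ, List.getD_cons_zero, hF₆]; rfl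
    jetFun_c₆ := jAb 6
    jetFun_d₆ := jc₆.mono (by norm_num) (by norm_num)
    jetFun_r₆ := jr₆.mono le_rfl (by norm_num)
    Φ_seven := fun z x t => by
      simp only [List.getD_cons_succ, List.getD_cons_zero, hF₇]
      rw [add_comm (7 * a₁ z x t)]
    total_c₇ := tc₇
    jetFun_c₇ := jc₇.mono (by norm_num) (by norm_num)
    jetFun_c₇' := jc₇'.mono (by norm_num) (by norm_num)
    jetFun_p₇ := jp₇.mono le_rfl (by norm_num)
    jetFun_h₇ := jH₇.mono le_rfl (by norm_num)
    Φ_eight := fun z x t => by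
      simp only [List.getD_cons_succ, List.getD_cons_zero, hF₈]
      rw [add_comm (8 * a₁ z x t)]
    total_c₈ := tc₈
    jetFun_c₈ := jc₈.mono (by norm_num) (by norm_num)
    jetFun_c₈' := jc₈'.mono (by norm_num) (by norm_num)
    jetFun_p₈ := (jc₇'.mono (by norm_num) (by norm_num)).add (jp₇.mono le_rfl (by norm_num))
    jetFun_q₈ := jP₁.mono le_rfl (by norm_num)
    jetFun_s₈ := (jP₂.mono le_rfl (by norm_num)).add (jK₁.mono le_rfl (by norm_num))
    jetFun_h₈ := jK₂.mono le_rfl (by norm_num) }⟩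
  · intro i hi
    interval_cases i
    exacts [t0, t1, t2, t3, t4, t5, t6, t7]
  · intro i hi
    interval_cases i
    · exact .coef _ _ (by simp) (by norm_num)
    · exact jF₁.mono (by norm_num) (by norm_num)
    · exact jF₂.mono (by norm_num) (by norm_num)
    · exact (((jA.mono (by norm_num) (by norm_num)).mul (.var 6 le_rfl)).add
        ((jAb 3).mul (.var 5 (by norm_num)))).add (js.mono (by norm_num) (by norm_num))

end

/-! ### Integration by parts with weights at a fixed time. -/

/-- Bounded continuous functions. -/
def BddCont (r : ℝ → ℝ) : Prop := Continuous r ∧ ∃ C, ∀ x, |r x| ≤ C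

lemma BddCont.integrable_mul {r v w : ℝ → ℝ} (hr : BddCont r) (hv : MemLp v 2 volume)
    (hw : MemLp w 2 volume) : Integrable (fun x => r x * (v x * w x)) :=
  let ⟨_, hC⟩ := hr.2
  integrable_bdd_mul hr.1 hC (KdVType.integrable_mul hv hw)

/-- Integration by parts in the dispersive terms, for coefficients with `(3/2) α' = β`. -/
lemma integral_dispersive {α β β₁ β₂ κ κ₁ w w₁ w₂ w₃ : ℝ → ℝ}
    (hα : ∀ x, HasDerivAt α (2 / 3 * β x) x) (hβ : ∀ x, HasDerivAt β (β₁ x) x)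
    (hβ₁ : ∀ x, HasDerivAt β₁ (β₂ x) x) (hκ : ∀ x, HasDerivAt κ (κ₁ x) x)
    (bα : BddCont α) (bβ : BddCont β) (bβ₁ : BddCont β₁) (bβ₂ : BddCont β₂)
    (bκ : BddCont κ) (bκ₁ : BddCont κ₁)
    (hw : ∀ x, HasDerivAt w (w₁ x) x) (hw₁ : ∀ x, HasDerivAt w₁ (w₂ x) x)
    (hw₂ : ∀ x, HasDerivAt w₂ (w₃ x) x)
    (m : MemLp w 2 volume) (m₁ : MemLp w₁ 2 volume) (m₂ : MemLp w₂ 2 volume)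
    (m₃ : MemLp w₃ 2 volume) :
    ∫ x, (α x * (w x * w₃ x) + β x * (w x * w₂ x) + κ x * (w x * w₁ x)) =
      ∫ x, (1 / 6 * β₂ x - 1 / 2 * κ₁ x) * (w x * w x) := by
  -- In the derivative of this primitive `w₁²` has the coefficient `-(1/2) α' + (1/3) β`, which is
  -- zero. This cancellation is the purpose of the weight: the remaining terms contain no derivative
  -- of `w`.
  have hd : ∀ x, HasDerivAt (fun x => α x * (w x * w₂ x) - 1 / 2 * (α x * (w₁ x * w₁ x))
      + 1 / 3 * (β x * (w x * w₁ x)) - 1 / 6 * (β₁ x * (w x * w x))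
      + 1 / 2 * (κ x * (w x * w x)))
      ((α x * (w x * w₃ x) + β x * (w x * w₂ x) + κ x * (w x * w₁ x))
        - (1 / 6 * β₂ x - 1 / 2 * κ₁ x) * (w x * w x)) x := by
    intro x
    refine HasDerivAt.congr_deriv (((((hα x).fun_mul ((hw x).fun_mul (hw₂ x))).fun_sub
      (((hα x).fun_mul ((hw₁ x).fun_mul (hw₁ x))).const_mul (1 / 2))).fun_add
      (((hβ x).fun_mul ((hw x).fun_mul (hw₁ x))).const_mul (1 / 3))).fun_sub
      (((hβ₁ x).fun_mul ((hw x).fun_mul (hw x))).const_mul (1 / 6)) |>.fun_add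
      (((hκ x).fun_mul ((hw x).fun_mul (hw x))).const_mul (1 / 2))) ?_
    ring
  have i1 : Integrable (fun x => α x * (w x * w₃ x) + β x * (w x * w₂ x) + κ x * (w x * w₁ x)) :=
    ((bα.integrable_mul m m₃).add (bβ.integrable_mul m m₂)).add (bκ.integrable_mul m m₁)
  have i2 : Integrable (fun x => (1 / 6 * β₂ x - 1 / 2 * κ₁ x) * (w x * w x)) := by
    have := ((bβ₂.integrable_mul m m).const_mul (1 / 6)).sub
      ((bκ₁.integrable_mul m m).const_mul (1 / 2))
    refine this.congr (Eventually.of_forall fun x => ?_)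
    simp only [Pi.sub_apply]; ring
  have h0 := integral_eq_zero_of_deriv hd ?_ (i1.sub i2)
  · rw [integral_sub i1 i2] at h0
    linarith
  · exact ((((bα.integrable_mul m m₂).sub ((bα.integrable_mul m₁ m₁).const_mul _)).add
      ((bβ.integrable_mul m m₁).const_mul _)).sub ((bβ₁.integrable_mul m m).const_mul _)).add
      ((bκ.integrable_mul m m).const_mul _)

/-- Integration by parts in the dissipative term. -/
lemma integral_dissipative {ρ ρ₁ ρ₂ w w₁ w₂ w₃ : ℝ → ℝ}
    (hρ : ∀ x, HasDerivAt ρ (ρ₁ x) x) (hρ₁ : ∀ x, HasDerivAt ρ₁ (ρ₂ x) x)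
    (bρ : BddCont ρ) (bρ₁ : BddCont ρ₁) (bρ₂ : BddCont ρ₂)
    (hw : ∀ x, HasDerivAt w (w₁ x) x) (hw₁ : ∀ x, HasDerivAt w₁ (w₂ x) x)
    (hw₂ : ∀ x, HasDerivAt w₂ (w₃ x) x)
    (m : MemLp w 2 volume) (m₁ : MemLp w₁ 2 volume) (m₂ : MemLp w₂ 2 volume)
    (m₃ : MemLp w₃ 2 volume) :
    ∫ x, (ρ₁ x * (w x * w₃ x) + ρ x * (w₁ x * w₃ x)) =
      ∫ x, (ρ₂ x * (w₁ x * w₁ x) - ρ₂ x * (w x * w₂ x) - ρ x * (w₂ x * w₂ x)) := by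
  have hd : ∀ x, HasDerivAt (fun x => ρ₁ x * (w x * w₂ x) + ρ x * (w₁ x * w₂ x)
      - ρ₁ x * (w₁ x * w₁ x))
      ((ρ₁ x * (w x * w₃ x) + ρ x * (w₁ x * w₃ x)) -
        (ρ₂ x * (w₁ x * w₁ x) - ρ₂ x * (w x * w₂ x) - ρ x * (w₂ x * w₂ x))) x := by
    intro x
    refine HasDerivAt.congr_deriv (((hρ₁ x).fun_mul ((hw x).fun_mul (hw₂ x))).fun_add
      ((hρ x).fun_mul ((hw₁ x).fun_mul (hw₂ x))) |>.fun_sub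
      ((hρ₁ x).fun_mul ((hw₁ x).fun_mul (hw₁ x)))) ?_
    ring
  have i1 := (bρ₁.integrable_mul m m₃).add (bρ.integrable_mul m₁ m₃)
  have i2 := ((bρ₂.integrable_mul m₁ m₁).sub (bρ₂.integrable_mul m m₂)).sub
    (bρ.integrable_mul m₂ m₂)
  have h0 := integral_eq_zero_of_deriv hd
    (((bρ₁.integrable_mul m m₂).add (bρ.integrable_mul m₁ m₂)).sub (bρ₁.integrable_mul m₁ m₁))
    (i1.sub i2)
  have h1 := integral_sub i1 i2
  simp only [Pi.add_apply, Pi.sub_apply] at h1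
  rw [h1] at h0
  linarith

/-- The weighted energy inequality at a fixed time. -/
lemma weighted_energy_le {ρ ρ₁ ρ₂ α β β₁ β₂ κ κ₁ w w₁ w₂ w₃ r φ : ℝ → ℝ} {ε μ K : ℝ}
    (hε : 0 ≤ ε) (hμ : 0 < μ)
    (hρ : ∀ x, HasDerivAt ρ (ρ₁ x) x) (hρ₁ : ∀ x, HasDerivAt ρ₁ (ρ₂ x) x)
    (bρ : BddCont ρ) (bρ₁ : BddCont ρ₁) (bρ₂ : BddCont ρ₂)
    (hα : ∀ x, HasDerivAt α (2 / 3 * β x) x) (hβ : ∀ x, HasDerivAt β (β₁ x) x)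
    (hβ₁ : ∀ x, HasDerivAt β₁ (β₂ x) x) (hκ : ∀ x, HasDerivAt κ (κ₁ x) x)
    (bα : BddCont α) (bβ : BddCont β) (bβ₁ : BddCont β₁) (bβ₂ : BddCont β₂)
    (bκ : BddCont κ) (bκ₁ : BddCont κ₁)
    (hw : ∀ x, HasDerivAt w (w₁ x) x) (hw₁ : ∀ x, HasDerivAt w₁ (w₂ x) x)
    (hw₂ : ∀ x, HasDerivAt w₂ (w₃ x) x)
    (m : MemLp w 2 volume) (m₁ : MemLp w₁ 2 volume) (m₂ : MemLp w₂ 2 volume)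
    (m₃ : MemLp w₃ 2 volume) (mr : MemLp r 2 volume) (mφ : MemLp φ 2 volume)
    (hφ : ∀ x, ∃ φ', HasDerivAt φ φ' x ∧
      ρ x * φ' = α x * w₃ x + β x * w₂ x + κ x * w₁ x + ρ x * r x)
    (hρμ : ∀ x, μ ≤ ρ x) (hρK : ∀ x, |ρ x| ≤ K) (hρ₂K : ∀ x, |ρ₂ x| ≤ K)
    (hβ₂K : ∀ x, |β₂ x| ≤ K) (hκ₁K : ∀ x, |κ₁ x| ≤ K) :
    ∫ x, (ρ₁ x * w x + ρ x * w₁ x) * (φ x + ε * w₃ x) ≤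
      K * l2 w ^ 2 + K * (l2 w * l2 r) + ε * (K ^ 2 / μ * l2 w ^ 2) := by
  choose φ' hφ' hφ'eq using hφ
  -- the terms with `φ`
  have e1 := integral_dispersive hα hβ hβ₁ hκ bα bβ bβ₁ bβ₂ bκ bκ₁ hw hw₁ hw₂ m m₁ m₂ m₃
  have i1 : Integrable (fun x => α x * (w x * w₃ x) + β x * (w x * w₂ x) + κ x * (w x * w₁ x)) :=
    ((bα.integrable_mul m m₃).add (bβ.integrable_mul m m₂)).add (bκ.integrable_mul m m₁)
  have ir := bρ.integrable_mul m mr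
  have iφ : Integrable (fun x => ρ₁ x * (w x * φ x) + ρ x * (w₁ x * φ x)) :=
    (bρ₁.integrable_mul m mφ).add (bρ.integrable_mul m₁ mφ)
  -- Here `φ` stands for a spatial derivative of `f` of one order less than `w`. Moving the
  -- derivative back onto it brings in the expansion of `φ'`.
  have eφ : ∫ x, (ρ₁ x * (w x * φ x) + ρ x * (w₁ x * φ x)) =
      - (∫ x, (α x * (w x * w₃ x) + β x * (w x * w₂ x) + κ x * (w x * w₁ x)))
        - ∫ x, ρ x * (w x * r x) := by
    have hd : ∀ x, HasDerivAt (fun x => ρ x * (w x * φ x))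
        ((ρ₁ x * (w x * φ x) + ρ x * (w₁ x * φ x)) +
          ((α x * (w x * w₃ x) + β x * (w x * w₂ x) + κ x * (w x * w₁ x))
            + ρ x * (w x * r x))) x := fun x =>
      ((hρ x).fun_mul ((hw x).fun_mul (hφ' x))).congr_deriv (by
        linear_combination (w x) * hφ'eq x)
    have h0 := integral_eq_zero_of_deriv hd (bρ.integrable_mul m mφ) (iφ.add (i1.add ir))
    have h1 := integral_add iφ (i1.add ir)
    simp only [Pi.add_apply] at h1
    rw [h1, integral_add i1 ir] at h0
    linarith
  have e2 := integral_dissipative hρ hρ₁ bρ bρ₁ bρ₂ hw hw₁ hw₂ m m₁ m₂ m₃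
  have i3 : Integrable (fun x => ρ₁ x * (w x * w₃ x) + ρ x * (w₁ x * w₃ x)) :=
    (bρ₁.integrable_mul m m₃).add (bρ.integrable_mul m₁ m₃)
  have etot : ∫ x, (ρ₁ x * w x + ρ x * w₁ x) * (φ x + ε * w₃ x) =
      (∫ x, (ρ₁ x * (w x * φ x) + ρ x * (w₁ x * φ x)))
      + ε * ∫ x, (ρ₁ x * (w x * w₃ x) + ρ x * (w₁ x * w₃ x)) := by
    rw [← integral_const_mul, ← integral_add iφ (i3.const_mul ε)]
    congr 1; ext x; ring
  have b1 := abs_le.1 (abs_integral_mul_mul_le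
    (r := fun x => 1 / 6 * β₂ x - 1 / 2 * κ₁ x) (C := K) (fun x => by
      have h1 := abs_le.1 (hβ₂K x)
      have h2 := abs_le.1 (hκ₁K x)
      have hK : 0 ≤ K := (abs_nonneg _).trans (hρK x)
      rw [abs_le]; constructor <;> linarith) m m)
  have b2 := abs_le.1 (abs_integral_mul_mul_le hρK m mr)
  have b3 := abs_le.1 (abs_integral_mul_mul_le hρ₂K m₁ m₁)
  have b4 := abs_le.1 (abs_integral_mul_mul_le hρ₂K m m₂)
  have b5 : μ * l2 w₂ ^ 2 ≤ ∫ x, ρ x * (w₂ x * w₂ x) := by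
    rw [← l2_sq m₂, ← integral_const_mul]
    refine integral_mono (m₂.integrable_sq.const_mul μ) (bρ.integrable_mul m₂ m₂) fun x => ?_
    simp only [← sq]
    exact mul_le_mul_of_nonneg_right (hρμ x) (sq_nonneg _)
  have b6 := l2_deriv_sq_le hw hw₁ m m₁ m₂
  have hK : 0 ≤ K := (abs_nonneg _).trans (hρK 0)
  -- By interpolation both terms with `ρ₂` are at most `K ‖w‖ ‖w₂‖`. Completing the square absorbs
  -- their sum into `μ ‖w₂‖²` and leaves `K² / μ ‖w‖²`.
  have e3 : ∫ x, (ρ₂ x * (w₁ x * w₁ x) - ρ₂ x * (w x * w₂ x) - ρ x * (w₂ x * w₂ x)) ≤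
      K ^ 2 / μ * l2 w ^ 2 := by
    have h0 := integral_sub ((bρ₂.integrable_mul m₁ m₁).sub (bρ₂.integrable_mul m m₂))
      (bρ.integrable_mul m₂ m₂)
    simp only [Pi.sub_apply] at h0
    rw [h0, integral_sub (bρ₂.integrable_mul m₁ m₁) (bρ₂.integrable_mul m m₂)]
    have h1 : K * (l2 w₁ * l2 w₁) ≤ K * (l2 w * l2 w₂) :=
      mul_le_mul_of_nonneg_left (by rw [← sq]; exact b6) hK
    have h2 : 2 * (K * (l2 w * l2 w₂)) - μ * l2 w₂ ^ 2 ≤ K ^ 2 / μ * l2 w ^ 2 := by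
      rw [div_mul_eq_mul_div, le_div_iff₀ hμ]
      nlinarith [sq_nonneg (μ * l2 w₂ - K * l2 w)]
    linarith [b3.2, b4.1]
  rw [etot, eφ, e1, e2]
  have e4 := mul_le_mul_of_nonneg_left e3 hε
  have : K * (l2 w * l2 w) = K * l2 w ^ 2 := by ring
  linarith [b1.1, b2.1]


/-! ### Corrections of jets, and a bound for increments. -/

/-- Functions that interpolate a prescribed `2`-jet at `0` and the zero jet at `-1`. -/
noncomputable def hermiteBump (j : ℕ) (τ : ℝ) : ℝ :=
  Real.smoothTransition (3 * τ + 2) * τ ^ j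

lemma contDiff_hermiteBump (j : ℕ) {n : ℕ∞} : ContDiff ℝ n (hermiteBump j) := by
  unfold hermiteBump
  exact (Real.smoothTransition.contDiff.comp (by fun_prop)).mul (by fun_prop)

lemma iteratedDeriv_hermiteBump_zero (i j : ℕ) :
    iteratedDeriv i (hermiteBump j) 0 = if i = j then (Nat.factorial j : ℝ) else 0 := by
  have h : hermiteBump j =ᶠ[𝓝 0] fun τ => τ ^ j := by
    have : ∀ᶠ τ : ℝ in 𝓝 0, -(1 / 3) < τ := lt_mem_nhds (by norm_num)
    filter_upwards [this] with τ hτ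
    rw [hermiteBump, Real.smoothTransition.one_of_one_le (by linarith), one_mul]
  rw [h.iteratedDeriv_eq, iteratedDeriv_fun_pow_zero]
  push_cast
  rfl

lemma iteratedDeriv_hermiteBump_neg_one (i j : ℕ) : iteratedDeriv i (hermiteBump j) (-1) = 0 := by
  have h : hermiteBump j =ᶠ[𝓝 (-1)] fun _ => 0 := by
    have : ∀ᶠ τ : ℝ in 𝓝 (-1), τ < -(2 / 3) := gt_mem_nhds (by norm_num)
    filter_upwards [this] with τ hτ
    rw [hermiteBump, Real.smoothTransition.zero_of_nonpos (by linarith), zero_mul]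
  rw [h.iteratedDeriv_eq, iteratedDeriv_fun_const_zero]

lemma exists_bound_hermiteBump : ∃ B, 0 < B ∧ ∀ i ≤ 3, ∀ j < 3, ∀ τ ∈ Set.Icc (-1 : ℝ) 0,
    |iteratedDeriv i (hermiteBump j) τ| ≤ B := by
  have h : ∀ i j : ℕ, ∃ B, ∀ τ ∈ Set.Icc (-1 : ℝ) 0, |iteratedDeriv i (hermiteBump j) τ| ≤ B := by
    intro i j
    exact isCompact_Icc.exists_bound_of_continuousOn
      ((contDiff_hermiteBump (n := ⊤) j).continuous_iteratedDeriv i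
        (by exact_mod_cast le_top)).continuousOn
  choose B hB using h
  have hB0 : ∀ i j, 0 ≤ B i j := fun i j => (abs_nonneg _).trans (hB i j 0 (by simp))
  refine ⟨∑ i ∈ Finset.range 4, ∑ j ∈ Finset.range 3, B i j + 1,
    add_pos_of_nonneg_of_pos (Finset.sum_nonneg fun i _ => Finset.sum_nonneg fun j _ => hB0 i j)
      one_pos, fun i hi j hj τ hτ => (hB i j τ hτ).trans ?_⟩
  have h1 := Finset.single_le_sum (f := fun j => B i j) (fun j _ => hB0 i j) (Finset.mem_range.2 hj)
  have h2 := Finset.single_le_sum (f := fun i => ∑ j ∈ Finset.range 3, B i j)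
    (fun i _ => Finset.sum_nonneg fun j _ => hB0 i j) (Finset.mem_range.2 (by omega : i < 4))
  linarith

/-- A function with jet `d` at `x₀` and the zero jet at `x₀ - 1`. -/
noncomputable def jetCorrection (d : Fin 3 → ℝ) (x₀ y : ℝ) : ℝ :=
  ∑ j : Fin 3, d j / (Nat.factorial j : ℝ) * hermiteBump j (y - x₀)

lemma contDiff_jetCorrection (d : Fin 3 → ℝ) (x₀ : ℝ) {n : ℕ∞} :
    ContDiff ℝ n (jetCorrection d x₀) := by
  unfold jetCorrection
  refine ContDiff.sum fun j _ => contDiff_const.mul ?_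
  exact (contDiff_hermiteBump j).comp (by fun_prop)

lemma iteratedDeriv_jetCorrection (d : Fin 3 → ℝ) (x₀ : ℝ) (i : ℕ) (y : ℝ) :
    iteratedDeriv i (jetCorrection d x₀) y =
      ∑ j : Fin 3, d j / (Nat.factorial j : ℝ) * iteratedDeriv i (hermiteBump j) (y - x₀) := by
  unfold jetCorrection
  rw [iteratedDeriv_fun_sum]
  · refine Finset.sum_congr rfl fun j _ => ?_
    rw [iteratedDeriv_const_mul_field]
    congr 1
    exact congrFun (iteratedDeriv_comp_sub_const i (hermiteBump j) x₀) y
  · intro j _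
    exact (contDiff_const.mul ((contDiff_hermiteBump (n := i) j).comp (by fun_prop))).contDiffAt

lemma iteratedDeriv_jetCorrection_self (d : Fin 3 → ℝ) (x₀ : ℝ) (i : Fin 3) :
    iteratedDeriv i (jetCorrection d x₀) x₀ = d i := by
  rw [iteratedDeriv_jetCorrection, Finset.sum_eq_single i]
  · rw [sub_self, iteratedDeriv_hermiteBump_zero, if_pos rfl]
    field_simp
  · intro j _ hj
    rw [sub_self, iteratedDeriv_hermiteBump_zero, if_neg (fun h => hj (Fin.ext h.symm)), mul_zero]
  · simp

lemma iteratedDeriv_jetCorrection_sub_one (d : Fin 3 → ℝ) (x₀ : ℝ) (i : ℕ) :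
    iteratedDeriv i (jetCorrection d x₀) (x₀ - 1) = 0 := by
  rw [iteratedDeriv_jetCorrection]
  refine Finset.sum_eq_zero fun j _ => ?_
  rw [sub_sub_cancel_left, iteratedDeriv_hermiteBump_neg_one, mul_zero]

lemma exists_bound_jetCorrection : ∃ B, 0 < B ∧ ∀ (d : Fin 3 → ℝ) (δ x₀ : ℝ), (∀ j, |d j| ≤ δ) →
    ∀ i ≤ 3, ∀ y ∈ Set.Icc (x₀ - 1) x₀, |iteratedDeriv i (jetCorrection d x₀) y| ≤ B * δ := by
  obtain ⟨B, hB, hb⟩ := exists_bound_hermiteBump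
  refine ⟨3 * B, by positivity, fun d δ x₀ hd i hi y hy => ?_⟩
  rw [iteratedDeriv_jetCorrection]
  have hδ : 0 ≤ δ := (abs_nonneg _).trans (hd 0)
  calc _ ≤ ∑ j : Fin 3, |d j / (Nat.factorial j : ℝ) * iteratedDeriv i (hermiteBump j) (y - x₀)| :=
        Finset.abs_sum_le_sum_abs _ _
    _ ≤ ∑ _j : Fin 3, δ * B := by
        refine Finset.sum_le_sum fun j _ => ?_
        rw [abs_mul, abs_div]
        refine mul_le_mul ?_ (hb i hi j j.2 _ ⟨by linarith [hy.1], by linarith [hy.2]⟩)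
          (abs_nonneg _) hδ
        refine (div_le_self (abs_nonneg _) ?_).trans (hd j)
        rw [abs_of_nonneg (by positivity)]
        exact_mod_cast Nat.one_le_iff_ne_zero.2 (Nat.factorial_ne_zero _)
    _ = _ := by simp; ring

/-- A bound for the increments of a function by the integral of a bound for its derivative. -/
lemma abs_sub_le_integral {H H' m : ℝ → ℝ} (hd : ∀ x, HasDerivAt H (H' x) x)
    (hm : Continuous m) (hi : Integrable m) (hle : ∀ x, |H' x| ≤ m x) (x y : ℝ) :
    |H x - H y| ≤ ∫ s, m s := by
  -- Monotonicity of `S - H` and `S + H` replaces the fundamental theorem of calculus, since nothing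
  -- is assumed on the measurability of `H'`.
  set S : ℝ → ℝ := fun z => ∫ s in y..z, m s with hS
  have hSd : ∀ z, HasDerivAt S (m z) z := fun z => (hm.integral_hasStrictDerivAt y z).hasDerivAt
  have hSy : S y = 0 := by simp [hS]
  have m1 : Monotone (fun z => S z - H z) :=
    monotone_of_hasDerivAt_nonneg (fun z => (hSd z).sub (hd z)) fun z => by
      have := (abs_le.1 (hle z)).2; simp only [Pi.zero_apply]; linarith
  have m2 : Monotone (fun z => S z + H z) :=
    monotone_of_hasDerivAt_nonneg (fun z => (hSd z).add (hd z)) fun z => by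
      have := (abs_le.1 (hle z)).1; simp only [Pi.zero_apply]; linarith
  have h0 : ∀ s, 0 ≤ m s := fun s => (abs_nonneg _).trans (hle s)
  have hSle : |S x| ≤ ∫ s, m s := by
    refine (intervalIntegral.norm_integral_le_integral_norm_uIoc (f := m) (a := y) (b := x)
      (μ := volume)).trans ?_
    simp only [Real.norm_of_nonneg (h0 _)]
    exact setIntegral_le_integral hi (Eventually.of_forall h0)
  refine le_trans ?_ hSle
  rcases le_total y x with h | h
  · have a := m1 h
    have b := m2 h
    simp only [hSy] at a b
    refine le_trans ?_ (le_abs_self _)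
    rw [abs_le]; constructor <;> linarith
  · have a := m1 h
    have b := m2 h
    simp only [hSy] at a b
    refine le_trans ?_ (neg_le_abs _)
    rw [abs_le]; constructor <;> linarith

/-! ### Quadratic smallness of `g_H`. -/

section GH

variable {I : Set ℝ} {gH : (Fin 4 → ℝ) → ℝ → ℝ → ℝ}
    {D : ℕ → (Fin 4 → ℕ) → ℕ → (Fin 4 → ℝ) → ℝ → ℝ → ℝ}

lemma IsDerivFamily.partialZ_eq {d m n : ℕ} {F : (Fin d → ℝ) → ℝ → ℝ → ℝ}
    {D : ℕ → (Fin d → ℕ) → ℕ → (Fin d → ℝ) → ℝ → ℝ → ℝ} (h : IsDerivFamily m n I F D)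
    (hm : 0 < m) (i : Fin d) (z : Fin d → ℝ) (x : ℝ) {t : ℝ} (ht : t ∈ I) :
    partialZ i F z x t = D 0 (Pi.single i 1) 0 z x t := by
  have h1 := h.2.2.1 0 0 0 (by norm_num) (by simpa using hm) (by omega) i z x t ht
  rw [zero_add] at h1
  rw [← h1.deriv, partialZ]
  congr 1
  ext s
  exact (h.1 _ x t ht).symm

/-- A function that vanishes to second order at `z = 0` is quadratically small, together with its
increments in `z` and `t`. -/
lemma IsDerivFamily.quadratic (h : IsDerivFamily 2 0 I gH D) (hI : Convex ℝ I)
    (hu : UniqueDiffOn ℝ I)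
    (h0 : ∀ x, ∀ t ∈ I, gH 0 x t = 0 ∧ ∀ j, partialZ j gH 0 x t = 0) (R : ℝ) :
    ∃ C, 0 < C ∧ ∀ z w x, ‖z‖ ≤ R → ‖w‖ ≤ R → ∀ t ∈ I, ∀ s ∈ I,
      |gH z x t - gH w x s| ≤ C * ((∑ i, |z i| + ∑ i, |w i|) * ∑ i, |z i - w i|)
        + C * (∑ i, |w i|) ^ 2 * |t - s| := by
  have hs : ∀ i : Fin 4, ∑ j, (Pi.single i 1 : Fin 4 → ℕ) j = 1 := fun i => by simp
  have z0 : ∀ x, ∀ t ∈ I, D 0 0 0 0 x t = 0 := fun x t ht => by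
    rw [h.1 0 x t ht]; exact (h0 x t ht).1
  have z1 : ∀ i x, ∀ t ∈ I, D 0 (Pi.single i 1) 0 0 x t = 0 := fun i x t ht => by
    rw [← h.partialZ_eq (by norm_num) i 0 x ht]; exact (h0 x t ht).2 i
  -- A quantity that vanishes for all times has zero time derivative; thus `∂_t g_H` vanishes to
  -- second order at `z = 0` as well.
  have w0 : ∀ β : Fin 4 → ℕ, ∑ i, β i ≤ 2 → (∀ x, ∀ t ∈ I, D 0 β 0 0 x t = 0) →
      ∀ x, ∀ t ∈ I, D 1 β 0 0 x t = 0 := by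
    intro β hβ hz x t ht
    have h1 := h.2.1 β 0 hβ le_rfl 0 x t ht
    have h2 : HasDerivWithinAt (fun s => D 0 β 0 0 x s) 0 I t :=
      (hasDerivWithinAt_const t I (0 : ℝ)).congr (fun s hs => hz x s hs) (hz x t ht)
    exact (hu t ht).eq_deriv _ h1 h2
  -- The gradient vanishes at the origin and is Lipschitz, so on the cube of radius `max ‖z‖ ‖w‖` it
  -- is at most a constant times that radius.
  have key : ∀ α ≤ 1, ∃ C, 0 < C ∧ ∀ z w x, ‖z‖ ≤ R → ‖w‖ ≤ R → ∀ t ∈ I,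
      |D α 0 0 z x t - D α 0 0 w x t| ≤
        C * ((∑ i, |z i| + ∑ i, |w i|) * ∑ i, |z i - w i|) := by
    intro α hα
    choose C hC hb using fun i : Fin 4 =>
      h.lipschitz_z (β := Pi.single i 1) (γ := 0) hα (by rw [hs]; norm_num) le_rfl R
    have hz : ∀ i x, ∀ t ∈ I, D α (Pi.single i 1) 0 0 x t = 0 := by
      intro i x t ht
      interval_cases α
      · exact z1 i x t ht
      · exact w0 _ (by rw [hs]; norm_num) (z1 i) x t ht
    refine ⟨(∑ i, C i) * 4, by
      have : 0 < ∑ i, C i := Finset.sum_pos (fun i _ => hC i) Finset.univ_nonempty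
      positivity, fun z w x hzR hwR t ht => ?_⟩
    set ρ := max ‖z‖ ‖w‖ with hρ
    have hρR : ρ ≤ R := max_le hzR hwR
    have hR : 0 ≤ R := (norm_nonneg z).trans hzR
    have hρs : ρ ≤ ∑ i, |z i| + ∑ i, |w i| := by
      have hn : ∀ y : Fin 4 → ℝ, ‖y‖ ≤ ∑ i, |y i| := fun y => by
        rw [pi_norm_le_iff_of_nonneg (Finset.sum_nonneg fun _ _ => abs_nonneg _)]
        exact fun i => Finset.single_le_sum (f := fun i => |y i|) (fun _ _ => abs_nonneg _)
          (Finset.mem_univ i)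
      have a1 := hn z
      have a2 := hn w
      have a3 := norm_nonneg z
      have a4 := norm_nonneg w
      exact max_le (by linarith) (by linarith)
    have hstep := abs_sub_le_of_partial (G := fun z => D α 0 0 z x t)
      (G' := fun i z => D α (0 + Pi.single i 1) 0 z x t) (R := ρ) (L := (∑ i, C i) * (4 * ρ))
      (fun i z s => h.hasDerivAt_z hα (by simp) le_rfl ht i z x s)
      (fun i y hy => by
        have h1 := hb i y 0 x (hy.trans hρR) (by simpa using hR) t ht
        rw [zero_add, ← sub_zero (D α (Pi.single i 1) 0 y x t), ← hz i x t ht]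
        refine h1.trans (mul_le_mul (Finset.single_le_sum (f := C) (fun i _ => (hC i).le)
          (Finset.mem_univ i)) ?_ (Finset.sum_nonneg fun _ _ => abs_nonneg _)
          (Finset.sum_nonneg fun i _ => (hC i).le))
        calc ∑ j, |y j - (0 : Fin 4 → ℝ) j| ≤ ∑ _j : Fin 4, ρ := Finset.sum_le_sum fun j _ => by
              simpa using (norm_le_pi_norm y j).trans hy
          _ = 4 * ρ := by simp)
      (le_max_left _ _) (le_max_right _ _)
    refine hstep.trans ?_
    have h1 : (0 : ℝ) ≤ ∑ i, C i := Finset.sum_nonneg fun i _ => (hC i).le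
    have h2 : (0 : ℝ) ≤ ∑ i, |z i - w i| := Finset.sum_nonneg fun i _ => abs_nonneg _
    calc (∑ i, C i) * (4 * ρ) * ∑ i, |z i - w i|
        = (∑ i, C i) * 4 * (ρ * ∑ i, |z i - w i|) := by ring
      _ ≤ _ := by gcongr
  obtain ⟨C₀, hC₀, hb₀⟩ := key 0 (by norm_num)
  obtain ⟨C₁, hC₁, hb₁⟩ := key 1 le_rfl
  refine ⟨C₀ + C₁, by positivity, fun z w x hz hw t ht s hs => ?_⟩
  rw [← h.1 z x t ht, ← h.1 w x s hs]
  have e1 := hb₀ z w x hz hw t ht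
  have hR : 0 ≤ R := (norm_nonneg z).trans hz
  have e2 : |D 0 0 0 w x t - D 0 0 0 w x s| ≤ C₁ * (∑ i, |w i|) ^ 2 * |t - s| := by
    refine hI.norm_image_sub_le_of_norm_hasDerivWithin_le
      (fun r hr => h.2.1 0 0 (by simp) le_rfl w x r hr) (fun r hr => ?_) hs ht
    have := hb₁ w 0 x hw (by simpa using hR) r hr
    rw [w0 0 (by simp) z0 x r hr] at this
    simp only [sub_zero, Pi.zero_apply, abs_zero, Finset.sum_const_zero, add_zero] at this
    rw [Real.norm_eq_abs, sq]
    exact this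
  have h1 : 0 ≤ (∑ i, |z i| + ∑ i, |w i|) * ∑ i, |z i - w i| :=
    mul_nonneg (add_nonneg (Finset.sum_nonneg fun _ _ => abs_nonneg _)
      (Finset.sum_nonneg fun _ _ => abs_nonneg _)) (Finset.sum_nonneg fun _ _ => abs_nonneg _)
  have h2 : 0 ≤ (∑ i, |w i|) ^ 2 * |t - s| := by positivity
  calc _ ≤ |D 0 0 0 z x t - D 0 0 0 w x t| + |D 0 0 0 w x t - D 0 0 0 w x s| := abs_sub_le _ _ _
    _ ≤ _ := by nlinarith

end GH


/-! ### The data of the equation; Lipschitz dependence of `g_D` on the jet. -/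

/-- The data of the equation: a nonlinearity that satisfies the structural conditions, with its
families of derivatives and the functions in the decomposition of the diffusion ratio. -/
structure Nonlinearity (I : Set ℝ) (f : (Fin 4 → ℝ) → ℝ → ℝ → ℝ) where
  (D : ℕ → (Fin 4 → ℕ) → ℕ → (Fin 4 → ℝ) → ℝ → ℝ → ℝ)
  (gD : (Fin 3 → ℝ) → ℝ → ℝ → ℝ)
  (gH : (Fin 4 → ℝ) → ℝ → ℝ → ℝ)
  (Dg : ℕ → (Fin 3 → ℕ) → ℕ → (Fin 3 → ℝ) → ℝ → ℝ → ℝ)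
  (Dh : ℕ → (Fin 4 → ℕ) → ℕ → (Fin 4 → ℝ) → ℝ → ℝ → ℝ)
  convex : Convex ℝ I
  uniqueDiff : UniqueDiffOn ℝ I
  fam : IsDerivFamily 11 11 I f D
  famD : IsDerivFamily 0 0 I gD Dg
  famH : IsDerivFamily 2 0 I gH Dh
  gH_zero : ∀ x, ∀ t ∈ I, gH 0 x t = 0 ∧ ∀ j, partialZ j gH 0 x t = 0
  f_zero : ∀ x, ∀ t ∈ I, f 0 x t = 0
  ratio : ∀ v : ℝ → ℝ, ContDiff ℝ 3 v → ∀ x, ∀ t ∈ I, dispCoef (D 0) (jetSeq v x) x t ≠ 0 →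
      HasDerivAt (fun y => gD (jet 3 v y) y t)
        (diffCoef (D 0) (jetSeq v x) x t / dispCoef (D 0) (jetSeq v x) x t - gH (jet 4 v x) x t) x
  E : JetExpansion I (D 0)

lemma nonempty_nonlinearity {I : Set ℝ} {f : (Fin 4 → ℝ) → ℝ → ℝ → ℝ} (hc : Convex ℝ I)
    (hu : UniqueDiffOn ℝ I) (h1 : ConditionA1 I f) (h2 : ConditionA2 I f) (h3 : ConditionA3 I f) :
    Nonempty (Nonlinearity I f) := by
  obtain ⟨D, hD⟩ := MixedRegularity.exists_family h1
  obtain ⟨gD, gH, hgD, hgH, h0, hr⟩ := h2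
  obtain ⟨Dg, hDg⟩ := hgD.exists_family
  obtain ⟨Dh, hDh⟩ := hgH.exists_family
  obtain ⟨E⟩ := hD.nonempty_jetExpansion
  refine ⟨⟨D, gD, gH, Dg, Dh, hc, hu, hD, hDg, hDh, h0, h3, fun v hv x t ht hne => ?_, E⟩⟩
  have h := hr v hv x t ht
  rw [hD.partialZ_eq (by norm_num) 3 _ x ht, hD.partialZ_eq (by norm_num) 2 _ x ht] at h
  exact h hne

lemma abs_div_sub_div_le {a₁ a₂ b₁ b₂ m K : ℝ} (hm : 0 < m) (h₁ : m ≤ |a₁|) (h₂ : m ≤ |a₂|)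
    (ha : |a₂| ≤ K) (hb : |b₂| ≤ K) :
    |b₁ / a₁ - b₂ / a₂| ≤ K / m ^ 2 * (|b₁ - b₂| + |a₁ - a₂|) := by
  have p₁ : 0 < |a₁| := hm.trans_le h₁
  have p₂ : 0 < |a₂| := hm.trans_le h₂
  have n₁ : a₁ ≠ 0 := abs_pos.1 p₁
  have n₂ : a₂ ≠ 0 := abs_pos.1 p₂
  rw [div_sub_div _ _ n₁ n₂, abs_div, abs_mul, div_le_iff₀ (by positivity)]
  have e : |b₁ * a₂ - a₁ * b₂| ≤ K * (|b₁ - b₂| + |a₁ - a₂|) := by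
    rw [show b₁ * a₂ - a₁ * b₂ = (b₁ - b₂) * a₂ + (-b₂) * (a₁ - a₂) by ring]
    refine (abs_add_le _ _).trans ?_
    rw [abs_mul, abs_mul, abs_neg]
    nlinarith [abs_nonneg (b₁ - b₂), abs_nonneg (a₁ - a₂)]
  refine e.trans ?_
  have hK : 0 ≤ K := (abs_nonneg _).trans ha
  have h3 : m ^ 2 ≤ |a₁| * |a₂| := by rw [sq]; exact mul_le_mul h₁ h₂ hm.le p₁.le
  have h4 : 0 ≤ K / m ^ 2 * (|b₁ - b₂| + |a₁ - a₂|) := by positivity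
  calc K * (|b₁ - b₂| + |a₁ - a₂|) = K / m ^ 2 * (|b₁ - b₂| + |a₁ - a₂|) * m ^ 2 := by
        field_simp
    _ ≤ _ := mul_le_mul_of_nonneg_left h3 h4

namespace Nonlinearity

variable {I : Set ℝ} {f : (Fin 4 → ℝ) → ℝ → ℝ → ℝ} (P : Nonlinearity I f)

/-- The dispersion coefficient `f_{z₃}`. -/
abbrev a : (ℕ → ℝ) → ℝ → ℝ → ℝ := dispCoef (P.D 0)

/-- The diffusion coefficient `f_{z₂}`. -/
abbrev b : (ℕ → ℝ) → ℝ → ℝ → ℝ := diffCoef (P.D 0)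

lemma jetFun_a : JetFun (P.D 0) 3 9 P.a := .coef _ _ (by simp) le_rfl

lemma jetFun_b : JetFun (P.D 0) 3 9 P.b := .coef _ _ (by simp) le_rfl

lemma bound_lipschitz {n : ℕ} {F : (ℕ → ℝ) → ℝ → ℝ → ℝ} (hF : JetFun (P.D 0) n 9 F) (R : ℝ) :
    ∃ C, 0 < C ∧ ∀ x, ∀ t ∈ I, ∀ z : ℕ → ℝ, (∀ j ≤ n, |z j| ≤ R) →
      |F z x t| ≤ C ∧ ∀ w : ℕ → ℝ, (∀ j ≤ n, |w j| ≤ R) →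
        |F z x t - F w x t| ≤ C * ∑ j ∈ Finset.range (n + 1), |z j - w j| :=
  hF.bound_lipschitz P.fam (by norm_num) (by norm_num) R

/-- Although `g_D` is only continuous in `z`, it is Lipschitz at jets of functions along which the
equation is dispersive. -/
lemma gD_lipschitz (R : ℝ) (hR : 0 < R) : ∃ C η, 0 < C ∧ 0 < η ∧
    ∀ (w : ℝ → ℝ) (t x₀ δ : ℝ) (d : Fin 3 → ℝ), ContDiff ℝ 3 w → t ∈ I →
      (∀ j ≤ 3, ∀ x, |iteratedDeriv j w x| ≤ R) → (∀ x, 1 ≤ R * |P.a (jetSeq w x) x t|) →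
      (∀ j, |d j| ≤ δ) → δ ≤ η →
      |P.gD (fun i => jet 3 w x₀ i + d i) x₀ t - P.gD (jet 3 w x₀) x₀ t| ≤ C * δ := by
  obtain ⟨B, hB, hbB⟩ := exists_bound_jetCorrection
  obtain ⟨Ca, hCa, ha⟩ := P.bound_lipschitz P.jetFun_a (R + B)
  obtain ⟨Cb, hCb, hb⟩ := P.bound_lipschitz P.jetFun_b (R + B)
  obtain ⟨Ch, hCh, hh⟩ := P.famH.lipschitz_z (α := 0) (β := 0) (γ := 0) (by norm_num) (by simp)
    le_rfl (R + B)
  -- Half of the lower bound `1 / R` for the dispersion along `w`. The second entry of the `min`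
  -- below ensures that the perturbation uses up at most the other half.
  set m : ℝ := 1 / (2 * R) with hm
  have hm0 : 0 < m := by positivity
  set C : ℝ := (Ca + Cb) / m ^ 2 * (Cb * (4 * B) + Ca * (4 * B)) + Ch * (4 * B) with hC
  refine ⟨C, min 1 (m / (Ca * (4 * B))), by positivity, by positivity,
    fun w t x₀ δ d hw ht hwR hwa hd hδ => ?_⟩
  have hδ0 : 0 ≤ δ := (abs_nonneg _).trans (hd 0)
  have hδ1 : δ ≤ 1 := hδ.trans (min_le_left _ _)
  have hδ2 : Ca * (4 * (B * δ)) ≤ m := by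
    have := hδ.trans (min_le_right _ _)
    rw [le_div_iff₀ (by positivity)] at this
    linarith
  -- The jets of `w + e` and `w` differ by `d` at `x₀` and agree at `x₀ - 1`. Hence the increment of
  -- `g_D` at `x₀` is the increment over a unit interval of a difference whose derivative is known
  -- from (A2): the difference of the two values of `b/a - g_H`. That quantity is Lipschitz in the
  -- jet although `g_D` is not assumed to be.
  set e := jetCorrection d x₀ with he
  have hec : ContDiff ℝ 3 e := contDiff_jetCorrection d x₀ (n := 3)
  set v : ℝ → ℝ := fun y => w y + e y with hv
  have hvc : ContDiff ℝ 3 v := hw.add hec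
  have hvi : ∀ j ≤ 3, ∀ y, iteratedDeriv j v y = iteratedDeriv j w y + iteratedDeriv j e y := by
    intro j hj y
    have hj' : ((j : ℕ) : WithTop ℕ∞) ≤ 3 := by exact_mod_cast hj
    exact iteratedDeriv_add (hw.of_le hj').contDiffAt (hec.of_le hj').contDiffAt
  have heB : ∀ j ≤ 3, ∀ y ∈ Set.Icc (x₀ - 1) x₀, |iteratedDeriv j e y| ≤ B * δ :=
    fun j hj y hy => hbB d δ x₀ hd j hj y hy
  have hBδ : B * δ ≤ B := by nlinarith
  have hwR' : ∀ y, ∀ j ≤ 3, |jetSeq w y j| ≤ R + B := fun y j hj => (hwR j hj y).trans (by linarith)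
  have hvR : ∀ y ∈ Set.Icc (x₀ - 1) x₀, ∀ j ≤ 3, |jetSeq v y j| ≤ R + B := by
    intro y hy j hj
    rw [jetSeq, hvi j hj]
    exact (abs_add_le _ _).trans (add_le_add (hwR j hj y) ((heB j hj y hy).trans hBδ))
  have hdiff : ∀ y ∈ Set.Icc (x₀ - 1) x₀,
      ∑ j ∈ Finset.range 4, |jetSeq v y j - jetSeq w y j| ≤ 4 * (B * δ) := by
    intro y hy
    calc _ ≤ ∑ _j ∈ Finset.range 4, B * δ := Finset.sum_le_sum fun j hj => by
          have hj3 : j ≤ 3 := by have := Finset.mem_range.1 hj; omega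
          rw [jetSeq, jetSeq, hvi j hj3, add_sub_cancel_left]
          exact heB j hj3 y hy
      _ = _ := by simp
  have hm2 : ∀ y, 2 * m ≤ |P.a (jetSeq w y) y t| := fun y => by
    have := hwa y
    rw [hm, ← mul_div_assoc, mul_one, mul_comm 2 R, div_mul_cancel_right₀ (by norm_num),
      inv_le_iff_one_le_mul₀' hR]
    exact this
  have hΔa : ∀ y ∈ Set.Icc (x₀ - 1) x₀,
      |P.a (jetSeq v y) y t - P.a (jetSeq w y) y t| ≤ Ca * (4 * (B * δ)) := fun y hy =>
    ((ha y t ht _ (hvR y hy)).2 _ (hwR' y)).trans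
      (mul_le_mul_of_nonneg_left (hdiff y hy) hCa.le)
  have hΔb : ∀ y ∈ Set.Icc (x₀ - 1) x₀,
      |P.b (jetSeq v y) y t - P.b (jetSeq w y) y t| ≤ Cb * (4 * (B * δ)) := fun y hy =>
    ((hb y t ht _ (hvR y hy)).2 _ (hwR' y)).trans
      (mul_le_mul_of_nonneg_left (hdiff y hy) hCb.le)
  have hva : ∀ y ∈ Set.Icc (x₀ - 1) x₀, m ≤ |P.a (jetSeq v y) y t| := by
    intro y hy
    have h1 := abs_sub_abs_le_abs_sub (P.a (jetSeq w y) y t) (P.a (jetSeq v y) y t)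
    rw [abs_sub_comm] at h1
    linarith [hm2 y, hΔa y hy]
  have hder : ∀ y ∈ Set.Icc (x₀ - 1) x₀, HasDerivWithinAt
      (fun y => P.gD (jet 3 v y) y t - P.gD (jet 3 w y) y t)
      ((P.b (jetSeq v y) y t / P.a (jetSeq v y) y t - P.gH (jet 4 v y) y t)
        - (P.b (jetSeq w y) y t / P.a (jetSeq w y) y t - P.gH (jet 4 w y) y t))
      (Set.Icc (x₀ - 1) x₀) y := fun y hy =>
    ((P.ratio v hvc y t ht (abs_pos.1 (hm0.trans_le (hva y hy)))).sub
      (P.ratio w hw y t ht (abs_pos.1 (lt_of_lt_of_le (by positivity) (hm2 y))))).hasDerivWithinAt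
  have hnorm : ∀ u : ℝ → ℝ, ∀ y, (∀ j ≤ 3, |jetSeq u y j| ≤ R + B) → ‖jet 4 u y‖ ≤ R + B := by
    intro u y hu
    rw [pi_norm_le_iff_of_nonneg (by positivity)]
    exact fun i => hu i (by omega)
  have hbound : ∀ y ∈ Set.Icc (x₀ - 1) x₀,
      ‖(P.b (jetSeq v y) y t / P.a (jetSeq v y) y t - P.gH (jet 4 v y) y t)
        - (P.b (jetSeq w y) y t / P.a (jetSeq w y) y t - P.gH (jet 4 w y) y t)‖ ≤ C * δ := by
    intro y hy
    have r1 := abs_div_sub_div_le (b₁ := P.b (jetSeq v y) y t) (b₂ := P.b (jetSeq w y) y t)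
      (K := Ca + Cb) hm0 (hva y hy) ((by linarith : m ≤ 2 * m).trans (hm2 y))
      ((ha y t ht _ (hwR' y)).1.trans (by linarith)) ((hb y t ht _ (hwR' y)).1.trans (by linarith))
    have r2 : |P.gH (jet 4 v y) y t - P.gH (jet 4 w y) y t| ≤ Ch * (4 * (B * δ)) := by
      rw [← P.famH.1 _ y t ht, ← P.famH.1 _ y t ht]
      refine (hh _ _ y (hnorm v y (hvR y hy)) (hnorm w y (hwR' y)) t ht).trans ?_
      refine mul_le_mul_of_nonneg_left ?_ hCh.le
      have := hdiff y hy
      rwa [← Fin.sum_univ_eq_sum_range (fun j => |jetSeq v y j - jetSeq w y j|) 4] at this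
    have r3 : (Ca + Cb) / m ^ 2 * (|P.b (jetSeq v y) y t - P.b (jetSeq w y) y t|
        + |P.a (jetSeq v y) y t - P.a (jetSeq w y) y t|) ≤
        (Ca + Cb) / m ^ 2 * (Cb * (4 * (B * δ)) + Ca * (4 * (B * δ))) := by
      gcongr
      · exact hΔb y hy
      · exact hΔa y hy
    rw [Real.norm_eq_abs, sub_sub_sub_comm]
    refine (abs_sub _ _).trans ?_
    rw [hC]
    calc _ ≤ (Ca + Cb) / m ^ 2 * (Cb * (4 * (B * δ)) + Ca * (4 * (B * δ))) + Ch * (4 * (B * δ)) :=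
          add_le_add (r1.trans r3) r2
      _ = _ := by ring
  have hmv := (convex_Icc (x₀ - 1) x₀).norm_image_sub_le_of_norm_hasDerivWithin_le hder hbound
    (Set.left_mem_Icc.2 (by linarith)) (Set.right_mem_Icc.2 (by linarith))
  have e1 : jet 3 v (x₀ - 1) = jet 3 w (x₀ - 1) := by
    ext i
    change iteratedDeriv i v _ = iteratedDeriv i w _
    rw [hvi i (by omega), he, iteratedDeriv_jetCorrection_sub_one, add_zero]
  have e2 : jet 3 v x₀ = fun i => jet 3 w x₀ i + d i := by
    ext i
    change iteratedDeriv i v _ = iteratedDeriv i w _ + _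
    rw [hvi i (by omega), he, iteratedDeriv_jetCorrection_self]
  simp only [e1, e2, sub_self, sub_zero, sub_sub_cancel, norm_one, mul_one] at hmv
  exact hmv

end Nonlinearity


/-! ### The logarithm of the weight: bounds by low norms, and its dependence on time. -/

/-- The sum of the absolute values of the first four entries of the jet. -/
noncomputable def jetSum (v : ℝ → ℝ) (x : ℝ) : ℝ := ∑ i : Fin 4, |jet 4 v x i|

lemma memLp_jetSum {v : ℝ → ℝ} (h : ∀ j ≤ 3, MemLp (iteratedDeriv j v) 2 volume) :
    MemLp (jetSum v) 2 volume := by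
  unfold jetSum
  exact memLp_finsetSum _ fun i _ => (h i (by omega)).norm

lemma l2_jetSum_le {v : ℝ → ℝ} {R : ℝ} (h : ∀ j ≤ 3, MemLp (iteratedDeriv j v) 2 volume)
    (hR : ∀ j ≤ 3, l2 (iteratedDeriv j v) ≤ R) : l2 (jetSum v) ≤ 4 * R := by
  have e : jetSum v = fun x => (|iteratedDeriv 0 v x| + |iteratedDeriv 1 v x|)
      + (|iteratedDeriv 2 v x| + |iteratedDeriv 3 v x|) := by
    ext x
    rw [jetSum, Fin.sum_univ_four]
    simp only [jet]
    simp
    ring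
  have m := fun j hj => (h j hj).norm
  simp only [Real.norm_eq_abs] at m
  have a := fun j (_ : j ≤ 3) => l2_abs (iteratedDeriv j v)
  rw [e]
  have h0 := l2_add_le (v := fun x => |iteratedDeriv 0 v x| + |iteratedDeriv 1 v x|)
    (w := fun x => |iteratedDeriv 2 v x| + |iteratedDeriv 3 v x|)
    ((m 0 (by norm_num)).add (m 1 (by norm_num)))
    ((m 2 (by norm_num)).add (m 3 (by norm_num)))
  have h1 := l2_add_le (m 0 (by norm_num)) (m 1 (by norm_num))
  have h2 := l2_add_le (m 2 (by norm_num)) (m 3 (by norm_num))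
  rw [l2_abs, l2_abs] at h1 h2
  linarith [hR 0 (by norm_num), hR 1 (by norm_num), hR 2 (by norm_num), hR 3 (by norm_num)]

lemma continuous_iteratedDeriv' {v : ℝ → ℝ} (hv : ContDiff ℝ 11 v) {j : ℕ} (hj : j ≤ 11) :
    Continuous (iteratedDeriv j v) :=
  hv.continuous_iteratedDeriv j (by exact_mod_cast hj)

lemma continuous_jetSum {v : ℝ → ℝ} (hv : ContDiff ℝ 11 v) : Continuous (jetSum v) := by
  unfold jetSum
  exact continuous_finsetSum _ fun i _ => (continuous_iteratedDeriv' hv (by omega)).abs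

lemma abs_log_sub_log_le {x y m : ℝ} (hm : 0 < m) (hx : m ≤ |x|) (hy : m ≤ |y|) :
    |Real.log x - Real.log y| ≤ |x - y| / m := by
  have key : ∀ x y : ℝ, m ≤ |x| → m ≤ |y| → Real.log x - Real.log y ≤ |x - y| / m := by
    intro x y hx hy
    have px := hm.trans_le hx
    have py := hm.trans_le hy
    rw [← Real.log_abs x, ← Real.log_abs y, ← Real.log_div px.ne' py.ne']
    have h1 := Real.log_le_sub_one_of_pos (div_pos px py)
    have h2 : |x| / |y| - 1 ≤ |x - y| / m := by
      rw [div_sub_one py.ne']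
      exact (div_le_div_of_nonneg_right (abs_sub_abs_le_abs_sub x y) py.le).trans
        (div_le_div_of_nonneg_left (abs_nonneg _) hm hy)
    linarith
  rw [abs_le]
  have a := key x y hx hy
  have b := key y x hy hx
  rw [abs_sub_comm] at b
  constructor <;> linarith

namespace Nonlinearity

variable {I : Set ℝ} {f : (Fin 4 → ℝ) → ℝ → ℝ → ℝ} (P : Nonlinearity I f)

/-- Bounds of low order: `H^4` and dispersion. -/
structure LowBound (R : ℝ) (v : ℝ → ℝ) (t : ℝ) : Prop where
  smooth : ContDiff ℝ 11 v
  mem : ∀ j ≤ 4, MemLp (iteratedDeriv j v) 2 volume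
  le : ∀ j ≤ 4, l2 (iteratedDeriv j v) ≤ R
  disp : ∀ x, 1 ≤ R * |P.a (jetSeq v x) x t|

variable {P}

lemma abs_iteratedDeriv_le_of_l2 {v : ℝ → ℝ} (hv : ContDiff ℝ 11 v) {n : ℕ} (hn : n ≤ 10) {R : ℝ}
    (hm : ∀ j ≤ n + 1, MemLp (iteratedDeriv j v) 2 volume)
    (h : ∀ j ≤ n + 1, l2 (iteratedDeriv j v) ≤ R) :
    ∀ j ≤ n, ∀ x, |iteratedDeriv j v x| ≤ 2 * R := by
  intro j hj x
  have := abs_le_l2_add_l2 (fun y => hasDerivAt_iteratedDeriv (m := 11) (n := j)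
    (by exact_mod_cast hv) (by omega) y) (hm j (by omega)) (hm (j + 1) (by omega)) x
  linarith [h j (by omega), h (j + 1) (by omega)]

namespace LowBound

variable {R t : ℝ} {v : ℝ → ℝ}

lemma pos (h : P.LowBound R v t) : 0 < R := by
  have h1 := h.disp 0
  by_contra hc
  have := mul_nonpos_of_nonpos_of_nonneg (not_lt.1 hc) (abs_nonneg (P.a (jetSeq v 0) 0 t))
  linarith

lemma sup (h : P.LowBound R v t) : ∀ j ≤ 3, ∀ x, |iteratedDeriv j v x| ≤ 2 * R :=
  abs_iteratedDeriv_le_of_l2 h.smooth (by norm_num) h.mem h.le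

lemma norm_jet (h : P.LowBound R v t) {d : ℕ} (hd : d ≤ 4) (x : ℝ) : ‖jet d v x‖ ≤ 2 * R := by
  rw [pi_norm_le_iff_of_nonneg (by linarith [h.pos])]
  exact fun i => h.sup i (by omega) x

lemma inv_le (h : P.LowBound R v t) (x : ℝ) : 1 / R ≤ |P.a (jetSeq v x) x t| := by
  rw [div_le_iff₀ h.pos, mul_comm]; exact h.disp x

lemma ne_zero (h : P.LowBound R v t) (x : ℝ) : P.a (jetSeq v x) x t ≠ 0 := fun h0 => by
  have := h.disp x
  rw [h0, abs_zero, mul_zero] at this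
  linarith

end LowBound

variable (P)

/-- The primitive of the modified diffusion ratio. -/
noncomputable def primitive (v : ℝ → ℝ) (t x : ℝ) : ℝ :=
  P.gD (jet 3 v 0) 0 t + ∫ y in (0 : ℝ)..x, P.b (jetSeq v y) y t / P.a (jetSeq v y) y t

/-- The logarithm of the weight. -/
noncomputable def logWeight (μ : ℝ) (v : ℝ → ℝ) (t x : ℝ) : ℝ :=
  μ * Real.log (P.a (jetSeq v x) x t) + 2 / 3 * P.primitive v t x

variable {P}

lemma continuous_a {v : ℝ → ℝ} (hv : ContDiff ℝ 11 v) {t : ℝ} (ht : t ∈ I) :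
    Continuous fun x => P.a (jetSeq v x) x t :=
  continuous_iff_continuousAt.2 fun x => (P.E.total_a v hv t ht x).continuousAt

lemma continuous_b {v : ℝ → ℝ} (hv : ContDiff ℝ 11 v) {t : ℝ} (ht : t ∈ I) :
    Continuous fun x => P.b (jetSeq v x) x t :=
  continuous_iff_continuousAt.2 fun x => (P.E.total_b v hv t ht x).continuousAt

lemma LowBound.hasDerivAt_primitive {R t : ℝ} {v : ℝ → ℝ} (h : P.LowBound R v t) (ht : t ∈ I)
    (x : ℝ) : HasDerivAt (P.primitive v t) (P.b (jetSeq v x) x t / P.a (jetSeq v x) x t) x := by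
  have hc : Continuous fun y => P.b (jetSeq v y) y t / P.a (jetSeq v y) y t :=
    (continuous_b h.smooth ht).div (continuous_a h.smooth ht) h.ne_zero
  exact (hc.integral_hasStrictDerivAt 0 x).hasDerivAt.const_add _

/-- Condition (A2) in the form in which it is used. With the constant of integration in `primitive`,
the difference also vanishes at `x = 0`, so it is the primitive of `g_H` from `0`. -/
lemma LowBound.hasDerivAt_primitive_sub {R t : ℝ} {v : ℝ → ℝ} (h : P.LowBound R v t) (ht : t ∈ I)
    (x : ℝ) : HasDerivAt (fun x => P.primitive v t x - P.gD (jet 3 v x) x t)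
      (P.gH (jet 4 v x) x t) x := by
  have := (h.hasDerivAt_primitive ht x).sub
    (P.ratio v (h.smooth.of_le (by norm_num)) x t ht (h.ne_zero x))
  rwa [sub_sub_cancel] at this

lemma primitive_zero (v : ℝ → ℝ) (t : ℝ) : P.primitive v t 0 - P.gD (jet 3 v 0) 0 t = 0 := by
  simp [primitive]

variable (P)

/-- The integral of `b/a` over long intervals has no evident bound. After removal of `g_D`, which is
bounded along bounded jets, the integrand is `g_H`, at most a constant times the squared jet, and
the integral of the latter is controlled by `L²` norms of derivatives of order at most three. -/
lemma primitive_bound (R : ℝ) : ∃ C, 0 < C ∧ ∀ v, ∀ t ∈ I, P.LowBound R v t →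
    ∀ x, |P.primitive v t x| ≤ C := by
  obtain ⟨Cq, hCq, hq⟩ := P.famH.quadratic P.convex P.uniqueDiff P.gH_zero (2 * R)
  obtain ⟨Cg, hCg, hg⟩ := P.famD.bound (α := 0) (β := 0) (γ := 0) (by norm_num) (by simp) le_rfl
    (2 * R)
  refine ⟨Cq * (4 * R) ^ 2 + Cg, by positivity, fun v t ht h x => ?_⟩
  have hm : MemLp (jetSum v) 2 volume := memLp_jetSum fun j hj => h.mem j (by omega)
  have h1 := abs_sub_le_integral (h.hasDerivAt_primitive_sub ht)
    (m := fun x => Cq * jetSum v x ^ 2)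
    (((continuous_jetSum h.smooth).pow 2).const_mul Cq |> fun h => by simpa using h)
    (hm.integrable_sq.const_mul Cq)
    (fun y => by
      have := hq (jet 4 v y) 0 y (h.norm_jet le_rfl y) (by simpa using h.pos.le) t ht t ht
      rw [(P.gH_zero y t ht).1] at this
      simp only [sub_zero, Pi.zero_apply, abs_zero, Finset.sum_const_zero, add_zero, sub_self,
        mul_zero, ← sq] at this
      exact this) x 0
  rw [primitive_zero, sub_zero, integral_const_mul, l2_sq hm] at h1
  have h2 : l2 (jetSum v) ^ 2 ≤ (4 * R) ^ 2 := by
    have := l2_jetSum_le (fun j hj => h.mem j (by omega)) (fun j hj => h.le j (by omega))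
    exact pow_le_pow_left₀ (l2_nonneg _) this 2
  have h3 := hg (jet 3 v x) x t ht (h.norm_jet (by norm_num) x)
  rw [P.famD.1 _ x t ht] at h3
  have h4 := mul_le_mul_of_nonneg_left h2 hCq.le
  have h5 : P.primitive v t x =
    (P.primitive v t x - P.gD (jet 3 v x) x t) + P.gD (jet 3 v x) x t := by ring
  rw [h5]
  exact (abs_add_le _ _).trans (by linarith)

lemma logWeight_bound (μ R : ℝ) : ∃ C, 0 < C ∧ ∀ v, ∀ t ∈ I, P.LowBound R v t →
    ∀ x, |P.logWeight μ v t x| ≤ C := by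
  obtain ⟨C, hC, hp⟩ := P.primitive_bound R
  obtain ⟨Ca, hCa, ha⟩ := P.bound_lipschitz P.jetFun_a (2 * R)
  refine ⟨|μ| * (|Real.log Ca| + |Real.log R|) + 2 / 3 * C, by positivity, fun v t ht h x => ?_⟩
  have h1 : |Real.log (P.a (jetSeq v x) x t)| ≤ |Real.log Ca| + |Real.log R| := by
    rw [← Real.log_abs (P.a (jetSeq v x) x t)]
    have hu := (ha x t ht (jetSeq v x) (fun j hj => h.sup j hj x)).1
    have hl := h.inv_le x
    have p := h.pos
    have l1 := Real.log_le_log (abs_pos.2 (h.ne_zero x)) hu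
    have l2 := Real.log_le_log (by positivity) hl
    rw [one_div, Real.log_inv] at l2
    rw [abs_le]
    constructor
    · linarith [le_abs_self (Real.log R), abs_nonneg (Real.log Ca)]
    · linarith [le_abs_self (Real.log Ca), abs_nonneg (Real.log R)]
  rw [logWeight]
  refine (abs_add_le _ _).trans ?_
  rw [abs_mul, abs_mul, abs_of_pos (by norm_num : (0 : ℝ) < 2 / 3)]
  have := mul_le_mul_of_nonneg_left h1 (abs_nonneg μ)
  linarith [hp v t ht h x]

/-- The weight is Lipschitz in time along Lipschitz curves in `H^4`. -/
lemma logWeight_lipschitz (μ R : ℝ) : ∃ C η, 0 < C ∧ 0 < η ∧ ∀ v w : ℝ → ℝ, ∀ t ∈ I, ∀ s ∈ I,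
    ∀ δ, P.LowBound R v t → P.LowBound R w s → δ ≤ η →
      (∀ j ≤ 4, l2 (iteratedDeriv j (fun x => v x - w x)) ≤ δ) →
      ∀ x, |P.logWeight μ v t x - P.logWeight μ w s x| ≤ C * (δ + |t - s|) := by
  rcases le_or_gt R 0 with hR | hR
  · exact ⟨1, 1, one_pos, one_pos, fun v w t _ s _ δ h => absurd h.pos (not_lt.2 hR)⟩
  obtain ⟨Cq, hCq, hq⟩ := P.famH.quadratic P.convex P.uniqueDiff P.gH_zero (2 * R)
  obtain ⟨Ct, hCt, hgt⟩ := P.famD.lipschitz_t P.convex (β := 0) (γ := 0) (by simp) le_rfl (2 * R)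
  obtain ⟨Cg, η, hCg, hη, hg⟩ := P.gD_lipschitz (2 * R) (by positivity)
  obtain ⟨Ca, hCa, ha⟩ := P.bound_lipschitz P.jetFun_a (2 * R)
  obtain ⟨Cs, hCs, has⟩ := P.fam.lipschitz_t P.convex (β := Pi.single 3 1) (γ := 0) (by simp)
    (by norm_num) (2 * R)
  set C₁ := Ca * 8 * R + Cs * R with hC₁
  set C₂ := Ct + 2 * Cg with hC₂
  set C₃ := Cq * (32 * R + (4 * R) ^ 2) with hC₃
  -- The Sobolev inequality turns the `L²` bound `δ` into the bound `2 * δ` for the jets; hence `η /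
  -- 2`.
  refine ⟨|μ| * C₁ + 2 / 3 * (C₂ + C₃), η / 2, by positivity, by positivity,
    fun v w t ht s hs δ hv hw hδη hδ x => ?_⟩
  have hδ0 : 0 ≤ δ := (l2_nonneg _).trans (hδ 0 (by norm_num))
  set d : ℝ → ℝ := fun x => v x - w x with hd
  have hdc : ContDiff ℝ 11 d := hv.smooth.sub hw.smooth
  have hdi : ∀ j ≤ 11, iteratedDeriv j d = fun y => iteratedDeriv j v y - iteratedDeriv j w y := by
    intro j hj
    ext y
    have hj' : ((j : ℕ) : WithTop ℕ∞) ≤ 11 := by exact_mod_cast hj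
    exact iteratedDeriv_sub (hv.smooth.of_le hj').contDiffAt (hw.smooth.of_le hj').contDiffAt
  have hdm : ∀ j ≤ 4, MemLp (iteratedDeriv j d) 2 volume := fun j hj => by
    rw [hdi j (by omega)]; exact (hv.mem j hj).sub (hw.mem j hj)
  have hds : ∀ j ≤ 3, ∀ y, |iteratedDeriv j v y - iteratedDeriv j w y| ≤ 2 * δ := by
    intro j hj y
    have := abs_iteratedDeriv_le_of_l2 hdc (n := 3) (by norm_num) hdm hδ j hj y
    rwa [hdi j (by omega)] at this
  -- the logarithm
  have hlog : |Real.log (P.a (jetSeq v x) x t) - Real.log (P.a (jetSeq w x) x s)| ≤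
      C₁ * (δ + |t - s|) := by
    refine (abs_log_sub_log_le (by positivity) (hv.inv_le x) (hw.inv_le x)).trans ?_
    have e1 := (ha x t ht (jetSeq v x) (fun j hj => hv.sup j hj x)).2 (jetSeq w x)
      (fun j hj => hw.sup j hj x)
    have e2 : ∑ j ∈ Finset.range (3 + 1), |jetSeq v x j - jetSeq w x j| ≤ 8 * δ := by
      calc _ ≤ ∑ _j ∈ Finset.range 4, 2 * δ := Finset.sum_le_sum fun j hj =>
            hds j (by have := Finset.mem_range.1 hj; omega) x
        _ = _ := by simp; ring
    have e3 : |P.a (jetSeq w x) x t - P.a (jetSeq w x) x s| ≤ Cs * |t - s| :=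
      has (jet 4 w x) x (hw.norm_jet le_rfl x) t ht s hs
    have e4 := abs_sub_le (P.a (jetSeq v x) x t) (P.a (jetSeq w x) x t) (P.a (jetSeq w x) x s)
    have e5 := mul_le_mul_of_nonneg_left e2 hCa.le
    have hts := abs_nonneg (t - s)
    rw [div_le_iff₀ (by positivity), hC₁]
    have : (Ca * 8 * R + Cs * R) * (δ + |t - s|) * (1 / R) =
      (Ca * 8 + Cs) * (δ + |t - s|) := by field_simp
    rw [this]
    nlinarith [mul_nonneg hCa.le hts, mul_nonneg hCs.le hδ0]
  have hgd : |P.gD (jet 3 v x) x t - P.gD (jet 3 w x) x s| ≤ C₂ * (δ + |t - s|) := by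
    have e1 : |P.gD (jet 3 v x) x t - P.gD (jet 3 v x) x s| ≤ Ct * |t - s| := by
      have := hgt (jet 3 v x) x (hv.norm_jet (by norm_num) x) t ht s hs
      rwa [P.famD.1 _ x t ht, P.famD.1 _ x s hs] at this
    -- The jet of `v` enters as a perturbation of that of `w`, at the time `s` at which the
    -- dispersion of `w` is known. The change of time was split off in `e1`.
    have e2 := hg w s x (2 * δ) (fun i => jet 3 v x i - jet 3 w x i)
      (hw.smooth.of_le (by norm_num)) hs hw.sup
      (fun y => (hw.disp y).trans (by nlinarith [abs_nonneg (P.a (jetSeq w y) y s)]))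
      (fun j => hds j (by omega) x) (by linarith)
    simp only [add_sub_cancel] at e2
    have e3 := abs_sub_le (P.gD (jet 3 v x) x t) (P.gD (jet 3 v x) x s) (P.gD (jet 3 w x) x s)
    have e4 : (fun i => jet 3 v x i) = jet 3 v x := rfl
    rw [e4] at e2
    rw [hC₂]
    nlinarith [mul_nonneg hCt.le hδ0, mul_nonneg hCg.le (abs_nonneg (t - s))]
  -- A pointwise Lipschitz bound for `g_H` would not be integrable on the line. The quadratic form
  -- of the increment gives products of two square integrable functions.
  have hrem : |(P.primitive v t x - P.gD (jet 3 v x) x t) -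
      (P.primitive w s x - P.gD (jet 3 w x) x s)| ≤ C₃ * (δ + |t - s|) := by
    have mv : MemLp (jetSum v) 2 volume := memLp_jetSum fun j hj => hv.mem j (by omega)
    have mw : MemLp (jetSum w) 2 volume := memLp_jetSum fun j hj => hw.mem j (by omega)
    have md : MemLp (jetSum d) 2 volume := memLp_jetSum fun j hj => hdm j (by omega)
    have lv := l2_jetSum_le (fun j hj => hv.mem j (by omega)) (fun j hj => hv.le j (by omega))
    have lw := l2_jetSum_le (fun j hj => hw.mem j (by omega)) (fun j hj => hw.le j (by omega))
    have ld := l2_jetSum_le (fun j hj => hdm j (by omega)) (fun j hj => hδ j (by omega))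
    have i1 : Integrable (fun y => (jetSum v y + jetSum w y) * jetSum d y) :=
      integrable_mul (mv.add mw) md
    have h1 := abs_sub_le_integral
      (fun y => (hv.hasDerivAt_primitive_sub ht y).sub (hw.hasDerivAt_primitive_sub hs y))
      (m := fun y => Cq * ((jetSum v y + jetSum w y) * jetSum d y) +
        Cq * |t - s| * jetSum w y ^ 2)
      (by
        have c1 := continuous_jetSum hv.smooth
        have c2 := continuous_jetSum hw.smooth
        have c3 := continuous_jetSum hdc
        fun_prop)
      ((i1.const_mul Cq).add (mw.integrable_sq.const_mul _))
      (fun y => by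
        have := hq (jet 4 v y) (jet 4 w y) y (hv.norm_jet le_rfl y) (hw.norm_jet le_rfl y) t ht s hs
        have e : ∑ i, |jet 4 v y i - jet 4 w y i| = jetSum d y := by
          refine Finset.sum_congr rfl fun i _ => ?_
          simp only [jet]
          rw [hdi i (by omega)]
        rw [e] at this
        refine this.trans_eq ?_
        simp only [jetSum]
        ring) x 0
    simp only [Pi.sub_apply] at h1
    rw [primitive_zero, primitive_zero, sub_zero, sub_zero,
      integral_add (i1.const_mul Cq) (mw.integrable_sq.const_mul _), integral_const_mul,
      integral_const_mul, l2_sq mw] at h1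
    have h2 := abs_integral_mul_le (v := fun y => jetSum v y + jetSum w y) (mv.add mw) md
    have h3 := l2_add_le mv mw
    have h4 : l2 (fun y => jetSum v y + jetSum w y) * l2 (jetSum d) ≤ (8 * R) * (4 * δ) :=
      mul_le_mul (by linarith) ld (l2_nonneg _) (by positivity)
    have h5 : l2 (jetSum w) ^ 2 ≤ (4 * R) ^ 2 := pow_le_pow_left₀ (l2_nonneg _) lw 2
    have h6 := mul_le_mul_of_nonneg_left (((le_abs_self _).trans h2).trans h4) hCq.le
    have h7 := mul_le_mul_of_nonneg_left h5 (mul_nonneg hCq.le (abs_nonneg (t - s)))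
    have h8 : 0 ≤ Cq * (4 * R) ^ 2 * δ := by positivity
    have h9 : 0 ≤ Cq * (32 * R) * |t - s| := by positivity
    rw [hC₃]
    linarith
  rw [logWeight, logWeight]
  have e : μ * Real.log (P.a (jetSeq v x) x t) + 2 / 3 * P.primitive v t x -
      (μ * Real.log (P.a (jetSeq w x) x s) + 2 / 3 * P.primitive w s x) =
    μ * (Real.log (P.a (jetSeq v x) x t) - Real.log (P.a (jetSeq w x) x s)) +
    2 / 3 * ((P.gD (jet 3 v x) x t - P.gD (jet 3 w x) x s) +
      ((P.primitive v t x - P.gD (jet 3 v x) x t) -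
      (P.primitive w s x - P.gD (jet 3 w x) x s))) := by ring
  rw [e]
  refine (abs_add_le _ _).trans ?_
  rw [abs_mul, abs_mul, abs_of_pos (by norm_num : (0 : ℝ) < 2 / 3)]
  have q1 := mul_le_mul_of_nonneg_left hlog (abs_nonneg μ)
  have q2 := (abs_add_le _ _).trans (add_le_add hgd hrem)
  linarith

end Nonlinearity


/-! ### Uniform bounds on time slices, and the derivatives of the weight. -/

lemma memLp_mul_of_bddCont {r v : ℝ → ℝ} {C : ℝ} (hr : Continuous r) (hC : ∀ x, |r x| ≤ C)
    (hv : MemLp v 2 volume) : MemLp (fun x => r x * v x) 2 volume ∧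
      l2 (fun x => r x * v x) ≤ C * l2 v := by
  have h0 : 0 ≤ C := (abs_nonneg _).trans (hC 0)
  refine ⟨memLp_of_bdd_mul hr hC hv, l2_le_of_abs_le hv (fun x => ?_) h0⟩
  rw [abs_mul]
  exact mul_le_mul_of_nonneg_right (hC x) (abs_nonneg _)

lemma l2_sum_le {ι : Type*} (S : Finset ι) {v : ι → ℝ → ℝ} (h : ∀ i ∈ S, MemLp (v i) 2 volume) :
    l2 (fun x => ∑ i ∈ S, v i x) ≤ ∑ i ∈ S, l2 (v i) := by
  classical
  induction S using Finset.induction_on with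
  | empty => simp [l2]
  | insert i S hi ih =>
    simp only [Finset.sum_insert hi]
    have h' : ∀ j ∈ S, MemLp (v j) 2 volume := fun j hj => h j (Finset.mem_insert_of_mem hj)
    exact (l2_add_le (h i (Finset.mem_insert_self _ _)) (memLp_finsetSum S h')).trans
      (by linarith [ih h'])

namespace Nonlinearity

variable {I : Set ℝ} {f : (Fin 4 → ℝ) → ℝ → ℝ → ℝ} (P : Nonlinearity I f)

/-- The bounds on a time slice of a solution. -/
structure SliceBound (R ε : ℝ) (v : ℝ → ℝ) (t : ℝ) : Prop where
  time : t ∈ I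
  smooth : ContDiff ℝ 11 v
  mem : ∀ j ≤ 11, MemLp (iteratedDeriv j v) 2 volume
  le : ∀ j ≤ 7, l2 (iteratedDeriv j v) ≤ R
  nonneg : 0 ≤ ε
  eps_le : ∀ j ≤ 8, ε * l2 (iteratedDeriv j v) ≤ R
  disp : ∀ x, 1 ≤ R * |P.a (jetSeq v x) x t|

/-- Functions of time slices that are continuous and uniformly bounded. -/
def Unif (R : ℝ) (G : (ℝ → ℝ) → ℝ → ℝ → ℝ) : Prop :=
  ∃ C, ∀ ε v t, P.SliceBound R ε v t → Continuous (G v t) ∧ ∀ x, |G v t x| ≤ C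

variable {P}

namespace SliceBound

variable {R ε t : ℝ} {v : ℝ → ℝ}

lemma lowBound (h : P.SliceBound R ε v t) : P.LowBound R v t :=
  ⟨h.smooth, fun j hj => h.mem j (by omega), fun j hj => h.le j (by omega), h.disp⟩

lemma sup (h : P.SliceBound R ε v t) : ∀ j ≤ 6, ∀ x, |iteratedDeriv j v x| ≤ 2 * R :=
  abs_iteratedDeriv_le_of_l2 h.smooth (by norm_num) (fun j hj => h.mem j (by omega)) h.le

lemma hasDerivAt (h : P.SliceBound R ε v t) {j : ℕ} (hj : j ≤ 10) (x : ℝ) :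
    HasDerivAt (iteratedDeriv j v) (iteratedDeriv (j + 1) v x) x :=
  hasDerivAt_iteratedDeriv (m := 11) (by exact_mod_cast h.smooth) (by omega) x

end SliceBound

lemma continuous_jetFun {F : (ℕ → ℝ) → ℝ → ℝ → ℝ} (hF : JetFun (P.D 0) 6 9 F) {v : ℝ → ℝ}
    (hv : ContDiff ℝ 11 v) {t : ℝ} (ht : t ∈ I) : Continuous fun x => F (jetSeq v x) x t := by
  obtain ⟨G, -, hG⟩ := hF.exists_totalDeriv' P.fam (by norm_num) (by norm_num) (by norm_num)
  exact continuous_iff_continuousAt.2 fun x => (hG v hv t ht x).continuousAt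

lemma unif_jetFun {F : (ℕ → ℝ) → ℝ → ℝ → ℝ} (hF : JetFun (P.D 0) 6 9 F) (R : ℝ) :
    P.Unif R fun v t x => F (jetSeq v x) x t := by
  obtain ⟨C, -, hC⟩ := P.bound_lipschitz hF (2 * R)
  exact ⟨C, fun ε v t h => ⟨continuous_jetFun hF h.smooth h.time, fun x =>
    (hC x t h.time _ fun j hj => h.sup j hj x).1⟩⟩

namespace Unif

variable {R : ℝ} {G H : (ℝ → ℝ) → ℝ → ℝ → ℝ}

lemma add (hG : P.Unif R G) (hH : P.Unif R H) : P.Unif R fun v t x => G v t x + H v t x := by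
  obtain ⟨C, hC⟩ := hG
  obtain ⟨C', hC'⟩ := hH
  exact ⟨C + C', fun ε v t h => ⟨(hC ε v t h).1.add (hC' ε v t h).1, fun x =>
    (abs_add_le _ _).trans (add_le_add ((hC ε v t h).2 x) ((hC' ε v t h).2 x))⟩⟩

lemma mul (hG : P.Unif R G) (hH : P.Unif R H) : P.Unif R fun v t x => G v t x * H v t x := by
  obtain ⟨C, hC⟩ := hG
  obtain ⟨C', hC'⟩ := hH
  refine ⟨C * C', fun ε v t h => ⟨(hC ε v t h).1.mul (hC' ε v t h).1, fun x => ?_⟩⟩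
  rw [abs_mul]
  exact mul_le_mul ((hC ε v t h).2 x) ((hC' ε v t h).2 x) (abs_nonneg _)
    ((abs_nonneg _).trans ((hC ε v t h).2 x))

lemma const (c : ℝ) : P.Unif R fun _ _ _ => c :=
  ⟨|c|, fun _ _ _ _ => ⟨continuous_const, fun _ => le_rfl⟩⟩

lemma sub (hG : P.Unif R G) (hH : P.Unif R H) : P.Unif R fun v t x => G v t x - H v t x := by
  simpa [sub_eq_add_neg] using hG.add ((const (-1)).mul hH)

lemma bddCont (hG : P.Unif R G) {ε t : ℝ} {v : ℝ → ℝ} (h : P.SliceBound R ε v t) :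
    BddCont (G v t) :=
  let ⟨C, hC⟩ := hG
  ⟨(hC ε v t h).1, C, (hC ε v t h).2⟩

lemma inv_a : P.Unif R fun v t x => (P.a (jetSeq v x) x t)⁻¹ := by
  refine ⟨R, fun ε v t h => ⟨(continuous_a h.smooth h.time).inv₀ h.lowBound.ne_zero, fun x => ?_⟩⟩
  rw [abs_inv, inv_le_iff_one_le_mul₀ (abs_pos.2 (h.lowBound.ne_zero x))]
  exact h.disp x

end Unif

section Weight

variable (P)

/-- The weight of the energy of order `N`. -/
noncomputable def weight (N : ℕ) (v : ℝ → ℝ) (t x : ℝ) : ℝ :=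
  Real.exp (P.logWeight (2 * N / 3 - 1) v t x)

/-- The coefficient of the derivative of order `N + 2` in the derivative of order `N` of `f`. -/
noncomputable def subCoef (N : ℕ) (v : ℝ → ℝ) (t x : ℝ) : ℝ :=
  P.b (jetSeq v x) x t + N * P.E.a₁ (jetSeq v x) x t

/-- The first derivative of `subCoef`. -/
noncomputable def subCoef₁ (N : ℕ) (v : ℝ → ℝ) (t x : ℝ) : ℝ :=
  P.E.b₁ (jetSeq v x) x t + N * P.E.a₂ (jetSeq v x) x t

/-- The second derivative of `subCoef`. -/
noncomputable def subCoef₂ (N : ℕ) (v : ℝ → ℝ) (t x : ℝ) : ℝ :=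
  P.E.b₂ (jetSeq v x) x t + N * P.E.a₃ (jetSeq v x) x t

/-- The logarithmic derivative of the weight. -/
noncomputable def rate (N : ℕ) (v : ℝ → ℝ) (t x : ℝ) : ℝ :=
  (2 / 3 * P.subCoef N v t x - P.E.a₁ (jetSeq v x) x t) * (P.a (jetSeq v x) x t)⁻¹

/-- The derivative of `rate`. -/
noncomputable def rate₁ (N : ℕ) (v : ℝ → ℝ) (t x : ℝ) : ℝ :=
  (2 / 3 * P.subCoef₁ N v t x - P.E.a₂ (jetSeq v x) x t) * (P.a (jetSeq v x) x t)⁻¹ -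
    P.rate N v t x * (P.E.a₁ (jetSeq v x) x t * (P.a (jetSeq v x) x t)⁻¹)

variable {P} {N : ℕ} {R ε t : ℝ} {v : ℝ → ℝ}

lemma hasDerivAt_subCoef (h : P.SliceBound R ε v t) (x : ℝ) :
    HasDerivAt (P.subCoef N v t) (P.subCoef₁ N v t x) x :=
  (P.E.total_b v h.smooth t h.time x).fun_add
    ((P.E.total_a₁ v h.smooth t h.time x).const_mul (N : ℝ))

lemma hasDerivAt_subCoef₁ (h : P.SliceBound R ε v t) (x : ℝ) :
    HasDerivAt (P.subCoef₁ N v t) (P.subCoef₂ N v t x) x :=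
  (P.E.total_b₁ v h.smooth t h.time x).fun_add
    ((P.E.total_a₂ v h.smooth t h.time x).const_mul (N : ℝ))

lemma hasDerivAt_rate (h : P.SliceBound R ε v t) (x : ℝ) :
    HasDerivAt (P.rate N v t) (P.rate₁ N v t x) x := by
  have h1 := P.E.total_a v h.smooth t h.time x
  have h2 := P.E.total_a₁ v h.smooth t h.time x
  have h0 := h.lowBound.ne_zero x
  refine ((((hasDerivAt_subCoef h x).const_mul (2 / 3)).fun_sub h2).fun_mul
    (h1.fun_inv h0)).congr_deriv ?_
  rw [rate₁, rate]
  field_simp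
  ring

/-- The exponent `2N/3 - 1` and the factor `2/3` in `logWeight` are the solution of `(ρ a)' = (2/3)
ρ (b + N a')`, the relation required by `integral_dispersive`. The identity is used in this form in
`weighted_slice`. -/
lemma hasDerivAt_weight (h : P.SliceBound R ε v t) (x : ℝ) :
    HasDerivAt (P.weight N v t) (P.weight N v t x * P.rate N v t x) x := by
  have h0 := h.lowBound.ne_zero x
  have h1 := ((P.E.total_a v h.smooth t h.time x).log h0).const_mul (2 * (N : ℝ) / 3 - 1)
  have h2 := (h.lowBound.hasDerivAt_primitive h.time x).const_mul (2 / 3)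
  refine ((h1.fun_add h2).exp).congr_deriv ?_
  rw [rate, subCoef, weight, logWeight]
  congr 1
  field_simp
  ring

lemma Unif.subCoef : P.Unif R (P.subCoef N) :=
  (unif_jetFun (P.jetFun_b.mono (by norm_num) le_rfl) R).add
    ((Unif.const (N : ℝ)).mul (unif_jetFun (P.E.jetFun_a₁.mono (by norm_num) le_rfl) R))

lemma Unif.subCoef₁ : P.Unif R (P.subCoef₁ N) :=
  (unif_jetFun (P.E.jetFun_b₁.mono (by norm_num) le_rfl) R).add
    ((Unif.const (N : ℝ)).mul (unif_jetFun (P.E.jetFun_a₂.mono (by norm_num) le_rfl) R))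

lemma Unif.subCoef₂ : P.Unif R (P.subCoef₂ N) :=
  (unif_jetFun (P.E.jetFun_b₂.mono (by norm_num) le_rfl) R).add
    ((Unif.const (N : ℝ)).mul (unif_jetFun P.E.jetFun_a₃ R))

lemma Unif.rate : P.Unif R (P.rate N) :=
  (((Unif.const (2 / 3)).mul Unif.subCoef).sub
    (unif_jetFun (P.E.jetFun_a₁.mono (by norm_num) le_rfl) R)).mul Unif.inv_a

lemma Unif.rate₁ : P.Unif R (P.rate₁ N) :=
  ((((Unif.const (2 / 3)).mul Unif.subCoef₁).sub
    (unif_jetFun (P.E.jetFun_a₂.mono (by norm_num) le_rfl) R)).mul Unif.inv_a).sub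
    (Unif.rate.mul ((unif_jetFun (P.E.jetFun_a₁.mono (by norm_num) le_rfl) R).mul Unif.inv_a))

variable (P) in
/-- Two-sided bounds for the weight, by the norms of low order. -/
lemma weight_bound (N : ℕ) (R : ℝ) : ∃ C, 0 < C ∧ ∀ v, ∀ t ∈ I, P.LowBound R v t →
    ∀ x, C⁻¹ ≤ P.weight N v t x ∧ P.weight N v t x ≤ C := by
  obtain ⟨C, hC, h⟩ := P.logWeight_bound (2 * N / 3 - 1) R
  refine ⟨Real.exp C, Real.exp_pos _, fun v t ht hv x => ?_⟩
  have := abs_le.1 (h v t ht hv x)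
  rw [← Real.exp_neg]
  exact ⟨Real.exp_le_exp.2 this.1, Real.exp_le_exp.2 this.2⟩

lemma Unif.weight : P.Unif R (P.weight N) := by
  obtain ⟨C, hC, h⟩ := P.weight_bound N R
  refine ⟨C, fun ε v t hs => ⟨continuous_iff_continuousAt.2 fun x =>
    (hasDerivAt_weight hs x).continuousAt, fun x => ?_⟩⟩
  rw [abs_of_pos (show 0 < P.weight N v t x from Real.exp_pos _)]
  exact (h v t hs.time hs.lowBound x).2

end Weight

end Nonlinearity


/-! ### Energy inequalities at a fixed time. -/

namespace Nonlinearity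

variable {I : Set ℝ} {f : (Fin 4 → ℝ) → ℝ → ℝ → ℝ} {P : Nonlinearity I f}

/-- Inherited from `f` by `TotalDeriv.apply_zero`. The remainders in the expansions then vanish at
the zero jet too, so that Lipschitz bounds become `L²` bounds. -/
lemma phi_zero {i : ℕ} (hi : i ≤ 8) {t : ℝ} (ht : t ∈ I) : ∀ x, P.E.Φ i 0 x t = 0 := by
  induction i with
  | zero =>
    intro x
    rw [P.E.Φ_zero]
    exact (P.fam.1 _ x t ht).trans (P.f_zero x t ht)
  | succ i ih => exact (P.E.Φ_succ i (by omega)).apply_zero ht (ih (by omega))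

/-- The `L²` bound for functions of the jet that vanish at the zero jet. -/
lemma l2_jetFun_le {F : (ℕ → ℝ) → ℝ → ℝ → ℝ} (hF : JetFun (P.D 0) 6 9 F)
    (h0 : ∀ t ∈ I, ∀ x, F 0 x t = 0) (R : ℝ) : ∃ C, 0 < C ∧ ∀ ε v t, P.SliceBound R ε v t →
      MemLp (fun x => F (jetSeq v x) x t) 2 volume ∧
      l2 (fun x => F (jetSeq v x) x t) ≤ C * ∑ j ∈ Finset.range 7, l2 (iteratedDeriv j v) := by
  obtain ⟨C, hC, h⟩ := P.bound_lipschitz hF (2 * |R|)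
  refine ⟨C, hC, fun ε v t hs => ?_⟩
  have hm : ∀ j ∈ Finset.range 7, MemLp (fun x => |iteratedDeriv j v x|) 2 volume :=
    fun j hj => (hs.mem j (by have := Finset.mem_range.1 hj; omega)).norm
  have hle : ∀ x, |F (jetSeq v x) x t| ≤
      C * |(∑ j ∈ Finset.range 7, |iteratedDeriv j v x|)| := fun x => by
    have := (h x t hs.time (jetSeq v x) fun j hj => (hs.sup j hj x).trans
      (by linarith [le_abs_self R])).2 0 fun j _ => by simp
    simp only [h0 t hs.time, sub_zero, Pi.zero_apply] at this
    exact this.trans (mul_le_mul_of_nonneg_left (le_abs_self _) hC.le)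
  refine ⟨memLp_of_abs_le (continuous_jetFun hF hs.smooth hs.time) hle (memLp_finsetSum _ hm), ?_⟩
  refine (l2_le_of_abs_le (memLp_finsetSum _ hm) hle hC.le).trans ?_
  refine mul_le_mul_of_nonneg_left ((l2_sum_le _ hm).trans_eq ?_) hC.le
  exact Finset.sum_congr rfl fun j _ => l2_abs _

lemma Unif.l2_mul {R : ℝ} {G : (ℝ → ℝ) → ℝ → ℝ → ℝ} (hG : P.Unif R G) :
    ∃ C, 0 < C ∧ ∀ ε v t, P.SliceBound R ε v t → ∀ w, MemLp w 2 volume →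
      MemLp (fun x => G v t x * w x) 2 volume ∧ l2 (fun x => G v t x * w x) ≤ C * l2 w := by
  obtain ⟨C, hC⟩ := hG
  refine ⟨|C| + 1, by positivity, fun ε v t h w hw => ?_⟩
  refine ⟨(memLp_mul_of_bddCont (hC ε v t h).1 (hC ε v t h).2 hw).1,
    (memLp_mul_of_bddCont (hC ε v t h).1 (hC ε v t h).2 hw).2.trans ?_⟩
  exact mul_le_mul_of_nonneg_right (by linarith [le_abs_self C]) (l2_nonneg _)

namespace SliceBound

variable {R ε t : ℝ} {v : ℝ → ℝ}

lemma sum_le (h : P.SliceBound R ε v t) :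
    ∑ j ∈ Finset.range 7, l2 (iteratedDeriv j v) ≤ 7 * R := by
  calc _ ≤ ∑ _j ∈ Finset.range 7, R := Finset.sum_le_sum fun j hj =>
        h.le j (by have := Finset.mem_range.1 hj; omega)
    _ = _ := by simp

lemma eps_sum_le (h : P.SliceBound R ε v t) :
    ε * ∑ j ∈ Finset.range 7, l2 (iteratedDeriv j v) ≤ 7 * R := by
  rw [Finset.mul_sum]
  calc _ ≤ ∑ _j ∈ Finset.range 7, R := Finset.sum_le_sum fun j hj =>
        h.eps_le j (by have := Finset.mem_range.1 hj; omega)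
    _ = _ := by simp

end SliceBound

variable (P)

/-- The spatial derivatives of order at most four of `f` are bounded in `L²`. -/
lemma l2_phi_le (R : ℝ) : ∃ C, 0 < C ∧ ∀ ε v t, P.SliceBound R ε v t → ∀ i ≤ 4,
    MemLp (fun x => P.E.Φ i (jetSeq v x) x t) 2 volume ∧
      l2 (fun x => P.E.Φ i (jetSeq v x) x t) ≤ C := by
  have h3 : ∀ i, ∃ C, 0 < C ∧ (i ≤ 3 → ∀ ε v t, P.SliceBound R ε v t →
      MemLp (fun x => P.E.Φ i (jetSeq v x) x t) 2 volume ∧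
      l2 (fun x => P.E.Φ i (jetSeq v x) x t) ≤
        C * ∑ j ∈ Finset.range 7, l2 (iteratedDeriv j v)) := by
    intro i
    by_cases hi : i ≤ 3
    · obtain ⟨C, hC, h⟩ := l2_jetFun_le (P.E.jetFun_Φ i hi) (fun t ht => phi_zero (by omega) ht) R
      exact ⟨C, hC, fun _ => h⟩
    · exact ⟨1, one_pos, fun h => absurd h hi⟩
  choose C hC h3 using h3
  obtain ⟨Ca, hCa, ha⟩ := (unif_jetFun (P.jetFun_a.mono (by norm_num) le_rfl) R).l2_mul
  have hr0 : ∀ t ∈ I, ∀ x, P.E.r₄ 0 x t = 0 := fun t ht x => by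
    have := P.E.Φ_four 0 x t
    rw [phi_zero (by norm_num) ht] at this
    simpa using this.symm
  obtain ⟨Cr, hCr, hr⟩ := l2_jetFun_le P.E.jetFun_r₄ hr0 R
  have hsum : 0 ≤ ∑ i ∈ Finset.range 4, C i := Finset.sum_nonneg fun j _ => (hC j).le
  refine ⟨(∑ i ∈ Finset.range 4, C i + Ca + Cr) * (7 * |R| + 1), by positivity,
    fun ε v t hs i hi => ?_⟩
  have hR : R ≤ |R| := le_abs_self R
  rcases Nat.lt_or_ge i 4 with hi4 | hi4
  · have := h3 i (by omega) ε v t hs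
    refine ⟨this.1, this.2.trans ?_⟩
    have h1 : C i ≤ ∑ i ∈ Finset.range 4, C i :=
      Finset.single_le_sum (fun j _ => (hC j).le) (Finset.mem_range.2 hi4)
    refine mul_le_mul (by linarith) (by linarith [hs.sum_le])
      (Finset.sum_nonneg fun _ _ => l2_nonneg _) (by positivity)
  · obtain rfl : i = 4 := by omega
    have e : (fun x => P.E.Φ 4 (jetSeq v x) x t) = fun x =>
        P.a (jetSeq v x) x t * iteratedDeriv 7 v x + P.E.r₄ (jetSeq v x) x t := by
      ext x; exact P.E.Φ_four _ _ _
    obtain ⟨m1, l1⟩ := ha ε v t hs _ (hs.mem 7 (by norm_num))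
    obtain ⟨m2, l2'⟩ := hr ε v t hs
    rw [e]
    refine ⟨m1.add m2, (l2_add_le m1 m2).trans ?_⟩
    have q1 := mul_le_mul_of_nonneg_left (hs.le 7 le_rfl) hCa.le
    have q2 := mul_le_mul_of_nonneg_left hs.sum_le hCr.le
    have q3 : 0 ≤ (∑ i ∈ Finset.range 4, C i) * (7 * |R| + 1) :=
      mul_nonneg (Finset.sum_nonneg fun j _ => (hC j).le) (by positivity)
    have q4 : Ca * R ≤ Ca * (7 * |R| + 1) :=
      mul_le_mul_of_nonneg_left (by linarith [abs_nonneg R]) hCa.le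
    have q5 : Cr * (7 * R) ≤ Cr * (7 * |R| + 1) :=
      mul_le_mul_of_nonneg_left (by linarith) hCr.le
    linarith

/-- The sixth spatial derivative of `f`. -/
lemma l2_phi_six_le (R : ℝ) : ∃ C, 0 < C ∧ ∀ ε v t, P.SliceBound R ε v t →
    MemLp (fun x => P.E.Φ 6 (jetSeq v x) x t) 2 volume ∧
      l2 (fun x => P.E.Φ 6 (jetSeq v x) x t) ≤
        C * ∑ j ∈ Finset.range 10, l2 (iteratedDeriv j v) := by
  obtain ⟨C1, hC1, h1⟩ := (unif_jetFun (P.jetFun_a.mono (by norm_num) le_rfl) R).l2_mul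
  obtain ⟨C2, hC2, h2⟩ := (unif_jetFun P.E.jetFun_c₆ R).l2_mul
  obtain ⟨C3, hC3, h3⟩ := (unif_jetFun P.E.jetFun_d₆ R).l2_mul
  have hr0 : ∀ t ∈ I, ∀ x, P.E.r₆ 0 x t = 0 := fun t ht x => by
    have := P.E.Φ_six 0 x t
    rw [phi_zero (by norm_num) ht] at this
    simpa using this.symm
  obtain ⟨C4, hC4, h4⟩ := l2_jetFun_le P.E.jetFun_r₆ hr0 R
  refine ⟨C1 + C2 + C3 + C4, by positivity, fun ε v t hs => ?_⟩
  obtain ⟨m1, l1⟩ := h1 ε v t hs _ (hs.mem 9 (by norm_num))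
  obtain ⟨m2, l2'⟩ := h2 ε v t hs _ (hs.mem 8 (by norm_num))
  obtain ⟨m3, l3⟩ := h3 ε v t hs _ (hs.mem 7 (by norm_num))
  obtain ⟨m4, l4⟩ := h4 ε v t hs
  have e : (fun x => P.E.Φ 6 (jetSeq v x) x t) = fun x =>
      (P.a (jetSeq v x) x t * iteratedDeriv 9 v x + P.E.c₆ (jetSeq v x) x t * iteratedDeriv 8 v x
      + P.E.d₆ (jetSeq v x) x t * iteratedDeriv 7 v x) + P.E.r₆ (jetSeq v x) x t := by
    ext x; exact P.E.Φ_six _ _ _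
  rw [e]
  refine ⟨((m1.add m2).add m3).add m4, ?_⟩
  have b1 := l2_add_le ((m1.add m2).add m3) m4
  have b2 := l2_add_le (m1.add m2) m3
  have b3 := l2_add_le m1 m2
  simp only [Pi.add_apply, Pi.add_def] at b1 b2 b3
  have n := fun j => l2_nonneg (iteratedDeriv j v)
  have s0 : 0 ≤ ∑ j ∈ Finset.range 7, l2 (iteratedDeriv j v) := Finset.sum_nonneg fun j _ => n j
  rw [Finset.sum_range_succ, Finset.sum_range_succ, Finset.sum_range_succ]
  set S := ∑ j ∈ Finset.range 7, l2 (iteratedDeriv j v)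
  set A := S + l2 (iteratedDeriv 7 v) + l2 (iteratedDeriv 8 v) + l2 (iteratedDeriv 9 v) with hA
  have q1 : C1 * l2 (iteratedDeriv 9 v) ≤ C1 * A :=
    mul_le_mul_of_nonneg_left (by linarith [n 7, n 8]) hC1.le
  have q2 : C2 * l2 (iteratedDeriv 8 v) ≤ C2 * A :=
    mul_le_mul_of_nonneg_left (by linarith [n 7, n 9]) hC2.le
  have q3 : C3 * l2 (iteratedDeriv 7 v) ≤ C3 * A :=
    mul_le_mul_of_nonneg_left (by linarith [n 8, n 9]) hC3.le
  have q4 : C4 * S ≤ C4 * A :=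
    mul_le_mul_of_nonneg_left (by linarith [n 7, n 8, n 9]) hC4.le
  linarith

/-- The lower order terms of the seventh derivative of `f`. -/
noncomputable def rem₇ (v : ℝ → ℝ) (t x : ℝ) : ℝ :=
  P.E.p₇ (jetSeq v x) x t * iteratedDeriv 7 v x + P.E.h₇ (jetSeq v x) x t

lemma l2_rem₇_le (R : ℝ) : ∃ C, 0 < C ∧ ∀ ε v t, P.SliceBound R ε v t →
    MemLp (P.rem₇ v t) 2 volume ∧ l2 (P.rem₇ v t) ≤ C := by
  obtain ⟨C1, hC1, h1⟩ := (unif_jetFun P.E.jetFun_p₇ R).l2_mul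
  have hr0 : ∀ t ∈ I, ∀ x, P.E.h₇ 0 x t = 0 := fun t ht x => by
    have := P.E.Φ_seven 0 x t
    rw [phi_zero (by norm_num) ht] at this
    simpa using this.symm
  obtain ⟨C4, hC4, h4⟩ := l2_jetFun_le P.E.jetFun_h₇ hr0 R
  refine ⟨C1 * |R| + C4 * (7 * |R|) + 1, by positivity, fun ε v t hs => ?_⟩
  obtain ⟨m1, l1⟩ := h1 ε v t hs _ (hs.mem 7 (by norm_num))
  obtain ⟨m4, l4⟩ := h4 ε v t hs
  refine ⟨m1.add m4, (l2_add_le m1 m4).trans ?_⟩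
  have hR : R ≤ |R| := le_abs_self R
  have q1 := mul_le_mul_of_nonneg_left ((hs.le 7 le_rfl).trans hR) hC1.le
  have q2 := mul_le_mul_of_nonneg_left
    (hs.sum_le.trans (mul_le_mul_of_nonneg_left hR (by norm_num : (0 : ℝ) ≤ 7))) hC4.le
  linarith

lemma memLp_phi_seven {R ε t : ℝ} {v : ℝ → ℝ} (hs : P.SliceBound R ε v t) :
    MemLp (fun x => P.E.Φ 7 (jetSeq v x) x t) 2 volume := by
  obtain ⟨C1, -, h1⟩ := (unif_jetFun (P.jetFun_a.mono (by norm_num) le_rfl) R).l2_mul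
  obtain ⟨C2, -, h2⟩ := (Unif.subCoef (P := P) (N := 7) (R := R)).l2_mul
  obtain ⟨C3, -, h3⟩ := (unif_jetFun P.E.jetFun_c₇ R).l2_mul
  obtain ⟨C4, -, h4⟩ := P.l2_rem₇_le R
  have := (((h1 ε v t hs _ (hs.mem 10 (by norm_num))).1.add
    (h2 ε v t hs _ (hs.mem 9 (by norm_num))).1).add
    (h3 ε v t hs _ (hs.mem 8 (by norm_num))).1).add (h4 ε v t hs).1
  refine this.congr_norm ?_ (Eventually.of_forall fun x => ?_)
  · exact (continuous_iff_continuousAt.2 fun x => (P.E.Φ_succ 7 (by norm_num) v hs.smooth t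
      hs.time x).continuousAt).aestronglyMeasurable
  · rw [P.E.Φ_seven]
    simp only [Pi.add_apply, subCoef, rem₇, Nat.cast_ofNat]
    rfl

/-- The lower order terms of the eighth derivative of `f`. -/
noncomputable def rem₈ (v : ℝ → ℝ) (t x : ℝ) : ℝ :=
  P.E.p₈ (jetSeq v x) x t * iteratedDeriv 8 v x
    + P.E.q₈ (jetSeq v x) x t * (iteratedDeriv 7 v x * iteratedDeriv 7 v x)
    + P.E.s₈ (jetSeq v x) x t * iteratedDeriv 7 v x + P.E.h₈ (jetSeq v x) x t

/-- The critical term is the square of `∂⁷v`. One factor is taken in the supremum norm, at the price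
of an `H⁸` norm that is bounded only after multiplication by `ε`; the other is bounded in `L²`. -/
lemma l2_rem₈_le (R : ℝ) : ∃ C, 0 < C ∧ ∀ ε v t, P.SliceBound R ε v t →
    MemLp (P.rem₈ v t) 2 volume ∧ ε * l2 (P.rem₈ v t) ≤ C := by
  obtain ⟨C1, hC1, h1⟩ := (unif_jetFun P.E.jetFun_p₈ R).l2_mul
  obtain ⟨C2, hC2, h2⟩ := (unif_jetFun P.E.jetFun_q₈ R).l2_mul
  obtain ⟨C3, hC3, h3⟩ := (unif_jetFun P.E.jetFun_s₈ R).l2_mul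
  have hr0 : ∀ t ∈ I, ∀ x, P.E.h₈ 0 x t = 0 := fun t ht x => by
    have := P.E.Φ_eight 0 x t
    rw [phi_zero (by norm_num) ht] at this
    simpa using this.symm
  obtain ⟨C4, hC4, h4⟩ := l2_jetFun_le P.E.jetFun_h₈ hr0 R
  refine ⟨C1 * |R| + C2 * (2 * |R| * |R|) + C3 * |R| + C4 * (7 * |R|) + 1, by positivity,
    fun ε v t hs => ?_⟩
  have hR : R ≤ |R| := le_abs_self R
  have m7 := hs.mem 7 (by norm_num)
  have hsup : ∀ x, |iteratedDeriv 7 v x| ≤ l2 (iteratedDeriv 7 v) + l2 (iteratedDeriv 8 v) :=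
    abs_le_l2_add_l2 (hs.hasDerivAt (by norm_num)) m7 (hs.mem 8 (by norm_num))
  obtain ⟨m77, l77⟩ := memLp_mul_of_bddCont (continuous_iteratedDeriv' hs.smooth (by norm_num))
    hsup m7
  obtain ⟨m1, l1⟩ := h1 ε v t hs _ (hs.mem 8 (by norm_num))
  obtain ⟨m2, l2'⟩ := h2 ε v t hs _ m77
  obtain ⟨m3, l3⟩ := h3 ε v t hs _ m7
  obtain ⟨m4, l4⟩ := h4 ε v t hs
  refine ⟨((m1.add m2).add m3).add m4, ?_⟩
  have b1 := l2_add_le ((m1.add m2).add m3) m4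
  have b2 := l2_add_le (m1.add m2) m3
  have b3 := l2_add_le m1 m2
  simp only [Pi.add_apply, Pi.add_def] at b1 b2 b3
  have b0 : l2 (P.rem₈ v t) ≤ C1 * l2 (iteratedDeriv 8 v) +
      C2 * ((l2 (iteratedDeriv 7 v) + l2 (iteratedDeriv 8 v)) * l2 (iteratedDeriv 7 v))
      + C3 * l2 (iteratedDeriv 7 v) + C4 * ∑ j ∈ Finset.range 7, l2 (iteratedDeriv j v) := by
    have := mul_le_mul_of_nonneg_left l77 hC2.le
    unfold rem₈
    linarith
  have e8 := (hs.eps_le 8 le_rfl).trans hR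
  have e7 := (hs.eps_le 7 (by norm_num)).trans hR
  have q1 := mul_le_mul_of_nonneg_left e8 hC1.le
  have q2 : (ε * l2 (iteratedDeriv 7 v) + ε * l2 (iteratedDeriv 8 v)) * l2 (iteratedDeriv 7 v) ≤
      2 * |R| * |R| := mul_le_mul (by linarith) ((hs.le 7 le_rfl).trans hR) (l2_nonneg _)
        (by positivity)
  have q2' := mul_le_mul_of_nonneg_left q2 hC2.le
  have q3 := mul_le_mul_of_nonneg_left e7 hC3.le
  have q4 := mul_le_mul_of_nonneg_left
    (hs.eps_sum_le.trans (mul_le_mul_of_nonneg_left hR (by norm_num : (0 : ℝ) ≤ 7))) hC4.le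
  have := mul_le_mul_of_nonneg_left b0 hs.nonneg
  linarith

/-- The weighted energy inequality for the derivative of order `N = M + 1`. -/
lemma weighted_slice {M : ℕ} (hM : M ≤ 7) {c c' : (ℕ → ℝ) → ℝ → ℝ → ℝ}
    (hc : JetFun (P.D 0) 6 9 c) (hc' : JetFun (P.D 0) 6 9 c') (hcc : TotalDeriv I c c') (R : ℝ) :
    ∃ C, 0 < C ∧ ∀ ε v t r, P.SliceBound R ε v t → MemLp r 2 volume →
      MemLp (fun x => P.E.Φ M (jetSeq v x) x t) 2 volume →
      (∀ x, P.E.Φ (M + 1) (jetSeq v x) x t = P.a (jetSeq v x) x t * iteratedDeriv (M + 4) v x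
        + P.subCoef (M + 1) v t x * iteratedDeriv (M + 3) v x
        + c (jetSeq v x) x t * iteratedDeriv (M + 2) v x + r x) →
      ∫ x, (P.weight (M + 1) v t x * P.rate (M + 1) v t x * iteratedDeriv (M + 1) v x +
        P.weight (M + 1) v t x * iteratedDeriv (M + 2) v x) *
        (P.E.Φ M (jetSeq v x) x t + ε * iteratedDeriv (M + 4) v x) ≤
      C * (l2 (iteratedDeriv (M + 1) v) ^ 2 + l2 (iteratedDeriv (M + 1) v) * l2 r
        + ε * l2 (iteratedDeriv (M + 1) v) ^ 2) := by
  have ua : P.Unif R fun v t x => P.a (jetSeq v x) x t :=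
    unif_jetFun (P.jetFun_a.mono (by norm_num) le_rfl) R
  have uρ : P.Unif R (P.weight (M + 1)) := Unif.weight
  have ug : P.Unif R (P.rate (M + 1)) := Unif.rate
  have ug₁ : P.Unif R (P.rate₁ (M + 1)) := Unif.rate₁
  have uB : P.Unif R (P.subCoef (M + 1)) := Unif.subCoef
  have uB₁ : P.Unif R (P.subCoef₁ (M + 1)) := Unif.subCoef₁
  have uB₂ : P.Unif R (P.subCoef₂ (M + 1)) := Unif.subCoef₂
  have uc := unif_jetFun (P := P) hc R
  have uc' := unif_jetFun (P := P) hc' R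
  have uρ₁ := uρ.mul ug
  have uρ₂ := (uρ₁.mul ug).add (uρ.mul ug₁)
  have uα := uρ.mul ua
  have uβ := uρ.mul uB
  have uβ₁ := (uρ₁.mul uB).add (uρ.mul uB₁)
  have uβ₂ := ((uρ₂.mul uB).add (uρ₁.mul uB₁)).add ((uρ₁.mul uB₁).add (uρ.mul uB₂))
  have uκ := uρ.mul uc
  have uκ₁ := (uρ₁.mul uc).add (uρ.mul uc')
  obtain ⟨Cμ, hCμ, hμ⟩ := P.weight_bound (M + 1) R
  obtain ⟨C1, h1⟩ := uρ
  obtain ⟨C2, h2⟩ := uρ₂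
  obtain ⟨C3, h3⟩ := uβ₂
  obtain ⟨C4, h4⟩ := uκ₁
  set K := |C1| + |C2| + |C3| + |C4| with hK
  have k1 : C1 ≤ K := by
    linarith [le_abs_self C1, abs_nonneg C2, abs_nonneg C3, abs_nonneg C4]
  have k2 : C2 ≤ K := by
    linarith [le_abs_self C2, abs_nonneg C1, abs_nonneg C3, abs_nonneg C4]
  have k3 : C3 ≤ K := by
    linarith [le_abs_self C3, abs_nonneg C2, abs_nonneg C1, abs_nonneg C4]
  have k4 : C4 ≤ K := by
    linarith [le_abs_self C4, abs_nonneg C2, abs_nonneg C3, abs_nonneg C1]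
  have hK0 : 0 ≤ K := by positivity
  refine ⟨K + K ^ 2 / Cμ⁻¹ + 1, by positivity, fun ε v t r hs mr mφ hΦ => ?_⟩
  have dρ := hasDerivAt_weight (N := M + 1) hs
  have dg := hasDerivAt_rate (N := M + 1) hs
  have dρ₁ := fun x => (dρ x).fun_mul (dg x)
  have dB := hasDerivAt_subCoef (N := M + 1) hs
  have dB₁ := hasDerivAt_subCoef₁ (N := M + 1) hs
  have da := P.E.total_a v hs.smooth t hs.time
  have dc := hcc v hs.smooth t hs.time
  have key := weighted_energy_le (φ := fun x => P.E.Φ M (jetSeq v x) x t) (r := r) hs.nonneg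
    (inv_pos.2 hCμ) dρ dρ₁
    (Unif.weight.bddCont hs) (uρ₁.bddCont hs) (Unif.bddCont ⟨C2, h2⟩ hs)
    (α := fun x => P.weight (M + 1) v t x * P.a (jetSeq v x) x t)
    (β := fun x => P.weight (M + 1) v t x * P.subCoef (M + 1) v t x)
    (κ := fun x => P.weight (M + 1) v t x * c (jetSeq v x) x t)
    -- The differential equation that determines the weight: `(ρ a)' = (2/3) ρ (b + N a')` with `N =
    -- M + 1`.
    (fun x => ((dρ x).fun_mul (da x)).congr_deriv (by
      have h0 := hs.lowBound.ne_zero x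
      rw [rate]
      field_simp
      ring))
    (fun x => (dρ x).fun_mul (dB x))
    (fun x => ((dρ₁ x).fun_mul (dB x)).fun_add ((dρ x).fun_mul (dB₁ x)))
    (fun x => (dρ x).fun_mul (dc x))
    (uα.bddCont hs) (uβ.bddCont hs) (uβ₁.bddCont hs) (Unif.bddCont ⟨C3, h3⟩ hs) (uκ.bddCont hs)
    (Unif.bddCont ⟨C4, h4⟩ hs)
    (hs.hasDerivAt (j := M + 1) (by omega)) (hs.hasDerivAt (j := M + 2) (by omega))
    (hs.hasDerivAt (j := M + 3) (by omega)) (hs.mem _ (by omega)) (hs.mem _ (by omega))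
    (hs.mem _ (by omega)) (hs.mem _ (by omega)) mr mφ
    (fun x => ⟨_, P.E.Φ_succ M (by omega) v hs.smooth t hs.time x, by rw [hΦ x]; ring⟩)
    (fun x => (hμ v t hs.time hs.lowBound x).1)
    (fun x => ((h1 ε v t hs).2 x).trans k1) (fun x => ((h2 ε v t hs).2 x).trans k2)
    (fun x => ((h3 ε v t hs).2 x).trans k3) (fun x => ((h4 ε v t hs).2 x).trans k4)
  refine key.trans ?_
  set A := l2 (iteratedDeriv (M + 1) v) with hA
  have hA0 : 0 ≤ A := l2_nonneg _
  have hr0 := l2_nonneg r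
  have hε := hs.nonneg
  have n1 : 0 ≤ K ^ 2 / Cμ⁻¹ := by positivity
  have n2 : 0 ≤ A * l2 r := by positivity
  have n3 : 0 ≤ ε * A ^ 2 := by positivity
  nlinarith [mul_nonneg n1 n2, mul_nonneg n1 (sq_nonneg A), mul_nonneg hK0 n3, sq_nonneg A]

/-- In each quadratic term one factor is estimated by `R`, so the bound becomes linear in the norm,
as the square-root argument requires. In the viscous term that factor is `ε` times the norm, so no
smallness of `ε` is needed. -/
lemma weighted_slice_seven (R : ℝ) : ∃ C, 0 < C ∧ ∀ ε v t, P.SliceBound R ε v t →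
    ∫ x, (P.weight 7 v t x * P.rate 7 v t x * iteratedDeriv 7 v x +
        P.weight 7 v t x * iteratedDeriv 8 v x) *
        (P.E.Φ 6 (jetSeq v x) x t + ε * iteratedDeriv 10 v x) ≤ C * l2 (iteratedDeriv 7 v) := by
  obtain ⟨C, hC, h⟩ := P.weighted_slice (M := 6) (by norm_num) P.E.jetFun_c₇ P.E.jetFun_c₇'
    P.E.total_c₇ R
  obtain ⟨Cr, hCr, hr⟩ := P.l2_rem₇_le R
  obtain ⟨C6, -, h6⟩ := P.l2_phi_six_le R
  refine ⟨C * (2 * |R| + Cr), by positivity, fun ε v t hs => ?_⟩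
  refine (h ε v t _ hs (hr ε v t hs).1 (h6 ε v t hs).1 fun x => ?_).trans ?_
  · rw [P.E.Φ_seven]
    simp only [subCoef, rem₇, Nat.cast_ofNat, Nat.cast_add, Nat.cast_one]
    norm_num
    rfl
  · rw [mul_assoc]
    refine mul_le_mul_of_nonneg_left ?_ hC.le
    have a1 := hs.le 7 le_rfl
    have a2 := hs.eps_le 7 (by norm_num)
    have a3 := (hr ε v t hs).2
    have a0 := l2_nonneg (iteratedDeriv 7 v)
    have hR := le_abs_self R
    norm_num
    nlinarith [mul_le_mul_of_nonneg_left (a1.trans hR) a0,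
      mul_le_mul_of_nonneg_left (a2.trans hR) a0, mul_le_mul_of_nonneg_left a3 a0]

/-- The factor `ε²` puts one `ε` on each factor of the quadratic terms. The viscous term is left
with a third power of `ε`, and this is where `ε ≤ 1` enters. -/
lemma weighted_slice_eight (R : ℝ) : ∃ C, 0 < C ∧ ∀ ε v t, ε ≤ 1 → P.SliceBound R ε v t →
    ε ^ 2 * ∫ x, (P.weight 8 v t x * P.rate 8 v t x * iteratedDeriv 8 v x +
        P.weight 8 v t x * iteratedDeriv 9 v x) *
        (P.E.Φ 7 (jetSeq v x) x t + ε * iteratedDeriv 11 v x) ≤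
      C * (ε * l2 (iteratedDeriv 8 v)) := by
  obtain ⟨C, hC, h⟩ := P.weighted_slice (M := 7) (by norm_num) P.E.jetFun_c₈ P.E.jetFun_c₈'
    P.E.total_c₈ R
  obtain ⟨Cr, hCr, hr⟩ := P.l2_rem₈_le R
  refine ⟨C * (2 * |R| + Cr), by positivity, fun ε v t hε1 hs => ?_⟩
  have key := h ε v t _ hs (hr ε v t hs).1 (P.memLp_phi_seven hs) fun x => by
    rw [P.E.Φ_eight]
    simp only [subCoef, rem₈, Nat.cast_ofNat, Nat.cast_add, Nat.cast_one]
    norm_num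
    rw [sq]
    rfl
  refine (mul_le_mul_of_nonneg_left key (sq_nonneg ε)).trans ?_
  norm_num
  have a2 := hs.eps_le 8 (by norm_num)
  have a3 := (hr ε v t hs).2
  have hε := hs.nonneg
  set A := ε * l2 (iteratedDeriv 8 v) with hA
  have a0 : 0 ≤ A := mul_nonneg hε (l2_nonneg _)
  have hR := le_abs_self R
  have e1 : ε ^ 2 * (C * (l2 (iteratedDeriv 8 v) ^ 2 + l2 (iteratedDeriv 8 v) * l2 (P.rem₈ v t)
      + ε * l2 (iteratedDeriv 8 v) ^ 2)) = C * (A * A + A * (ε * l2 (P.rem₈ v t)) + ε * (A * A)) := by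
    rw [hA]; ring
  rw [e1, mul_assoc C (2 * |R| + Cr)]
  refine mul_le_mul_of_nonneg_left ?_ hC.le
  have b1 := mul_le_mul_of_nonneg_left (a2.trans hR) a0
  have b2 := mul_le_mul_of_nonneg_left a3 a0
  have b3 : ε * (A * A) ≤ A * A := mul_le_of_le_one_left (mul_nonneg a0 a0) hε1
  linarith

end Nonlinearity


/-! ### Dini derivatives of energies. -/

/-- The upper right Dini derivative of `F` at `s` is at most `D`. -/
def DiniLE (F : ℝ → ℝ) (s D : ℝ) : Prop :=
  ∀ r, D < r → ∀ᶠ z in 𝓝[>] s, slope F s z < r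

namespace DiniLE

variable {F G : ℝ → ℝ} {s D D' : ℝ}

lemma mono (h : DiniLE F s D) (hD : D ≤ D') : DiniLE F s D' := fun r hr => h r (hD.trans_lt hr)

lemma add (hF : DiniLE F s D) (hG : DiniLE G s D') :
    DiniLE (fun z => F z + G z) s (D + D') := by
  intro r hr
  filter_upwards [hF (D + (r - D - D') / 2) (by linarith),
    hG (D' + (r - D - D') / 2) (by linarith)] with z h1 h2
  have : slope (fun z => F z + G z) s z = slope F s z + slope G s z := by
    simp only [slope_def_field]; ring
  rw [this]
  linarith

lemma const_mul {c : ℝ} (hc : 0 ≤ c) (hF : DiniLE F s D) :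
    DiniLE (fun z => c * F z) s (c * D) := by
  intro r hr
  have e : ∀ z, slope (fun z => c * F z) s z = c * slope F s z := fun z => by
    simp only [slope_def_field]; ring
  rcases hc.eq_or_lt with rfl | hc
  · exact Eventually.of_forall fun z => by rw [e]; linarith
  · filter_upwards [hF (r / c) (by rw [lt_div_iff₀ hc]; linarith)] with z h
    rw [e]
    rw [lt_div_iff₀ hc] at h
    linarith

end DiniLE

/-- Growth of the square root of a function with upper Dini derivative bounded by its root. -/
lemma sqrt_le_of_diniLE {F : ℝ → ℝ} {T C : ℝ} (hC : 0 < C) (hF : ContinuousOn F (Set.Icc 0 T))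
    (h0 : ∀ s ∈ Set.Icc 0 T, 0 ≤ F s) (hd : ∀ s ∈ Set.Ico 0 T, DiniLE F s (C * √(F s))) :
    ∀ s ∈ Set.Icc 0 T, √(F s) ≤ √(F 0) + s * C := by
  intro s hs
  have h00 : 0 ≤ F 0 := h0 0 ⟨le_rfl, hs.1.trans hs.2⟩
  refine le_of_forall_pos_le_add fun η hη => ?_
  set A := √(F 0) + η with hA
  have hA0 : 0 < A := by positivity
  -- Comparison with `(A + x * C)²`: at a point of contact the Dini bound is `C * (A + x * C)`, half
  -- of the slope of the barrier. The inequality is strict since `η` makes `A` positive.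
  have key := image_le_of_liminf_slope_right_lt_deriv_boundary' (f := F)
    (f' := fun s => C * √(F s)) (B := fun x => (A + x * C) ^ 2)
    (B' := fun x => 2 * (A + x * C) * C) hF
    (fun x hx r hr => (hd x hx r hr).frequently)
    (by
      have := Real.sq_sqrt h00
      have h2 : 0 ≤ √(F 0) := Real.sqrt_nonneg _
      simp only [zero_mul, add_zero]
      nlinarith)
    (by fun_prop)
    (fun x _ => by
      have h1 : HasDerivAt (fun x : ℝ => A + x * C) C x := by
        simpa using ((hasDerivAt_id x).mul_const C).const_add A
      have h2 := (h1.fun_pow 2).hasDerivWithinAt (s := Set.Ici x)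
      simpa using h2)
    (fun x hx h => by
      have hp : 0 < A + x * C := by have := mul_nonneg hx.1 hC.le; linarith
      rw [h, Real.sqrt_sq hp.le]
      nlinarith) hs
  have hp : 0 ≤ A + s * C := by have := mul_nonneg hs.1 hC.le; linarith
  have := Real.sqrt_le_sqrt key
  rw [Real.sqrt_sq hp] at this
  linarith

/-- Continuity and the Dini derivative of a weighted energy. -/
lemma energy_dini {T s : ℝ} (hs : s ∈ Set.Icc 0 T) {ρ w : ℝ → ℝ → ℝ} {Λ : ℝ → ℝ} {Λ₀ C Cρ B : ℝ}
    (hρ : ∀ z ∈ Set.Icc 0 T, BddCont (ρ z)) (hw : ∀ z ∈ Set.Icc 0 T, MemLp (w z) 2 volume)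
    (hCρ : ∀ x, |ρ s x| ≤ Cρ)
    (hΛ : ∀ᶠ z in 𝓝[Set.Icc 0 T \ {s}] s, ∀ x, |ρ z x - ρ s x| ≤ Λ z * |z - s|)
    (hΛ₀ : Tendsto Λ (𝓝[Set.Icc 0 T \ {s}] s) (𝓝 Λ₀))
    (hC : ∀ᶠ z in 𝓝[Set.Icc 0 T \ {s}] s, l2 (fun x => w z x - w s x) ≤ C * |z - s|)
    (hB : Tendsto (fun z => (∫ x, ρ s x * (w s x * (w z x - w s x))) / (z - s))
      (𝓝[Set.Icc 0 T \ {s}] s) (𝓝 B)) :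
    ContinuousWithinAt (fun z => ∫ x, ρ z x * (w z x * w z x)) (Set.Icc 0 T) s ∧
    (s < T → DiniLE (fun z => ∫ x, ρ z x * (w z x * w z x)) s (2 * B + Λ₀ * l2 (w s) ^ 2)) := by
  set l := 𝓝[Set.Icc 0 T \ {s}] s with hl
  set E := fun z => ∫ x, ρ z x * (w z x * w z x) with hE
  have hz : Tendsto (fun z => |z - s|) l (𝓝 0) := by
    have : Tendsto (fun z : ℝ => |z - s|) (𝓝 s) (𝓝 0) := by
      have h : Continuous fun z : ℝ => |z - s| := by fun_prop
      simpa using h.tendsto s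
    exact this.mono_left nhdsWithin_le_nhds
  -- Beyond the linear part, the increment of the energy consists of the change of the weight, which
  -- contributes `Λ₀`, and a term quadratic in `z - s`.
  have hest : ∀ᶠ z in l, |E z - E s - 2 * ∫ x, ρ s x * (w s x * (w z x - w s x))| ≤
      (Λ z * (l2 (w s) + C * |z - s|) ^ 2 + Cρ * C ^ 2 * |z - s|) * |z - s| := by
    filter_upwards [hΛ, hC, self_mem_nhdsWithin] with z h1 h2 h3
    have mz := hw z h3.1
    have ms := hw s hs
    have md := mz.sub ms
    have i1 := (hρ z h3.1).integrable_mul mz mz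
    have i2 := (hρ s hs).integrable_mul ms ms
    have i3 := ((hρ s hs).integrable_mul ms md).const_mul 2
    have i4 := (hρ s hs).integrable_mul md md
    have i5 : Integrable (fun x => (ρ z x - ρ s x) * (w z x * w z x)) :=
      (i1.sub ((hρ s hs).integrable_mul mz mz)).congr
        (Eventually.of_forall fun x => by simp only [Pi.sub_apply]; ring)
    have e : E z - E s - 2 * ∫ x, ρ s x * (w s x * (w z x - w s x)) =
        (∫ x, (ρ z x - ρ s x) * (w z x * w z x)) +
          ∫ x, ρ s x * ((w z x - w s x) * (w z x - w s x)) := by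
      simp only [Pi.sub_apply] at i3 i4
      have i12 : Integrable (fun x => ρ z x * (w z x * w z x) - ρ s x * (w s x * w s x)) :=
        i1.sub i2
      rw [hE, ← integral_const_mul]
      rw [← integral_sub i1 i2, ← integral_sub i12 i3, ← integral_add i5 i4]
      congr 1; ext x
      ring
    rw [e]
    refine (abs_add_le _ _).trans ?_
    have b1 := abs_integral_mul_mul_le h1 mz mz
    have b2 := abs_integral_mul_mul_le hCρ md md
    simp only [Pi.sub_apply] at b2
    have b3 : l2 (w z) ≤ l2 (w s) + C * |z - s| := by
      have := l2_add_le ms md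
      simp only [Pi.sub_apply, add_sub_cancel] at this
      have h2' : l2 (w z - w s) ≤ C * |z - s| := h2
      linarith
    have b4 : l2 (w z) * l2 (w z) ≤ (l2 (w s) + C * |z - s|) ^ 2 := by
      rw [← sq]; exact pow_le_pow_left₀ (l2_nonneg _) b3 2
    have b5 : l2 (fun x => w z x - w s x) * l2 (fun x => w z x - w s x) ≤ (C * |z - s|) ^ 2 := by
      rw [← sq]; exact pow_le_pow_left₀ (l2_nonneg _) h2 2
    have n1 : 0 ≤ Λ z * |z - s| := (abs_nonneg _).trans (h1 0)
    have n2 : 0 ≤ Cρ := (abs_nonneg _).trans (hCρ 0)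
    have c1 := mul_le_mul_of_nonneg_left b4 n1
    have c2 := mul_le_mul_of_nonneg_left b5 n2
    have b2' : |∫ x, ρ s x * ((w z x - w s x) * (w z x - w s x))| ≤
      Cρ * (l2 (fun x => w z x - w s x) * l2 (fun x => w z x - w s x)) := b2
    calc _ ≤ Λ z * |z - s| * (l2 (w s) + C * |z - s|) ^ 2 + Cρ * (C * |z - s|) ^ 2 :=
          add_le_add (b1.trans c1) (b2'.trans c2)
      _ = _ := by ring
  have hGt : Tendsto (fun z => Λ z * (l2 (w s) + C * |z - s|) ^ 2 + Cρ * C ^ 2 * |z - s|) l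
      (𝓝 (Λ₀ * l2 (w s) ^ 2)) := by
    have := (hΛ₀.mul (((hz.const_mul C).const_add (l2 (w s))).pow 2)).add
      (hz.const_mul (Cρ * C ^ 2))
    simpa using this
  have hsub : Tendsto (fun z => z - s) l (𝓝 0) := by
    have : Tendsto (fun z : ℝ => z - s) (𝓝 s) (𝓝 0) := by
      have h : Continuous fun z : ℝ => z - s := by fun_prop
      simpa using h.tendsto s
    exact this.mono_left nhdsWithin_le_nhds
  have hne : ∀ᶠ z in l, z - s ≠ 0 := by
    filter_upwards [self_mem_nhdsWithin] with z h3
    exact sub_ne_zero.2 h3.2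
  constructor
  · rw [← continuousWithinAt_sdiff_self, ContinuousWithinAt]
    have t1 : Tendsto (fun z => 2 * ∫ x, ρ s x * (w s x * (w z x - w s x))) l (𝓝 0) := by
      have := (hB.mul hsub).const_mul 2
      simp only [mul_zero] at this
      refine this.congr' ?_
      filter_upwards [hne] with z h
      rw [div_mul_cancel₀ _ h]
    have t2 : Tendsto (fun z => E z - E s - 2 * ∫ x, ρ s x * (w s x * (w z x - w s x))) l (𝓝 0) := by
      refine squeeze_zero_norm' hest ?_
      simpa using hGt.mul hz
    have t3 := (t2.add t1).add_const (E s)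
    simpa using t3
  · intro hsT r hr
    have hle : 𝓝[>] s ≤ l := by
      rw [hl]
      refine nhdsWithin_le_iff.2 ?_
      filter_upwards [Ioo_mem_nhdsGT hsT] with z hzz
      exact ⟨⟨hs.1.trans hzz.1.le, hzz.2.le⟩, hzz.1.ne'⟩
    have hlim := (hB.const_mul 2).add hGt
    have hev : ∀ᶠ z in l, _ < r := hlim.eventually_lt_const hr
    filter_upwards [hle hev, hle hest, self_mem_nhdsWithin] with z h1 h2 h3
    have hp : 0 < z - s := sub_pos.2 h3
    rw [abs_of_pos hp] at h1 h2
    refine lt_of_le_of_lt ?_ h1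
    rw [slope_def_field, div_le_iff₀ hp, add_mul, mul_assoc 2, div_mul_cancel₀ _ hp.ne']
    linarith [(abs_le.1 h2).2]


/-! ### Differentiation in time along a solution. -/

lemma contDiff_of_hasDerivAt_seq {F : ℕ → ℝ → ℝ} {n : ℕ}
    (h : ∀ i < n, ∀ x, HasDerivAt (F i) (F (i + 1) x) x) (hc : Continuous (F n)) :
    ContDiff ℝ n (F 0) ∧ ∀ j ≤ n, iteratedDeriv j (F 0) = F j := by
  have e : ∀ j ≤ n, iteratedDeriv j (F 0) = F j := by
    intro j hj
    induction j with
    | zero => exact iteratedDeriv_zero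
    | succ j ih =>
      rw [iteratedDeriv_succ, ih (by omega)]
      exact funext fun x => (h j hj x).deriv
  refine ⟨contDiff_nat_iff_iteratedDeriv.2 ⟨fun m hm => ?_, fun m hm => ?_⟩, e⟩
  · rw [e m hm]
    rcases hm.eq_or_lt with rfl | hm
    · exact hc
    · exact continuous_iff_continuousAt.2 fun x => (h m hm x).continuousAt
  · rw [e m hm.le]
    exact fun x => (h m hm x).differentiableAt

/-- Passage to the limit in the linear part of the variation of an energy. -/
lemma tendsto_integral_mul_quotient {l : Filter ℝ} {s : ℝ} {h q : ℝ → ℝ} {g : ℝ → ℝ → ℝ}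
    (hh : MemLp h 2 volume) (hq : MemLp q 2 volume) (hg : ∀ᶠ z in l, MemLp (g z) 2 volume)
    (hs : MemLp (g s) 2 volume)
    (hl : Tendsto (fun z => l2 (fun x => (g z x - g s x) / (z - s) - q x)) l (𝓝 0)) :
    Tendsto (fun z => (∫ x, h x * (g z x - g s x)) / (z - s)) l (𝓝 (∫ x, h x * q x)) := by
  rw [tendsto_iff_norm_sub_tendsto_zero]
  refine squeeze_zero' (Eventually.of_forall fun _ => norm_nonneg _) ?_
    (by simpa using hl.const_mul (l2 h))
  filter_upwards [hg] with z hz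
  have m1 : MemLp (fun x => (g z x - g s x) / (z - s)) 2 volume := by
    have := (hz.sub hs).const_mul (z - s)⁻¹
    refine this.congr_norm (this.1.congr (Eventually.of_forall fun x => ?_))
      (Eventually.of_forall fun x => ?_)
    · simp only [Pi.sub_apply]; ring
    · simp only [Pi.sub_apply]; congr 1; ring
  have e : (∫ x, h x * (g z x - g s x)) / (z - s) - ∫ x, h x * q x =
      ∫ x, h x * ((g z x - g s x) / (z - s) - q x) := by
    rw [div_eq_inv_mul, ← integral_const_mul]
    rw [← integral_sub _ (integrable_mul hh hq)]
    · congr 1; ext x; ring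
    · exact ((integrable_mul hh m1)).congr (Eventually.of_forall fun x => by
        simp only; ring)
  rw [e, Real.norm_eq_abs]
  exact abs_integral_mul_le hh (m1.sub hq)

lemma abs_exp_sub_exp_le {x y C : ℝ} (hx : x ≤ C) (hy : y ≤ C) :
    |Real.exp x - Real.exp y| ≤ Real.exp C * |x - y| := by
  have key : ∀ x y : ℝ, x ≤ C → Real.exp x - Real.exp y ≤ Real.exp C * |x - y| := by
    intro x y hx
    have h1 : Real.exp y = Real.exp x * Real.exp (y - x) := by rw [← Real.exp_add]; ring_nf
    have h2 := Real.add_one_le_exp (y - x)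
    have h3 := Real.exp_le_exp.2 hx
    have h4 : Real.exp x - Real.exp y ≤ Real.exp x * (x - y) := by
      rw [h1]; nlinarith [Real.exp_pos x]
    nlinarith [Real.exp_pos x, le_abs_self (x - y), abs_nonneg (x - y)]
  rw [abs_le]
  have a := key x y hx
  have b := key y x hy
  rw [abs_sub_comm] at b
  constructor <;> linarith

namespace Nonlinearity

variable {I : Set ℝ} {f : (Fin 4 → ℝ) → ℝ → ℝ → ℝ} (P : Nonlinearity I f)

/-- A solution on `[0, T]` with uniform bounds on its time slices. -/
structure Flow (R ε T : ℝ) (u u' : ℝ → ℝ → ℝ) : Prop where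
  slice : ∀ s ∈ Set.Icc 0 T, P.SliceBound R ε (u s) s
  memH : ∀ s ∈ Set.Icc 0 T, MemH 8 (u s)
  memH' : ∀ s ∈ Set.Icc 0 T, MemH 8 (u' s)
  tendsto : ∀ s ∈ Set.Icc 0 T, Tendsto
    (fun z => sobolevENorm 8 (fun x => (u z x - u s x) / (z - s) - u' s x))
    (𝓝[Set.Icc 0 T \ {s}] s) (𝓝 0)
  eq : ∀ s ∈ Set.Icc 0 T, ∀ x, u' s x =
    -P.E.Φ 0 (jetSeq (u s) x) x s - ε * iteratedDeriv 4 (u s) x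

variable {P}

namespace Flow

variable {R ε T s : ℝ} {u u' : ℝ → ℝ → ℝ}

/-- The equation expresses `u'` through the jet of `u` up to order four. With eleven classical
derivatives of `u` this leaves seven for `u'`, which accounts for the bound `7` in what follows. -/
lemma contDiff_deriv (h : P.Flow R ε T u u') (hs : s ∈ Set.Icc 0 T) :
    ContDiff ℝ 7 (u' s) ∧ ∀ j ≤ 7, iteratedDeriv j (u' s) = fun x =>
      -P.E.Φ j (jetSeq (u s) x) x s - ε * iteratedDeriv (j + 4) (u s) x := by
  have hb := h.slice s hs
  have e : u' s = fun x => -P.E.Φ 0 (jetSeq (u s) x) x s - ε * iteratedDeriv (0 + 4) (u s) x :=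
    funext (h.eq s hs)
  rw [e]
  refine contDiff_of_hasDerivAt_seq (n := 7) (F := fun j x =>
    -P.E.Φ j (jetSeq (u s) x) x s - ε * iteratedDeriv (j + 4) (u s) x) (fun i hi x => ?_) ?_
  · have := (P.E.Φ_succ i (by omega) (u s) hb.smooth s hb.time x).fun_neg.fun_sub
      ((hb.hasDerivAt (j := i + 4) (by omega) x).const_mul ε)
    rwa [show i + 1 + 4 = i + 4 + 1 by ring]
  · have h1 : Continuous fun x => P.E.Φ 7 (jetSeq (u s) x) x s := continuous_iff_continuousAt.2
      fun x => (P.E.Φ_succ 7 (by norm_num) (u s) hb.smooth s hb.time x).continuousAt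
    have h2 := continuous_iteratedDeriv' hb.smooth (j := 7 + 4) (by norm_num)
    fun_prop

lemma memLp_deriv (h : P.Flow R ε T u u') (hs : s ∈ Set.Icc 0 T) {j : ℕ} (hj : j ≤ 7) :
    MemLp (iteratedDeriv j (u' s)) 2 volume :=
  memLp_iteratedDeriv (h.memH' s hs) ((h.contDiff_deriv hs).1.of_le (by exact_mod_cast hj))
    (by norm_cast; omega)

lemma iteratedDeriv_quotient (h : P.Flow R ε T u u') (hs : s ∈ Set.Icc 0 T) {z : ℝ}
    (hz : z ∈ Set.Icc 0 T) :
    ContDiff ℝ 7 (fun x => (u z x - u s x) / (z - s) - u' s x) ∧ ∀ j ≤ 7,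
      iteratedDeriv j (fun x => (u z x - u s x) / (z - s) - u' s x) = fun x =>
      (iteratedDeriv j (u z) x - iteratedDeriv j (u s) x) / (z - s) - iteratedDeriv j (u' s) x := by
  have hc' := (h.contDiff_deriv hs).1
  refine contDiff_of_hasDerivAt_seq (n := 7) (F := fun j x =>
    (iteratedDeriv j (u z) x - iteratedDeriv j (u s) x) / (z - s) - iteratedDeriv j (u' s) x)
    (fun i hi x => ?_) ?_ |> fun hh => by
      simp only [iteratedDeriv_zero] at hh
      exact hh
  · exact ((((h.slice z hz).hasDerivAt (j := i) (by omega) x).fun_sub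
      ((h.slice s hs).hasDerivAt (j := i) (by omega) x)).div_const _).fun_sub
      (hasDerivAt_iteratedDeriv (m := 7) (by exact_mod_cast hc') hi x)
  · have h1 := continuous_iteratedDeriv' (h.slice z hz).smooth (j := 7) (by norm_num)
    have h2 := continuous_iteratedDeriv' (h.slice s hs).smooth (j := 7) (by norm_num)
    have h3 := hc'.continuous_iteratedDeriv 7 le_rfl
    fun_prop

/-- The spatial derivatives of the difference quotients converge in `L²`. -/
lemma tendsto_l2_quotient (h : P.Flow R ε T u u') (hs : s ∈ Set.Icc 0 T) {j : ℕ} (hj : j ≤ 7) :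
    Tendsto (fun z => l2 (fun x => (iteratedDeriv j (u z) x - iteratedDeriv j (u s) x) / (z - s)
      - iteratedDeriv j (u' s) x)) (𝓝[Set.Icc 0 T \ {s}] s) (𝓝 0) := by
  have h1 := (ENNReal.tendsto_toReal ENNReal.zero_ne_top).comp (h.tendsto s hs)
  have h2 := h1.const_mul ((2 * Real.pi) ^ j)
  simp only [ENNReal.toReal_zero, mul_zero] at h2
  refine squeeze_zero' (Eventually.of_forall fun _ => l2_nonneg _) ?_ h2
  filter_upwards [self_mem_nhdsWithin, (h.tendsto s hs).eventually_lt_const ENNReal.zero_lt_top]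
    with z hz hm
  obtain ⟨hc, he⟩ := h.iteratedDeriv_quotient hs hz.1
  rw [← he j hj]
  exact l2_iteratedDeriv_le (hc.of_le (by exact_mod_cast hj)) (by norm_cast; omega) hm

/-- Solutions are Lipschitz continuous in time with values in `H^8`. -/
lemma exists_lipschitz (h : P.Flow R ε T u u') (hs : s ∈ Set.Icc 0 T) :
    ∃ C, ∀ j ≤ 8, ∀ᶠ z in 𝓝[Set.Icc 0 T \ {s}] s,
      l2 (fun x => iteratedDeriv j (u z) x - iteratedDeriv j (u s) x) ≤ C * |z - s| := by
  set S := (sobolevENorm 8 (u' s)).toReal with hS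
  refine ⟨(2 * Real.pi) ^ 8 * (1 + S), fun j hj => ?_⟩
  filter_upwards [self_mem_nhdsWithin, (h.tendsto s hs).eventually_lt_const one_pos] with z hz hm
  have hne : z - s ≠ 0 := sub_ne_zero.2 hz.2
  have hcz := (h.slice z hz.1).smooth
  have hcs := (h.slice s hs).smooth
  have hjc : ((j : ℕ) : WithTop ℕ∞) ≤ 11 := by exact_mod_cast (by omega : j ≤ 11)
  have e1 : iteratedDeriv j (fun x => u z x - u s x) = fun x =>
      iteratedDeriv j (u z) x - iteratedDeriv j (u s) x := funext fun x =>
    iteratedDeriv_sub (hcz.of_le hjc).contDiffAt (hcs.of_le hjc).contDiffAt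
  set d := fun x => (u z x - u s x) / (z - s) - u' s x with hd
  -- The function `d` has only seven guaranteed classical derivatives, while the plain difference
  -- has eleven. Estimating the latter in the `H⁸` norm reaches order eight.
  have e2 : (fun x => u z x - u s x) = fun x => (z - s) * (d x + u' s x) := by
    ext x; rw [hd]; field_simp; ring
  have hm8 : MemH 8 d := hm.trans ENNReal.one_lt_top
  have hle : sobolevENorm 8 (fun x => d x + u' s x) ≤ ENNReal.ofReal (1 + S) := by
    refine (sobolevENorm_add_le 8 d (u' s)).trans ?_
    rw [ENNReal.ofReal_add zero_le_one ENNReal.toReal_nonneg, ENNReal.ofReal_one,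
      ENNReal.ofReal_toReal (h.memH' s hs).ne]
    gcongr
  have hmd : MemH 8 (fun x => d x + u' s x) := hle.trans_lt ENNReal.ofReal_lt_top
  have hle2 : sobolevENorm 8 (fun x => u z x - u s x) ≤ ENNReal.ofReal (|z - s| * (1 + S)) := by
    rw [e2]
    refine (sobolevENorm_const_mul_le 8 (z - s) _ hmd.memLp_ofReal).trans ?_
    rw [ENNReal.ofReal_mul (abs_nonneg _)]
    gcongr
  have hmem : MemH 8 (fun x => u z x - u s x) := hle2.trans_lt ENNReal.ofReal_lt_top
  have hfin := l2_iteratedDeriv_le (n := j) (s := 8) (v := fun x => u z x - u s x)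
    ((hcz.sub hcs).of_le hjc) (by norm_cast) hmem
  rw [e1] at hfin
  refine hfin.trans ?_
  have hS0 : 0 ≤ S := ENNReal.toReal_nonneg
  have h3 := ENNReal.toReal_mono ENNReal.ofReal_ne_top hle2
  rw [ENNReal.toReal_ofReal (by positivity)] at h3
  have hpi : (1 : ℝ) ≤ 2 * Real.pi := by linarith [Real.pi_gt_three]
  calc _ ≤ (2 * Real.pi) ^ 8 * (|z - s| * (1 + S)) :=
        mul_le_mul (pow_le_pow_right₀ hpi hj) h3 ENNReal.toReal_nonneg (by positivity)
    _ = _ := by ring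

end Flow

variable (P)

/-- The low derivatives of the time derivative are bounded. -/
lemma l2_deriv_le (R : ℝ) : ∃ C, 0 < C ∧ ∀ ε T u u', P.Flow R ε T u u' → ∀ s ∈ Set.Icc 0 T,
    ∀ j ≤ 4, l2 (iteratedDeriv j (u' s)) ≤ C := by
  obtain ⟨C, hC, hΦ⟩ := P.l2_phi_le R
  refine ⟨C + |R|, by positivity, fun ε T u u' h s hs j hj => ?_⟩
  have hb := h.slice s hs
  obtain ⟨m, l⟩ := hΦ ε (u s) s hb j hj
  rw [(h.contDiff_deriv hs).2 j (by omega)]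
  have e : (fun x => -P.E.Φ j (jetSeq (u s) x) x s - ε * iteratedDeriv (j + 4) (u s) x) =
      fun x => (-1) * P.E.Φ j (jetSeq (u s) x) x s + (-ε) * iteratedDeriv (j + 4) (u s) x := by
    ext x; ring
  rw [e]
  refine (l2_add_le (m.const_mul _) ((hb.mem (j + 4) (by omega)).const_mul _)).trans ?_
  rw [l2_const_mul, l2_const_mul, abs_neg, abs_neg, abs_one, abs_of_nonneg hb.nonneg]
  -- The viscous term has order at most eight, so it is controlled by the part `ε ‖u‖_{H⁸}` of
  -- `M_ε`.
  linarith [hb.eps_le (j + 4) (by omega), le_abs_self R]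

/-- The weight is Lipschitz continuous in time along a solution. -/
lemma weight_lipschitz (N : ℕ) (R : ℝ) : ∃ C, 0 < C ∧ ∀ ε T u u', P.Flow R ε T u u' →
    ∀ s ∈ Set.Icc 0 T, ∃ Λ : ℝ → ℝ, Tendsto Λ (𝓝[Set.Icc 0 T \ {s}] s) (𝓝 C) ∧
      ∀ᶠ z in 𝓝[Set.Icc 0 T \ {s}] s, ∀ x,
        |P.weight N (u z) z x - P.weight N (u s) s x| ≤ Λ z * |z - s| := by
  obtain ⟨C', hC', hu'⟩ := P.l2_deriv_le R
  obtain ⟨CL, η, hCL, hη, hL⟩ := P.logWeight_lipschitz (2 * N / 3 - 1) R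
  obtain ⟨Cb, hCb, hb⟩ := P.logWeight_bound (2 * N / 3 - 1) R
  refine ⟨Real.exp Cb * (CL * (C' + 1)), by positivity, fun ε T u u' h s hs => ?_⟩
  set l := 𝓝[Set.Icc 0 T \ {s}] s with hl
  set m := fun j z => l2 (fun x => (iteratedDeriv j (u z) x - iteratedDeriv j (u s) x) / (z - s)
      - iteratedDeriv j (u' s) x) with hm
  set S := fun z => ∑ j ∈ Finset.range 5, m j z with hS
  have hSt : Tendsto S l (𝓝 0) := by
    have := tendsto_finsetSum (Finset.range 5) fun j hj =>
      h.tendsto_l2_quotient hs (j := j) (by have := Finset.mem_range.1 hj; omega)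
    simpa using this
  have hz : Tendsto (fun z => |z - s|) l (𝓝 0) := by
    have : Tendsto (fun z : ℝ => |z - s|) (𝓝 s) (𝓝 0) := by
      have h : Continuous fun z : ℝ => |z - s| := by fun_prop
      simpa using h.tendsto s
    exact this.mono_left nhdsWithin_le_nhds
  -- `S z` measures how far the difference quotients are from `u'`. It tends to zero at a rate that
  -- depends on the solution, but the limit of `Λ` depends only on `N` and `R`.
  refine ⟨fun z => Real.exp Cb * (CL * ((S z + C') + 1)), ?_, ?_⟩
  · have := (((hSt.add_const C').add_const 1).const_mul CL).const_mul (Real.exp Cb)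
    simpa using this
  · have hsmall : Tendsto (fun z => (S z + C') * |z - s|) l (𝓝 0) := by
      simpa using (hSt.add_const C').mul hz
    filter_upwards [self_mem_nhdsWithin, hsmall.eventually_lt_const hη] with z hzT hzη x
    have hlz := (h.slice z hzT.1).lowBound
    have hls := (h.slice s hs).lowBound
    have hd : ∀ j ≤ 4, l2 (iteratedDeriv j (fun x => u z x - u s x)) ≤ (S z + C') * |z - s| := by
      intro j hj
      have hjc : ((j : ℕ) : WithTop ℕ∞) ≤ 11 := by exact_mod_cast (by omega : j ≤ 11)
      have e1 : iteratedDeriv j (fun x => u z x - u s x) = fun x =>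
          (z - s) * (((iteratedDeriv j (u z) x - iteratedDeriv j (u s) x) / (z - s)
      - iteratedDeriv j (u' s) x) + iteratedDeriv j (u' s) x) := funext fun x => by
        have hne : z - s ≠ 0 := sub_ne_zero.2 hzT.2
        rw [sub_add_cancel, mul_div_cancel₀ _ hne]
        exact iteratedDeriv_sub (hlz.smooth.of_le hjc).contDiffAt (hls.smooth.of_le hjc).contDiffAt
      rw [e1, l2_const_mul, mul_comm]
      refine mul_le_mul_of_nonneg_right ?_ (abs_nonneg _)
      have hmd : MemLp (fun x => (iteratedDeriv j (u z) x - iteratedDeriv j (u s) x) / (z - s)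
          - iteratedDeriv j (u' s) x) 2 volume := by
        have := (((hlz.mem j hj).sub (hls.mem j hj)).const_mul (z - s)⁻¹).sub
          (h.memLp_deriv hs (j := j) (by omega))
        convert this using 2 with x
        simp only [Pi.sub_apply]
        ring
      refine (l2_add_le hmd (h.memLp_deriv hs (by omega))).trans (add_le_add ?_ (hu' ε T u u' h s hs j hj))
      exact Finset.single_le_sum (f := fun j => m j z) (fun j _ => l2_nonneg _)
        (Finset.mem_range.2 (by omega))
    have key := hL (u z) (u s) z (h.slice z hzT.1).time s (h.slice s hs).time _ hlz hls hzη.le hd x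
    refine (abs_exp_sub_exp_le (abs_le.1 (hb _ z (h.slice z hzT.1).time hlz x)).2
      (abs_le.1 (hb _ s (h.slice s hs).time hls x)).2).trans ?_
    have := mul_le_mul_of_nonneg_left key (Real.exp_pos Cb).le
    refine this.trans_eq ?_
    ring

end Nonlinearity


/-! ### Growth of energies along a solution. -/

lemma bddCont_const (c : ℝ) : BddCont fun _ => c := ⟨continuous_const, |c|, fun _ => le_rfl⟩

/-- Growth of an energy made of a weighted part of high order and of the `L²` norm. -/
lemma energy_growth {T θ c C₁ C₂ : ℝ} (hθ : 0 ≤ θ) (hc : 1 ≤ c) (hC₁ : 0 < C₁) (hC₂ : 0 < C₂)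
    {A DA DB : ℝ → ℝ} {v w : ℝ → ℝ → ℝ}
    (hA : ContinuousOn A (Set.Icc 0 T)) (hB : ContinuousOn (fun s => l2 (v s) ^ 2) (Set.Icc 0 T))
    (hDA : ∀ s ∈ Set.Ico 0 T, DiniLE A s (DA s))
    (hDB : ∀ s ∈ Set.Ico 0 T, DiniLE (fun s => l2 (v s) ^ 2) s (DB s))
    (hA1 : ∀ s ∈ Set.Icc 0 T, l2 (w s) ^ 2 ≤ c * A s)
    (hA2 : ∀ s ∈ Set.Icc 0 T, A s ≤ c * l2 (w s) ^ 2)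
    (h1 : ∀ s ∈ Set.Ico 0 T, θ ^ 2 * DA s ≤ C₁ * (θ * (l2 (v s) + l2 (w s))))
    (h2 : ∀ s ∈ Set.Ico 0 T, θ ^ 2 * DB s ≤ C₂ * (θ * (l2 (v s) + l2 (w s)))) :
    ∀ s ∈ Set.Icc 0 T, θ * (l2 (v s) + l2 (w s)) ≤
      4 * c ^ 2 * (θ * (l2 (v 0) + l2 (w 0)) + s * (C₁ + C₂)) := by
  -- The unweighted `L²` part is added because the top derivative alone does not control a Sobolev
  -- norm. One factor `2 * c` comes from the rate of growth of the root of `E`, another from the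
  -- return to norms.
  set E := fun s => θ ^ 2 * (A s + l2 (v s) ^ 2) with hE
  have hc0 : 0 < c := by linarith
  have hA0 : ∀ s ∈ Set.Icc 0 T, 0 ≤ A s := fun s hs => by
    by_contra hneg
    have := hA1 s hs
    nlinarith [sq_nonneg (l2 (w s))]
  have hlow : ∀ s ∈ Set.Icc 0 T, θ * (l2 (v s) + l2 (w s)) ≤ 2 * c * √(E s) := by
    intro s hs
    have e1 : θ * l2 (w s) ≤ c * √(E s) := by
      rw [← Real.sqrt_sq hc0.le, ← Real.sqrt_mul (sq_nonneg c)]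
      apply Real.le_sqrt_of_sq_le
      have i1 := hA1 s hs
      have i2 := hA0 s hs
      have i3 : l2 (w s) ^ 2 ≤ c ^ 2 * (A s + l2 (v s) ^ 2) := by
        have : c * A s ≤ c ^ 2 * A s := by nlinarith [mul_nonneg hc0.le i2]
        nlinarith [mul_nonneg (sq_nonneg c) (sq_nonneg (l2 (v s)))]
      have := mul_le_mul_of_nonneg_left i3 (sq_nonneg θ)
      rw [hE]
      nlinarith
    have e2 : θ * l2 (v s) ≤ √(E s) := by
      apply Real.le_sqrt_of_sq_le
      have := mul_nonneg (sq_nonneg θ) (hA0 s hs)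
      rw [hE]
      nlinarith
    have e3 : √(E s) ≤ c * √(E s) := le_mul_of_one_le_left (Real.sqrt_nonneg _) hc
    linarith
  have hcont : ContinuousOn E (Set.Icc 0 T) := (hA.add hB).const_mul _ |> fun h => h
  have hgrow := sqrt_le_of_diniLE (F := E) (T := T) (C := 2 * c * (C₁ + C₂)) (by positivity) hcont
    (fun s hs => mul_nonneg (sq_nonneg θ) (add_nonneg (hA0 s hs) (sq_nonneg _)))
    (fun s hs => by
      refine (((hDA s hs).add (hDB s hs)).const_mul (sq_nonneg θ)).mono ?_
      have l := hlow s (Set.Ico_subset_Icc_self hs)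
      have l' := mul_le_mul_of_nonneg_left l (add_pos hC₁ hC₂).le
      have a := h1 s hs
      have b := h2 s hs
      linarith)
  intro s hs
  have h00 : (0 : ℝ) ∈ Set.Icc 0 T := ⟨le_rfl, hs.1.trans hs.2⟩
  have hup : √(E 0) ≤ c * (θ * (l2 (v 0) + l2 (w 0))) := by
    refine Real.sqrt_le_iff.2 ⟨by
      have := l2_nonneg (v 0); have := l2_nonneg (w 0); positivity, ?_⟩
    have i1 := hA2 0 h00
    have i2 := l2_nonneg (v 0)
    have i3 := l2_nonneg (w 0)
    have i4 : A 0 + l2 (v 0) ^ 2 ≤ c ^ 2 * (l2 (v 0) + l2 (w 0)) ^ 2 := by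
      have a1 : c * l2 (w 0) ^ 2 ≤ c ^ 2 * l2 (w 0) ^ 2 :=
        mul_le_mul_of_nonneg_right (by nlinarith) (sq_nonneg _)
      have a2 : l2 (v 0) ^ 2 ≤ c ^ 2 * l2 (v 0) ^ 2 :=
        le_mul_of_one_le_left (sq_nonneg _) (by nlinarith)
      have a3 : 0 ≤ c ^ 2 * (2 * (l2 (v 0) * l2 (w 0))) := by positivity
      nlinarith
    have := mul_le_mul_of_nonneg_left i4 (sq_nonneg θ)
    rw [hE]
    nlinarith
  have g := hgrow s hs
  have l := hlow s hs
  have g2 := mul_le_mul_of_nonneg_left (g.trans (add_le_add_left hup _)) (by positivity : 0 ≤ 2 * c)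
  have i2 := l2_nonneg (v 0)
  have i3 := l2_nonneg (w 0)
  have n : 0 ≤ c ^ 2 * (θ * (l2 (v 0) + l2 (w 0))) := by positivity
  nlinarith

namespace Nonlinearity

variable {I : Set ℝ} {f : (Fin 4 → ℝ) → ℝ → ℝ → ℝ} {P : Nonlinearity I f}

namespace Flow

variable {R ε T s : ℝ} {u u' : ℝ → ℝ → ℝ}

/-- The Dini derivative of a weighted energy along a solution. -/
lemma energy_dini (h : P.Flow R ε T u u') (hs : s ∈ Set.Icc 0 T) {M : ℕ} (hM : M ≤ 7)
    {ρ : ℝ → ℝ → ℝ} {ρ₁ Λ : ℝ → ℝ} {Λ₀ : ℝ}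
    (hρ : ∀ z ∈ Set.Icc 0 T, BddCont (ρ z)) (hd : ∀ x, HasDerivAt (ρ s) (ρ₁ x) x)
    (hρ₁ : BddCont ρ₁)
    (hΛ₀ : Tendsto Λ (𝓝[Set.Icc 0 T \ {s}] s) (𝓝 Λ₀))
    (hΛ : ∀ᶠ z in 𝓝[Set.Icc 0 T \ {s}] s, ∀ x, |ρ z x - ρ s x| ≤ Λ z * |z - s|) :
    ContinuousWithinAt (fun z => ∫ x, ρ z x *
      (iteratedDeriv (M + 1) (u z) x * iteratedDeriv (M + 1) (u z) x)) (Set.Icc 0 T) s ∧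
    (s < T → DiniLE (fun z => ∫ x, ρ z x *
      (iteratedDeriv (M + 1) (u z) x * iteratedDeriv (M + 1) (u z) x)) s
      (2 * (∫ x, (ρ₁ x * iteratedDeriv (M + 1) (u s) x + ρ s x * iteratedDeriv (M + 2) (u s) x) *
        (P.E.Φ M (jetSeq (u s) x) x s + ε * iteratedDeriv (M + 4) (u s) x))
        + Λ₀ * l2 (iteratedDeriv (M + 1) (u s)) ^ 2)) := by
  obtain ⟨C, hC⟩ := h.exists_lipschitz hs
  obtain ⟨Cρ, hCρ⟩ := (hρ s hs).2
  obtain ⟨Cρ₁, hCρ₁⟩ := hρ₁.2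
  have hb := h.slice s hs
  set w := iteratedDeriv (M + 1) (u s) with hw
  set w₁ := iteratedDeriv (M + 2) (u s) with hw₁
  have m : MemLp w 2 volume := hb.mem _ (by omega)
  have m₁ : MemLp w₁ 2 volume := hb.mem _ (by omega)
  have dw : ∀ x, HasDerivAt w (w₁ x) x := hb.hasDerivAt (j := M + 1) (by omega)
  have mh : MemLp (fun x => -(ρ₁ x * w x + ρ s x * w₁ x)) 2 volume :=
    ((memLp_of_bdd_mul hρ₁.1 hCρ₁ m).add (memLp_of_bdd_mul (hρ s hs).1 hCρ m₁)).neg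
  -- For `M = 7` the derivative of order `M + 1` of `u'` is not available. One derivative is
  -- therefore moved onto `ρ w`, and only the quotients of order `M` pass to the limit.
  have hB := tendsto_integral_mul_quotient (g := fun z => iteratedDeriv M (u z)) mh
    (h.memLp_deriv hs hM) (l := 𝓝[Set.Icc 0 T \ {s}] s)
    (by
      filter_upwards [self_mem_nhdsWithin] with z hz
      exact (h.slice z hz.1).mem M (by omega))
    (hb.mem M (by omega)) (h.tendsto_l2_quotient hs hM)
  have hB' : Tendsto (fun z => (∫ x, ρ s x * (w x * (iteratedDeriv (M + 1) (u z) x - w x)))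
      / (z - s)) (𝓝[Set.Icc 0 T \ {s}] s)
      (𝓝 (∫ x, -(ρ₁ x * w x + ρ s x * w₁ x) * iteratedDeriv M (u' s) x)) := by
    refine hB.congr' ?_
    filter_upwards [self_mem_nhdsWithin] with z hz
    have hbz := h.slice z hz.1
    congr 1
    have mg := (hbz.mem M (by omega)).sub (hb.mem M (by omega))
    have mw := (hbz.mem (M + 1) (by omega)).sub m
    have i1 := (hρ s hs).integrable_mul m mw
    have i2 := integrable_mul mh mg
    have h0 := integral_eq_zero_of_deriv
      (F := fun x => ρ s x * (w x * (iteratedDeriv M (u z) x - iteratedDeriv M (u s) x)))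
      (F' := fun x => ρ s x * (w x * (iteratedDeriv (M + 1) (u z) x - w x)) -
        -(ρ₁ x * w x + ρ s x * w₁ x) * (iteratedDeriv M (u z) x - iteratedDeriv M (u s) x))
      (fun x => ((hd x).fun_mul ((dw x).fun_mul ((hbz.hasDerivAt (j := M) (by omega) x).fun_sub
        (hb.hasDerivAt (j := M) (by omega) x)))).congr_deriv (by ring))
      ((hρ s hs).integrable_mul m mg) (i1.sub i2)
    have h1 := integral_sub i1 i2
    simp only [Pi.sub_apply] at h1
    linarith
  have key := KdVType.energy_dini hs hρ (w := fun z => iteratedDeriv (M + 1) (u z))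
    (fun z hz => (h.slice z hz).mem _ (by omega)) hCρ hΛ hΛ₀ (hC (M + 1) (by omega)) hB'
  refine ⟨key.1, fun hsT => (key.2 hsT).mono (le_of_eq ?_)⟩
  refine congrArg (fun r => 2 * r + Λ₀ * l2 w ^ 2)
    (integral_congr_ae (Eventually.of_forall fun x => ?_))
  simp only
  rw [(h.contDiff_deriv hs).2 M hM]
  ring

end Flow

variable (P)

/-- The `L²` norm along a solution. -/
lemma l2_sq_dini (R : ℝ) : ∃ C, 0 < C ∧ ∀ ε T u u', P.Flow R ε T u u' →
    ∃ D : ℝ → ℝ, ContinuousOn (fun s => l2 (u s) ^ 2) (Set.Icc 0 T) ∧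
      (∀ s ∈ Set.Ico 0 T, DiniLE (fun s => l2 (u s) ^ 2) s (D s)) ∧
      ∀ s ∈ Set.Ico 0 T, D s ≤ C * l2 (u s) ∧ ε ^ 2 * D s ≤ C * (ε * l2 (u s)) := by
  obtain ⟨C, hC, hΦ⟩ := l2_jetFun_le (P.E.jetFun_Φ 0 (by norm_num))
    (fun t ht => phi_zero (by norm_num) ht) R
  refine ⟨2 * (C * (7 * |R|)) + 1, by positivity, fun ε T u u' h => ?_⟩
  set F := fun z => ∫ x, 1 * (u z x * u z x) with hF
  have eF : ∀ z ∈ Set.Icc 0 T, F z = l2 (u z) ^ 2 := fun z hz => by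
    have := (h.slice z hz).mem 0 (by norm_num)
    rw [iteratedDeriv_zero] at this
    change ∫ x, 1 * (u z x * u z x) = _
    rw [← l2_sq this]
    congr 1; ext x; ring
  have key : ∀ s ∈ Set.Icc 0 T, ContinuousWithinAt F (Set.Icc 0 T) s ∧
      (s < T → DiniLE F s (2 * (∫ x, u s x * u' s x) + 0 * l2 (u s) ^ 2)) := by
    intro s hs
    obtain ⟨C', hC'⟩ := h.exists_lipschitz hs
    have m : ∀ z ∈ Set.Icc 0 T, MemLp (u z) 2 volume := fun z hz => by
      simpa using (h.slice z hz).mem 0 (by norm_num)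
    have hB := tendsto_integral_mul_quotient (g := u) (q := u' s) (m s hs)
      (by simpa using h.memLp_deriv hs (j := 0) (by norm_num)) (l := 𝓝[Set.Icc 0 T \ {s}] s)
      (by
        filter_upwards [self_mem_nhdsWithin] with z hz
        exact m z hz.1)
      (m s hs) (by simpa using h.tendsto_l2_quotient hs (j := 0) (by norm_num))
    exact KdVType.energy_dini hs (ρ := fun _ _ => 1) (w := u) (Λ := fun _ => 0)
      (fun _ _ => bddCont_const 1) m (Cρ := 1) (fun _ => by simp) (Eventually.of_forall (by simp))
      tendsto_const_nhds (by simpa using hC' 0 (by norm_num)) (by simpa only [one_mul] using hB)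
  refine ⟨fun s => 2 * (l2 (u s) * l2 (fun x => P.E.Φ 0 (jetSeq (u s) x) x s)), ?_,
    fun s hs => ?_, fun s hs => ?_⟩
  · exact ContinuousOn.congr (fun s hs => (key s hs).1) fun s hs => (eF s hs).symm
  · have hsI := Set.Ico_subset_Icc_self hs
    have hb := h.slice s hsI
    have k := (key s hsI).2 hs.2
    have k' : DiniLE (fun s => l2 (u s) ^ 2) s (2 * (∫ x, u s x * u' s x) + 0 * l2 (u s) ^ 2) := by
      intro r hr
      filter_upwards [k r hr, Ioo_mem_nhdsGT hs.2] with z hz hz'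
      rw [slope_def_field] at hz ⊢
      rwa [eF z ⟨hs.1.trans hz'.1.le, hz'.2.le⟩, eF s hsI] at hz
    refine k'.mono ?_
    have m0 : MemLp (u s) 2 volume := by simpa using hb.mem 0 (by norm_num)
    obtain ⟨mΦ, -⟩ := hΦ ε (u s) s hb
    have m4 := hb.mem 4 (by norm_num)
    have m2 := hb.mem 2 (by norm_num)
    have d := fun j (hj : j ≤ 10) => hb.hasDerivAt hj
    have i04 := integrable_mul m0 m4
    have i22 := integrable_mul m2 m2
    have i0Φ := integrable_mul m0 mΦ
    have d0 : ∀ x, HasDerivAt (u s) (iteratedDeriv 1 (u s) x) x := by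
      have := d 0 (by norm_num)
      rwa [iteratedDeriv_zero] at this
    -- The viscosity has the good sign and is dropped.
    have hpos : ∫ x, u s x * iteratedDeriv 4 (u s) x =
        ∫ x, iteratedDeriv 2 (u s) x * iteratedDeriv 2 (u s) x := by
      have h0 := integral_eq_zero_of_deriv
        (F := fun x => u s x * iteratedDeriv 3 (u s) x -
          iteratedDeriv 1 (u s) x * iteratedDeriv 2 (u s) x)
        (F' := fun x => u s x * iteratedDeriv 4 (u s) x -
          iteratedDeriv 2 (u s) x * iteratedDeriv 2 (u s) x)
        (fun x => (((d0 x).fun_mul (d 3 (by norm_num) x)).fun_sub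
          ((d 1 (by norm_num) x).fun_mul (d 2 (by norm_num) x))).congr_deriv (by ring))
        ((integrable_mul m0 (hb.mem 3 (by norm_num))).sub
          (integrable_mul (hb.mem 1 (by norm_num)) m2)) (i04.sub i22)
      have h1 := integral_sub i04 i22
      linarith
    have hnn : 0 ≤ ∫ x, iteratedDeriv 2 (u s) x * iteratedDeriv 2 (u s) x :=
      integral_nonneg fun x => mul_self_nonneg _
    have e : ∫ x, u s x * u' s x = -(∫ x, u s x * P.E.Φ 0 (jetSeq (u s) x) x s)
        - ε * ∫ x, u s x * iteratedDeriv 4 (u s) x := by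
      have i0n : Integrable (fun x => -(u s x * P.E.Φ 0 (jetSeq (u s) x) x s)) := i0Φ.neg
      rw [← integral_neg, ← integral_const_mul, ← integral_sub i0n (i04.const_mul ε)]
      congr 1; ext x
      rw [h.eq s hsI]
      ring
    have b := (abs_le.1 (abs_integral_mul_le m0 mΦ)).1
    have c := mul_nonneg hb.nonneg hnn
    rw [e, hpos]
    linarith
  · have hb := h.slice s (Set.Ico_subset_Icc_self hs)
    obtain ⟨-, lΦ⟩ := hΦ ε (u s) s hb
    have hR := le_abs_self R
    have n0 := l2_nonneg (u s)
    have hε := hb.nonneg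
    set S := ∑ j ∈ Finset.range 7, l2 (iteratedDeriv j (u s)) with hS
    have b1 : l2 (fun x => P.E.Φ 0 (jetSeq (u s) x) x s) ≤ C * (7 * |R|) :=
      lΦ.trans (mul_le_mul_of_nonneg_left (by linarith [hb.sum_le]) hC.le)
    have b2 : ε * l2 (fun x => P.E.Φ 0 (jetSeq (u s) x) x s) ≤ C * (7 * |R|) := by
      have := mul_le_mul_of_nonneg_left lΦ hε
      have h2 : C * (ε * S) ≤ C * (7 * |R|) :=
        mul_le_mul_of_nonneg_left (by linarith [hb.eps_sum_le]) hC.le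
      linarith
    have c1 := mul_le_mul_of_nonneg_left b1 n0
    have c2 := mul_le_mul_of_nonneg_left b2 (mul_nonneg hε n0)
    constructor
    · linarith
    · have := mul_nonneg hε n0
      nlinarith

end Nonlinearity


/-! ### Growth at orders seven and eight. -/

namespace Nonlinearity

variable {I : Set ℝ} {f : (Fin 4 → ℝ) → ℝ → ℝ → ℝ} (P : Nonlinearity I f)

lemma l2_sq_le_weighted {ρ w : ℝ → ℝ} {c : ℝ} (hc : 0 < c) (hρ : BddCont ρ)
    (hw : MemLp w 2 volume) (h : ∀ x, c⁻¹ ≤ ρ x ∧ ρ x ≤ c) :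
    l2 w ^ 2 ≤ c * (∫ x, ρ x * (w x * w x)) ∧ ∫ x, ρ x * (w x * w x) ≤ c * l2 w ^ 2 := by
  have i := hρ.integrable_mul hw hw
  rw [← l2_sq hw, ← integral_const_mul, ← integral_const_mul]
  constructor
  · refine integral_mono hw.integrable_sq (i.const_mul c) fun x => ?_
    have h1 : 1 ≤ c * ρ x := by
      have := mul_le_mul_of_nonneg_left (h x).1 hc.le
      rwa [mul_inv_cancel₀ hc.ne'] at this
    nlinarith [mul_le_mul_of_nonneg_right h1 (sq_nonneg (w x))]
  · refine integral_mono i (hw.integrable_sq.const_mul c) fun x => ?_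
    nlinarith [mul_le_mul_of_nonneg_right (h x).2 (sq_nonneg (w x))]

/-- Growth of the weighted energies, from a bound at fixed times. -/
lemma weighted_growth {M : ℕ} (hM : M ≤ 7) (K : ℝ) : ∃ c, 1 ≤ c ∧ ∀ R C, 0 < C → ∃ C', 0 < C' ∧
    ∀ ε T u u' θ, P.Flow R ε T u u' → 0 ≤ θ → (θ = 1 ∨ θ = ε) →
      (∀ s ∈ Set.Icc 0 T, P.LowBound K (u s) s) →
      (∀ s ∈ Set.Icc 0 T, θ * l2 (iteratedDeriv (M + 1) (u s)) ≤ R) →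
      (∀ s ∈ Set.Icc 0 T, θ ^ 2 * ∫ x, (P.weight (M + 1) (u s) s x * P.rate (M + 1) (u s) s x *
        iteratedDeriv (M + 1) (u s) x + P.weight (M + 1) (u s) s x * iteratedDeriv (M + 2) (u s) x) *
        (P.E.Φ M (jetSeq (u s) x) x s + ε * iteratedDeriv (M + 4) (u s) x) ≤
        C * (θ * l2 (iteratedDeriv (M + 1) (u s)))) →
      ∀ s ∈ Set.Icc 0 T, θ * (l2 (u s) + l2 (iteratedDeriv (M + 1) (u s))) ≤
        4 * c ^ 2 * (θ * (l2 (u 0) + l2 (iteratedDeriv (M + 1) (u 0))) + s * C') := by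
  -- The comparison constant is fixed by the low bound `K`, before `R` is introduced. This order of
  -- quantifiers is what finally lets `C₂` depend on `k` alone.
  obtain ⟨c, hc, hcw⟩ := P.weight_bound (M + 1) K
  have hcm : c ≤ max c 1 := le_max_left _ _
  refine ⟨max c 1, le_max_right _ _, fun R C hC => ?_⟩
  obtain ⟨CΛ, hCΛ, hΛ⟩ := P.weight_lipschitz (M + 1) R
  obtain ⟨C0, hC0, h0⟩ := P.l2_sq_dini R
  refine ⟨(2 * C + CΛ * |R|) + C0, by positivity, fun ε T u u' θ h hθ hθε hlow hθR hint => ?_⟩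
  obtain ⟨D, hDc, hD, hD'⟩ := h0 ε T u u' h
  have bρ : ∀ z ∈ Set.Icc 0 T, BddCont (P.weight (M + 1) (u z) z) := fun z hz =>
    Unif.weight.bddCont (h.slice z hz)
  choose Λ hΛt hΛe using hΛ ε T u u' h
  have key : ∀ s ∈ Set.Icc 0 T, _ := fun s hs =>
    h.energy_dini hs hM (ρ := fun z => P.weight (M + 1) (u z) z) bρ
      (hasDerivAt_weight (h.slice s hs))
      ((Unif.weight.mul Unif.rate).bddCont (h.slice s hs)) (hΛt s hs) (hΛe s hs)
  have hwc : ∀ s ∈ Set.Icc 0 T, ∀ x, (max c 1)⁻¹ ≤ P.weight (M + 1) (u s) s x ∧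
      P.weight (M + 1) (u s) s x ≤ max c 1 := fun s hs x => by
    have := hcw (u s) s (h.slice s hs).time (hlow s hs) x
    exact ⟨(inv_anti₀ hc hcm).trans this.1, this.2.trans hcm⟩
  have hmem : ∀ s ∈ Set.Icc 0 T, MemLp (iteratedDeriv (M + 1) (u s)) 2 volume := fun s hs =>
    (h.slice s hs).mem _ (by omega)
  have hm0 : 0 < max c 1 := by positivity
  refine energy_growth hθ (le_max_right _ _) (by positivity) hC0
    (fun s hs => (key s hs).1) hDc (fun s hs => (key s (Set.Ico_subset_Icc_self hs)).2 hs.2) hD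
    (fun s hs => (l2_sq_le_weighted hm0 (bρ s hs) (hmem s hs) (hwc s hs)).1)
    (fun s hs => (l2_sq_le_weighted hm0 (bρ s hs) (hmem s hs) (hwc s hs)).2)
    (fun s hs => ?_) (fun s hs => ?_)
  · have hs' := Set.Ico_subset_Icc_self hs
    have a1 := hint s hs'
    have a2 := (hθR s hs').trans (le_abs_self R)
    have n1 := l2_nonneg (u s)
    set W := l2 (iteratedDeriv (M + 1) (u s)) with hW
    have n2 : 0 ≤ W := l2_nonneg _
    have a3 : CΛ * ((θ * W) * (θ * W)) ≤ CΛ * (|R| * (θ * W)) :=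
      mul_le_mul_of_nonneg_left (mul_le_mul_of_nonneg_right a2 (mul_nonneg hθ n2)) hCΛ.le
    have a4 : 0 ≤ (2 * C + CΛ * |R|) * (θ * l2 (u s)) := by positivity
    nlinarith
  · have hs' := Set.Ico_subset_Icc_self hs
    have n2 := l2_nonneg (iteratedDeriv (M + 1) (u s))
    have n3 : 0 ≤ C0 * (θ * l2 (iteratedDeriv (M + 1) (u s))) := by positivity
    obtain ⟨b1, b2⟩ := hD' s hs
    rcases hθε with rfl | rfl
    · linarith
    · linarith

lemma growth_seven (K : ℝ) : ∃ c, 1 ≤ c ∧ ∀ R, ∃ C, 0 < C ∧ ∀ ε T u u', P.Flow R ε T u u' →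
    (∀ s ∈ Set.Icc 0 T, P.LowBound K (u s) s) → ∀ s ∈ Set.Icc 0 T,
      l2 (u s) + l2 (iteratedDeriv 7 (u s)) ≤
        4 * c ^ 2 * (l2 (u 0) + l2 (iteratedDeriv 7 (u 0)) + s * C) := by
  obtain ⟨c, hc, h⟩ := P.weighted_growth (M := 6) (by norm_num) K
  refine ⟨c, hc, fun R => ?_⟩
  obtain ⟨C, hC, h7⟩ := P.weighted_slice_seven R
  obtain ⟨C', hC', h'⟩ := h R C hC
  refine ⟨C', hC', fun ε T u u' hF hlow s hs => ?_⟩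
  have := h' ε T u u' 1 hF zero_le_one (Or.inl rfl) hlow
    (fun s hs => by rw [one_mul]; exact (hF.slice s hs).le 7 le_rfl)
    (fun s hs => by
      rw [one_pow, one_mul, one_mul]
      exact h7 ε (u s) s (hF.slice s hs)) s hs
  simpa only [one_mul] using this

lemma growth_eight_of_le_one (K : ℝ) : ∃ c, 1 ≤ c ∧ ∀ R, ∃ C, 0 < C ∧ ∀ ε T u u', ε ≤ 1 →
    P.Flow R ε T u u' → (∀ s ∈ Set.Icc 0 T, P.LowBound K (u s) s) → ∀ s ∈ Set.Icc 0 T,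
      ε * (l2 (u s) + l2 (iteratedDeriv 8 (u s))) ≤
        4 * c ^ 2 * (ε * (l2 (u 0) + l2 (iteratedDeriv 8 (u 0))) + s * C) := by
  obtain ⟨c, hc, h⟩ := P.weighted_growth (M := 7) (by norm_num) K
  refine ⟨c, hc, fun R => ?_⟩
  obtain ⟨C, hC, h8⟩ := P.weighted_slice_eight R
  obtain ⟨C', hC', h'⟩ := h R C hC
  refine ⟨C', hC', fun ε T u u' hε hF hlow s hs => ?_⟩
  exact h' ε T u u' ε hF (hF.slice s hs).nonneg (Or.inr rfl) hlow
    (fun s hs => (hF.slice s hs).eps_le 8 le_rfl)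
    (fun s hs => h8 ε (u s) s hε (hF.slice s hs)) s hs

/-- All derivatives of order at most eight are controlled by the extreme ones. -/
lemma sum_l2_le {v : ℝ → ℝ} (hv : ContDiff ℝ 11 v) (hm : MemH 8 v) :
    ∑ j ∈ Finset.range 9, l2 (iteratedDeriv j v) ≤
      9 * ((2 * Real.pi) ^ 8 * 2 ^ 8) * (l2 v + l2 (iteratedDeriv 8 v)) := by
  have h1 := toReal_sobolevENorm_le (n := 8) (s := 8) hm (hv.of_le (by norm_num)) (by norm_num)
  have hpi : (1 : ℝ) ≤ 2 * Real.pi := by linarith [Real.pi_gt_three]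
  calc _ ≤ ∑ _j ∈ Finset.range 9,
        (2 * Real.pi) ^ 8 * (2 ^ 8 * (l2 v + l2 (iteratedDeriv 8 v))) := by
        refine Finset.sum_le_sum fun j hj => ?_
        have hj' : j ≤ 8 := by have := Finset.mem_range.1 hj; omega
        have h2 := l2_iteratedDeriv_le (n := j) (s := 8)
          (hv.of_le (by exact_mod_cast (by omega : j ≤ 11))) (by exact_mod_cast hj') hm
        refine h2.trans (mul_le_mul (pow_le_pow_right₀ hpi hj') (by simpa using h1)
          ENNReal.toReal_nonneg (by positivity))
    _ = _ := by simp; ring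

/-- Absorption of the terms of high order by the viscosity. -/
lemma absorb_viscosity {C ε S w z y : ℝ} (hC : 0 < C) (hε : 1 ≤ ε) (hzy : z ^ 2 ≤ w * y) :
    2 * (y * (C * (S + z)) - ε * y ^ 2) ≤ C ^ 2 * S ^ 2 + 2 * C ^ 4 * w ^ 2 := by
  have hε0 : 0 < ε := by linarith
  -- Young's inequality for the three products
  have y1 : 2 * (C * S) * y ≤ ε * y ^ 2 + C ^ 2 * S ^ 2 := by
    have : 2 * (C * S) * y ≤ y ^ 2 + C ^ 2 * S ^ 2 := by nlinarith [sq_nonneg (y - C * S)]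
    nlinarith [mul_le_mul_of_nonneg_right hε (sq_nonneg y)]
  have y2 : 2 * C * z * y ≤ 1 / 2 * ε * y ^ 2 + 2 * C ^ 2 * z ^ 2 / ε := by
    have : 0 ≤ (ε * y - 2 * C * z) ^ 2 / (2 * ε) := by positivity
    have e3 : (ε * y - 2 * C * z) ^ 2 / (2 * ε) =
      1 / 2 * ε * y ^ 2 + 2 * C ^ 2 * z ^ 2 / ε - 2 * C * z * y := by
      field_simp; ring
    linarith
  have y3 : 2 * C ^ 2 * z ^ 2 / ε ≤ 1 / 2 * ε * y ^ 2 + 2 * C ^ 4 * w ^ 2 := by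
    rw [div_le_iff₀ hε0]
    have i1 : 2 * C ^ 2 * z ^ 2 ≤ 2 * C ^ 2 * (w * y) :=
      mul_le_mul_of_nonneg_left hzy (by positivity)
    have i2 : 2 * C ^ 2 * (w * y) ≤ 1 / 2 * y ^ 2 + 2 * C ^ 4 * w ^ 2 := by
      nlinarith [sq_nonneg (y - 2 * C ^ 2 * w)]
    have i3 : 1 / 2 * y ^ 2 ≤ 1 / 2 * ε * y ^ 2 * ε := by
      have : 1 ≤ ε * ε := by nlinarith
      nlinarith [mul_le_mul_of_nonneg_right this (sq_nonneg y)]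
    have i4 : 2 * C ^ 4 * w ^ 2 ≤ 2 * C ^ 4 * w ^ 2 * ε :=
      le_mul_of_one_le_right (by positivity) hε
    linarith
  linarith

/-- In each square one factor is estimated by the given bound `r` and the other is kept. This makes
the right-hand side linear in `ε * (A + w)`. -/
lemma small_data_bound {C ε S S₀ w A r : ℝ} (hε : 0 ≤ ε) (hr : 0 ≤ r) (hS : 0 ≤ S) (hA : 0 ≤ A)
    (hw : 0 ≤ w) (h1 : ε * S ≤ 9 * r) (h2 : ε * w ≤ r) (h3 : S ≤ S₀ * (A + w)) :
    ε ^ 2 * (C ^ 2 * S ^ 2 + 2 * C ^ 4 * w ^ 2) ≤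
      (C ^ 2 * (9 * r) * S₀ + 2 * C ^ 4 * r + 1) * (ε * (A + w)) := by
  have f1 : (ε * S) * (ε * S) ≤ (9 * r) * (ε * (S₀ * (A + w))) :=
    mul_le_mul h1 (mul_le_mul_of_nonneg_left h3 hε) (mul_nonneg hε hS) (by linarith)
  have f2 : (ε * w) * (ε * w) ≤ r * (ε * (A + w)) :=
    mul_le_mul h2 (mul_le_mul_of_nonneg_left (by linarith) hε) (mul_nonneg hε hw) hr
  have g1 := mul_le_mul_of_nonneg_left f1 (sq_nonneg C)
  have g2 := mul_le_mul_of_nonneg_left f2 (by positivity : 0 ≤ 2 * C ^ 4)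
  have g3 : 0 ≤ ε * (A + w) := by positivity
  linarith

/-- For large viscosity the energy inequality needs no weight. -/
lemma slice_eight_of_one_le (R : ℝ) : ∃ C, 0 < C ∧ ∀ ε v t, 1 ≤ ε → P.SliceBound R ε v t →
    MemH 8 v → ε ^ 2 * (2 * ∫ x, iteratedDeriv 9 v x *
      (P.E.Φ 7 (jetSeq v x) x t + ε * iteratedDeriv 11 v x)) ≤
      C * (ε * (l2 v + l2 (iteratedDeriv 8 v))) := by
  obtain ⟨C, hC, hΦ⟩ := P.l2_phi_six_le R
  set S₀ : ℝ := 9 * ((2 * Real.pi) ^ 8 * 2 ^ 8) with hS₀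
  have hS₀p : 0 < S₀ := by positivity
  refine ⟨C ^ 2 * (9 * |R|) * S₀ + 2 * C ^ 4 * |R| + 1, by positivity, fun ε v t hε hs hm => ?_⟩
  obtain ⟨mΦ, lΦ⟩ := hΦ ε v t hs
  have m9 := hs.mem 9 (by norm_num)
  have m10 := hs.mem 10 (by norm_num)
  have m11 := hs.mem 11 (by norm_num)
  have mΦ7 := P.memLp_phi_seven hs
  have d := fun j (hj : j ≤ 10) => hs.hasDerivAt hj
  -- After this step only orders up to nine of `f` and order ten of `v` occur. Order nine is
  -- interpolated between eight and ten, and order ten is absorbed by the viscosity.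
  have ibp1 : ∫ x, iteratedDeriv 9 v x * P.E.Φ 7 (jetSeq v x) x t =
      -∫ x, iteratedDeriv 10 v x * P.E.Φ 6 (jetSeq v x) x t := by
    have h0 := integral_eq_zero_of_deriv
      (F := fun x => iteratedDeriv 9 v x * P.E.Φ 6 (jetSeq v x) x t)
      (F' := fun x => iteratedDeriv 10 v x * P.E.Φ 6 (jetSeq v x) x t +
        iteratedDeriv 9 v x * P.E.Φ 7 (jetSeq v x) x t)
      (fun x => (d 9 (by norm_num) x).fun_mul (P.E.Φ_succ 6 (by norm_num) v hs.smooth t hs.time x))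
      (integrable_mul m9 mΦ) ((integrable_mul m10 mΦ).add (integrable_mul m9 mΦ7))
    have h1 := integral_add (integrable_mul m10 mΦ) (integrable_mul m9 mΦ7)
    linarith
  have ibp2 : ∫ x, iteratedDeriv 9 v x * iteratedDeriv 11 v x = -l2 (iteratedDeriv 10 v) ^ 2 := by
    have h0 := integral_eq_zero_of_deriv
      (F := fun x => iteratedDeriv 9 v x * iteratedDeriv 10 v x)
      (F' := fun x => iteratedDeriv 10 v x * iteratedDeriv 10 v x +
        iteratedDeriv 9 v x * iteratedDeriv 11 v x)
      (fun x => (d 9 (by norm_num) x).fun_mul (d 10 (by norm_num) x))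
      (integrable_mul m9 m10) ((integrable_mul m10 m10).add (integrable_mul m9 m11))
    have h1 := integral_add (integrable_mul m10 m10) (integrable_mul m9 m11)
    have h2 := l2_sq m10
    simp only [sq] at h2 ⊢
    linarith
  have e : ∫ x, iteratedDeriv 9 v x * (P.E.Φ 7 (jetSeq v x) x t + ε * iteratedDeriv 11 v x) =
      -(∫ x, iteratedDeriv 10 v x * P.E.Φ 6 (jetSeq v x) x t)
        - ε * l2 (iteratedDeriv 10 v) ^ 2 := by
    have h1 := integral_add (integrable_mul m9 mΦ7) ((integrable_mul m9 m11).const_mul ε)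
    rw [integral_const_mul, ibp1, ibp2] at h1
    rw [show -(∫ x, iteratedDeriv 10 v x * P.E.Φ 6 (jetSeq v x) x t)
      - ε * l2 (iteratedDeriv 10 v) ^ 2 = -(∫ x, iteratedDeriv 10 v x * P.E.Φ 6 (jetSeq v x) x t)
      + ε * -l2 (iteratedDeriv 10 v) ^ 2 by ring, ← h1]
    congr 1; ext x; ring
  have hcs := (abs_le.1 (abs_integral_mul_le m10 mΦ)).1
  have hint := l2_deriv_sq_le (d 8 (by norm_num)) (d 9 (by norm_num)) (hs.mem 8 (by norm_num)) m9 m10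
  have hsum := sum_l2_le hs.smooth hm
  rw [Finset.sum_range_succ] at lΦ
  have n := fun j => l2_nonneg (iteratedDeriv j v)
  have hεS : ε * ∑ j ∈ Finset.range 9, l2 (iteratedDeriv j v) ≤ 9 * |R| := by
    rw [Finset.mul_sum]
    calc _ ≤ ∑ _j ∈ Finset.range 9, |R| := Finset.sum_le_sum fun j hj =>
          (hs.eps_le j (by have := Finset.mem_range.1 hj; omega)).trans (le_abs_self R)
      _ = _ := by simp
  have h8R := (hs.eps_le 8 le_rfl).trans (le_abs_self R)
  have hS0 : 0 ≤ ∑ j ∈ Finset.range 9, l2 (iteratedDeriv j v) := Finset.sum_nonneg fun j _ => n j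
  set S := ∑ j ∈ Finset.range 9, l2 (iteratedDeriv j v) with hS
  have n0 := l2_nonneg v
  have n8 := n 8
  have n9 := n 9
  have n10 := n 10
  set w := l2 (iteratedDeriv 8 v) with hw
  set z := l2 (iteratedDeriv 9 v) with hz
  set y := l2 (iteratedDeriv 10 v) with hy
  have hε0 : 0 < ε := by linarith
  have b1 : y * l2 (fun x => P.E.Φ 6 (jetSeq v x) x t) ≤ y * (C * (S + z)) :=
    mul_le_mul_of_nonneg_left lΦ n10
  rw [e]
  have tot : 2 * (-(∫ x, iteratedDeriv 10 v x * P.E.Φ 6 (jetSeq v x) x t) - ε * y ^ 2) ≤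
      C ^ 2 * S ^ 2 + 2 * C ^ 4 * w ^ 2 := by linarith [absorb_viscosity (S := S) hC hε hint]
  refine (mul_le_mul_of_nonneg_left tot (sq_nonneg ε)).trans ?_
  exact small_data_bound hε0.le (abs_nonneg R) hS0 n0 n8 hεS h8R hsum

/-- The energy argument with weight `1` and comparison constant `1`; the prefactor `4` is therefore
independent of the low norms. -/
lemma growth_eight_of_one_le (R : ℝ) : ∃ C, 0 < C ∧ ∀ ε T u u', 1 ≤ ε →
    P.Flow R ε T u u' → ∀ s ∈ Set.Icc 0 T,
      ε * (l2 (u s) + l2 (iteratedDeriv 8 (u s))) ≤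
        4 * (ε * (l2 (u 0) + l2 (iteratedDeriv 8 (u 0))) + s * C) := by
  obtain ⟨C, hC, h8⟩ := P.slice_eight_of_one_le R
  obtain ⟨C0, hC0, h0⟩ := P.l2_sq_dini R
  refine ⟨C + C0, by positivity, fun ε T u u' hε h => ?_⟩
  obtain ⟨D, hDc, hD, hD'⟩ := h0 ε T u u' h
  have key : ∀ s ∈ Set.Icc 0 T, _ := fun s hs =>
    h.energy_dini hs (M := 7) le_rfl (ρ := fun _ _ => 1) (ρ₁ := fun _ => 0) (Λ := fun _ => 0)
      (fun _ _ => bddCont_const 1) (fun x => hasDerivAt_const x (1 : ℝ)) (bddCont_const 0)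
      tendsto_const_nhds (Eventually.of_forall (by simp))
  have hmem : ∀ s ∈ Set.Icc 0 T, MemLp (iteratedDeriv 8 (u s)) 2 volume := fun s hs =>
    (h.slice s hs).mem _ (by norm_num)
  have hε0 : 0 ≤ ε := by linarith
  have := energy_growth (c := 1) hε0 le_rfl hC hC0
    (fun s hs => (key s hs).1) hDc (fun s hs => (key s (Set.Ico_subset_Icc_self hs)).2 hs.2) hD
    (fun s hs => (l2_sq_le_weighted one_pos (bddCont_const 1) (hmem s hs) (by simp)).1)
    (fun s hs => (l2_sq_le_weighted one_pos (bddCont_const 1) (hmem s hs) (by simp)).2)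
    (fun s hs => ?_) (fun s hs => ?_)
  · simpa using this
  · have hs' := Set.Ico_subset_Icc_self hs
    have := h8 ε (u s) s hε (h.slice s hs') (h.memH s hs')
    simpa using this
  · have n := l2_nonneg (iteratedDeriv 8 (u s))
    have n3 : 0 ≤ C0 * (ε * l2 (iteratedDeriv (7 + 1) (u s))) := by
      have := l2_nonneg (iteratedDeriv (7 + 1) (u s)); positivity
    linarith [(hD' s hs).2]

end Nonlinearity


/-! ### Monotone constants, conversion to Sobolev norms, and conclusion. -/

lemma ContinuousInH.exists_bound {s T : ℝ} {u : ℝ → ℝ → ℝ}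
    (h : ContinuousInH s (Set.Icc 0 T) u) :
    ∃ B : ℝ≥0∞, B ≠ ⊤ ∧ ∀ t ∈ Set.Icc 0 T, sobolevENorm s (u t) ≤ B := by
  refine isCompact_Icc.induction_on
    (p := fun S => ∃ B : ℝ≥0∞, B ≠ ⊤ ∧ ∀ t ∈ S, sobolevENorm s (u t) ≤ B)
    ⟨0, by simp, by simp⟩ ?_ ?_ ?_
  · rintro S S' hS ⟨B, hB, hb⟩
    exact ⟨B, hB, fun t ht => hb t (hS ht)⟩
  · rintro S S' ⟨B, hB, hb⟩ ⟨B', hB', hb'⟩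
    refine ⟨max B B', by simp [hB, hB'], fun t ht => ?_⟩
    rcases ht with ht | ht
    · exact (hb t ht).trans (le_max_left _ _)
    · exact (hb' t ht).trans (le_max_right _ _)
  · intro t₀ ht₀
    refine ⟨_, (h.2 t₀ ht₀).eventually_lt_const one_pos, 1 + sobolevENorm s (u t₀),
      ENNReal.add_ne_top.2 ⟨ENNReal.one_ne_top, (h.1 t₀ ht₀).ne⟩, fun t ht => ?_⟩
    have h1 := sobolevENorm_add_le s (fun x => u t x - u t₀ x) (u t₀)
    simp only [sub_add_cancel] at h1
    exact h1.trans (add_le_add_left (le_of_lt ht) _)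

/-- A monotone majorant of a sequence. -/
lemma exists_monotone_ge (A : ℕ → ℝ) : ∃ A' : ℕ → ℝ, Monotone A' ∧ (∀ n, 1 ≤ A' n) ∧
    ∀ m n, m ≤ n → A m ≤ A' n := by
  refine ⟨fun n => 1 + ∑ i ∈ Finset.range (n + 1), |A i|, fun m n h => ?_, fun n => ?_,
    fun m n h => ?_⟩
  · exact add_le_add_right (Finset.sum_le_sum_of_subset_of_nonneg
      (Finset.range_subset_range.2 (by omega)) fun _ _ _ => abs_nonneg _) _
  · linarith [Finset.sum_nonneg fun i (_ : i ∈ Finset.range (n + 1)) => abs_nonneg (A i)]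
  · have := Finset.single_le_sum (f := fun i => |A i|) (fun i _ => abs_nonneg (A i))
      (Finset.mem_range.2 (by omega : m < n + 1))
    linarith [le_abs_self (A m)]

/-- The rate of growth depends on the low and the high bound together, whereas `C₄` may depend on
the high one only. A majorant `G` of `B` on squares satisfies `G (max m n) ≤ G m * G n` because its
values are at least `1`. -/
lemma exists_monotone_mul_ge (B : ℕ → ℕ → ℝ) : ∃ G : ℕ → ℝ, Monotone G ∧ (∀ n, 1 ≤ G n) ∧
    ∀ m n, B m n ≤ G m * G n := by
  obtain ⟨G, hG, hG1, h⟩ := exists_monotone_ge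
    fun n => ∑ i ∈ Finset.range (n + 1), ∑ j ∈ Finset.range (n + 1), |B i j|
  refine ⟨G, hG, hG1, fun m n => ?_⟩
  have h1 := h (max m n) (max m n) le_rfl
  have h2 := Finset.single_le_sum
    (f := fun i => ∑ j ∈ Finset.range (max m n + 1), |B i j|)
    (fun i _ => Finset.sum_nonneg fun j _ => abs_nonneg (B i j))
    (Finset.mem_range.2 (Nat.lt_succ_of_le (le_max_left m n)))
  have h3 := Finset.single_le_sum (f := fun j => |B m j|) (fun j _ => abs_nonneg (B m j))
    (Finset.mem_range.2 (Nat.lt_succ_of_le (le_max_right m n)))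
  have h4 : G (max m n) ≤ G m * G n := by
    have a := hG1 m
    have b := hG1 n
    rcases le_total m n with hmn | hmn
    · rw [max_eq_right hmn]; nlinarith
    · rw [max_eq_left hmn]; nlinarith
  exact (le_abs_self _).trans (h3.trans (h2.trans (h1.trans h4)))

lemma sobolevENorm_le_highNorm {ε t s : ℝ} (hs : s ∈ Set.Icc 0 t) (u : ℝ → ℝ → ℝ) :
    sobolevENorm 7 (u s) + ENNReal.ofReal ε * sobolevENorm 8 (u s) ≤ highNorm ε u t := by
  unfold highNorm
  gcongr
  · exact le_iSup₂ (f := fun t' (_ : t' ∈ Set.Icc 0 t) => sobolevENorm 7 (u t')) s hs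
  · exact le_iSup₂ (f := fun t' (_ : t' ∈ Set.Icc 0 t) => sobolevENorm 8 (u t')) s hs

lemma toReal_sobolevENorm_le_highNorm {ε t s : ℝ} (hε : 0 ≤ ε) (hs : s ∈ Set.Icc 0 t)
    {u : ℝ → ℝ → ℝ} (h : highNorm ε u t ≠ ⊤) (h7 : MemH 7 (u s)) (h8 : MemH 8 (u s)) :
    (sobolevENorm 7 (u s)).toReal + ε * (sobolevENorm 8 (u s)).toReal ≤
      (highNorm ε u t).toReal := by
  have := ENNReal.toReal_mono h (sobolevENorm_le_highNorm (ε := ε) hs u)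
  rwa [ENNReal.toReal_add h7.ne (ENNReal.mul_ne_top ENNReal.ofReal_ne_top h8.ne),
    ENNReal.toReal_mul, ENNReal.toReal_ofReal hε] at this

lemma toReal_highNorm_le {ε t X Y : ℝ} (hε : 0 ≤ ε) {u : ℝ → ℝ → ℝ} (hX : 0 ≤ X) (hY : 0 ≤ Y)
    (hm : ∀ s ∈ Set.Icc 0 t, MemH 8 (u s))
    (h7 : ∀ s ∈ Set.Icc 0 t, (sobolevENorm 7 (u s)).toReal ≤ X)
    (h8 : ∀ s ∈ Set.Icc 0 t, ε * (sobolevENorm 8 (u s)).toReal ≤ Y) :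
    (highNorm ε u t).toReal ≤ X + Y := by
  refine ENNReal.toReal_le_of_le_ofReal (by positivity) ?_
  rw [ENNReal.ofReal_add hX hY, highNorm]
  refine add_le_add (iSup₂_le fun s hs => ?_) ?_
  · have h7m : sobolevENorm 7 (u s) ≠ ⊤ :=
      ((sobolevENorm_mono (by norm_num : (7 : ℝ) ≤ 8) (u s)).trans_lt (hm s hs)).ne
    rw [← ENNReal.ofReal_toReal h7m]
    exact ENNReal.ofReal_le_ofReal (h7 s hs)
  · simp_rw [ENNReal.mul_iSup]
    refine iSup₂_le fun s hs => ?_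
    rw [← ENNReal.ofReal_toReal (hm s hs).ne, ← ENNReal.ofReal_mul hε]
    exact ENNReal.ofReal_le_ofReal (h8 s hs)

/-- A bound on the dispersion holds everywhere, by continuity. -/
lemma one_le_mul_abs_of_essSup_le {a : ℝ → ℝ} (ha : Continuous a) {k : ℝ}
    (h : essSup (fun x => ‖a x‖ₑ⁻¹) volume ≤ ENNReal.ofReal k) (x : ℝ) : 1 ≤ k * |a x| := by
  have h1 : ∀ᵐ x, 1 ≤ k * |a x| := by
    filter_upwards [ENNReal.ae_le_essSup (μ := volume) fun x => ‖a x‖ₑ⁻¹] with x hx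
    have h2 := hx.trans h
    have h0 : a x ≠ 0 := by
      rintro h0
      simp [h0] at h2
    have hp : 0 < |a x| := abs_pos.2 h0
    rw [← ofReal_norm, Real.norm_eq_abs, ← ENNReal.ofReal_inv_of_pos hp] at h2
    have hk : 0 < k := by
      by_contra hk
      rw [ENNReal.ofReal_of_nonpos (not_lt.1 hk)] at h2
      have := ENNReal.ofReal_eq_zero.1 (le_zero_iff.1 h2)
      exact absurd this (not_le.2 (inv_pos.2 hp))
    rw [ENNReal.ofReal_le_ofReal_iff hk.le, inv_le_iff_one_le_mul₀ hp] at h2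
    exact h2
  have hd : Dense {x | 1 ≤ k * |a x|} := Measure.dense_of_ae h1
  have hc : IsClosed {x | 1 ≤ k * |a x|} :=
    isClosed_le continuous_const (continuous_const.mul ha.abs)
  have := hd.closure_eq
  rw [hc.closure_eq] at this
  exact Set.eq_univ_iff_forall.1 this x


lemma sobolev_equiv {v : ℝ → ℝ} (hv : ContDiff ℝ 11 v) {N : ℕ} (hN : N ≤ 8) (hm : MemH N v) :
    (sobolevENorm N v).toReal ≤ 2 ^ 8 * (l2 v + l2 (iteratedDeriv N v)) ∧
      l2 v + l2 (iteratedDeriv N v) ≤ 2 * (2 * Real.pi) ^ 8 * (sobolevENorm N v).toReal := by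
  have hc : ContDiff ℝ N v := hv.of_le (by exact_mod_cast (by omega : N ≤ 11))
  have hpi : (1 : ℝ) ≤ 2 * Real.pi := by linarith [Real.pi_gt_three]
  have n0 := l2_nonneg v
  have nN := l2_nonneg (iteratedDeriv N v)
  constructor
  · refine (toReal_sobolevENorm_le hm hc le_rfl).trans ?_
    exact mul_le_mul_of_nonneg_right (pow_le_pow_right₀ (by norm_num) hN) (by positivity)
  · have h0 := l2_iteratedDeriv_le (n := 0) (hc.of_le (by exact_mod_cast Nat.zero_le N))
      (by simp) hm
    have h1 := l2_iteratedDeriv_le hc le_rfl hm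
    rw [iteratedDeriv_zero, pow_zero, one_mul] at h0
    have hS : 0 ≤ (sobolevENorm N v).toReal := ENNReal.toReal_nonneg
    have e1 : (sobolevENorm N v).toReal ≤ (2 * Real.pi) ^ 8 * (sobolevENorm N v).toReal :=
      le_mul_of_one_le_left hS (one_le_pow₀ hpi)
    have e2 : (2 * Real.pi) ^ N * (sobolevENorm N v).toReal ≤
        (2 * Real.pi) ^ 8 * (sobolevENorm N v).toReal :=
      mul_le_mul_of_nonneg_right (pow_le_pow_right₀ hpi hN) hS
    linarith

lemma growth_of_equiv {θ S S₀ L L₀ c C s t p q : ℝ} (hθ : 0 ≤ θ) (hC : 0 ≤ C) (hs : 0 ≤ s)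
    (hst : s ≤ t) (hp : 1 ≤ p) (hq : 0 ≤ q) (h1 : S ≤ q * L) (h2 : L₀ ≤ 2 * p * S₀)
    (h : θ * L ≤ 4 * c ^ 2 * (θ * L₀ + s * C)) :
    θ * S ≤ 8 * q * p * c ^ 2 * (θ * S₀ + t * C) := by
  have e1 := mul_le_mul_of_nonneg_left h1 hθ
  have e2 := mul_le_mul_of_nonneg_left h2 hθ
  have e3 : s * C ≤ 2 * p * (t * C) := by
    have a : s * C ≤ t * C := mul_le_mul_of_nonneg_right hst hC
    have b : 0 ≤ t * C := mul_nonneg (hs.trans hst) hC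
    nlinarith
  have e4 : θ * L₀ + s * C ≤ 2 * p * (θ * S₀ + t * C) := by linarith
  have e5 := mul_le_mul_of_nonneg_left e4 (by positivity : 0 ≤ 4 * c ^ 2)
  have e6 := mul_le_mul_of_nonneg_left (h.trans e5) hq
  linarith

namespace Nonlinearity

variable {I : Set ℝ} {f : (Fin 4 → ℝ) → ℝ → ℝ → ℝ} (P : Nonlinearity I f)

/-- The estimate of the norms of high order, for integral values of the bounds. -/
lemma exists_highNorm_estimate : ∃ A G : ℕ → ℝ, Monotone A ∧ Monotone G ∧ (∀ n, 1 ≤ A n) ∧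
    (∀ n, 1 ≤ G n) ∧ ∀ (n m : ℕ) ε t u u', 0 ≤ ε → 0 ≤ t → P.Flow (n + m) ε t u u' →
      (∀ s ∈ Set.Icc 0 t, P.LowBound n (u s) s) → highNorm ε u t ≠ ⊤ → highNorm ε u 0 ≠ ⊤ →
      (highNorm ε u t).toReal ≤ A n * ((highNorm ε u 0).toReal + t * G m) := by
  choose c₇ hc₇ C₇ hC₇ h₇ using P.growth_seven
  choose c₈ hc₈ C₈ hC₈ h₈ using P.growth_eight_of_le_one
  choose C₁ hC₁ h₁ using P.growth_eight_of_one_le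
  obtain ⟨G, hG, hG1, hGB⟩ := exists_monotone_mul_ge fun m n =>
    C₇ m (m + n) + C₈ m (m + n) + C₁ (m + n)
  set p : ℝ := (2 * Real.pi) ^ 8 with hp
  have hp1 : 1 ≤ p := one_le_pow₀ (by linarith [Real.pi_gt_three])
  set q : ℝ := 2 ^ 8 with hq
  have hq0 : 0 < q := by positivity
  obtain ⟨A, hA, hA1, hAB⟩ := exists_monotone_ge fun n =>
    8 * q * p * (c₇ n ^ 2 + c₈ n ^ 2 + 2)
  -- The factor `G n` from the rate of growth is merged into the prefactor, which already depends on
  -- `n`.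
  refine ⟨fun n => A n * G n, G, fun m n h => mul_le_mul (hA h) (hG h)
    (by linarith [hG1 m]) (by linarith [hA1 n]), hG, fun n => by nlinarith [hA1 n, hG1 n], hG1,
    fun n m ε t u u' hε ht hF hlow hfin hfin0 => ?_⟩
  have h0t : (0 : ℝ) ∈ Set.Icc 0 t := ⟨le_rfl, ht⟩
  have hm7 : ∀ s ∈ Set.Icc 0 t, MemH 7 (u s) := fun s hs =>
    (sobolevENorm_mono (by norm_num : (7 : ℝ) ≤ 8) (u s)).trans_lt (hF.memH s hs)
  have eq7 := fun s hs => sobolev_equiv (N := 7) (hF.slice s hs).smooth (by norm_num)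
    (by exact_mod_cast hm7 s hs)
  have eq8 := fun s hs => sobolev_equiv (N := 8) (hF.slice s hs).smooth (by norm_num)
    (by exact_mod_cast hF.memH s hs)
  simp only [Nat.cast_ofNat] at eq7 eq8
  have hM0 := toReal_sobolevENorm_le_highNorm hε (t := 0) (s := 0) (by simp) hfin0 (hm7 0 h0t)
    (hF.memH 0 h0t)
  set S₇ := (sobolevENorm 7 (u 0)).toReal with hS₇
  set S₈ := (sobolevENorm 8 (u 0)).toReal with hS₈
  have nS₇ : 0 ≤ S₇ := ENNReal.toReal_nonneg
  have nS₈ : 0 ≤ S₈ := ENNReal.toReal_nonneg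
  -- A single bound for the slices: `m` covers the high norms and `n` covers the dispersion.
  set R : ℝ := n + m with hR
  have p7 := (hC₇ n R).le
  have p8 := (hC₈ n R).le
  have p1 := (hC₁ R).le
  have key : (highNorm ε u t).toReal ≤ 8 * q * p * (c₇ n ^ 2 + c₈ n ^ 2 + 2) *
      ((S₇ + ε * S₈) + t * (C₇ n R + C₈ n R + C₁ R)) := by
    have w : 0 ≤ 8 * q * p := by positivity
    rcases le_total ε 1 with hε1 | hε1
    · have b7 : ∀ s ∈ Set.Icc 0 t, (sobolevENorm 7 (u s)).toReal ≤
          8 * q * p * c₇ n ^ 2 * (S₇ + t * C₇ n R) := fun s hs => by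
        have := growth_of_equiv zero_le_one p7 hs.1 hs.2 hp1 hq0.le (eq7 s hs).1 (eq7 0 h0t).2
          (by simpa only [one_mul] using h₇ n R ε t u u' hF hlow s hs)
        simpa only [one_mul] using this
      have b8 : ∀ s ∈ Set.Icc 0 t, ε * (sobolevENorm 8 (u s)).toReal ≤
          8 * q * p * c₈ n ^ 2 * (ε * S₈ + t * C₈ n R) := fun s hs =>
        growth_of_equiv hε p8 hs.1 hs.2 hp1 hq0.le (eq8 s hs).1 (eq8 0 h0t).2
          (h₈ n R ε t u u' hε1 hF hlow s hs)
      refine (toReal_highNorm_le hε (by positivity) (by positivity) hF.memH b7 b8).trans ?_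
      have a1 : 0 ≤ S₇ + t * C₇ n R := by positivity
      have a2 : 0 ≤ ε * S₈ + t * C₈ n R := by positivity
      have a3 : 0 ≤ t * C₁ R := by positivity
      have d1 : c₇ n ^ 2 * (S₇ + t * C₇ n R) + c₈ n ^ 2 * (ε * S₈ + t * C₈ n R) ≤
          (c₇ n ^ 2 + c₈ n ^ 2 + 2) * ((S₇ + ε * S₈) + t * (C₇ n R + C₈ n R + C₁ R)) := by
        have x1 := mul_nonneg (sq_nonneg (c₇ n)) a2
        have x2 := mul_nonneg (sq_nonneg (c₈ n)) a1
        have x3 := mul_nonneg (by positivity : 0 ≤ c₇ n ^ 2 + c₈ n ^ 2 + 2) a3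
        linarith
      have d2 := mul_le_mul_of_nonneg_left d1 w
      linarith
    · have b8 : ∀ s ∈ Set.Icc 0 t, ε * (sobolevENorm 8 (u s)).toReal ≤
          8 * q * p * 1 ^ 2 * (ε * S₈ + t * C₁ R) := fun s hs =>
        growth_of_equiv hε p1 hs.1 hs.2 hp1 hq0.le (eq8 s hs).1 (eq8 0 h0t).2
          (by simpa using h₁ R ε t u u' hε1 hF s hs)
      -- For `ε ≥ 1` the `H⁷` norm is at most `ε` times the `H⁸` norm, so it needs no energy of its
      -- own.
      have b7 : ∀ s ∈ Set.Icc 0 t, (sobolevENorm 7 (u s)).toReal ≤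
          8 * q * p * 1 ^ 2 * (ε * S₈ + t * C₁ R) := fun s hs => by
        refine le_trans ?_ (b8 s hs)
        refine (ENNReal.toReal_mono (hF.memH s hs).ne
          (sobolevENorm_mono (by norm_num : (7 : ℝ) ≤ 8) (u s))).trans ?_
        exact le_mul_of_one_le_left ENNReal.toReal_nonneg hε1
      refine (toReal_highNorm_le hε (by positivity) (by positivity) hF.memH b7 b8).trans ?_
      have a2 : 0 ≤ ε * S₈ + t * C₁ R := by positivity
      have a3 : 0 ≤ t * (C₇ n R + C₈ n R) := by positivity
      have d1 : 2 * (ε * S₈ + t * C₁ R) ≤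
          (c₇ n ^ 2 + c₈ n ^ 2 + 2) * ((S₇ + ε * S₈) + t * (C₇ n R + C₈ n R + C₁ R)) := by
        refine mul_le_mul (by nlinarith [sq_nonneg (c₇ n), sq_nonneg (c₈ n)]) (by linarith) a2
          (by positivity)
      have d2 := mul_le_mul_of_nonneg_left d1 w
      linarith
  have hB := hGB n m
  have hA' := hAB n n le_rfl
  have g1 := hG1 n
  have g2 := hG1 m
  set M₀ := (highNorm ε u 0).toReal with hM₀
  have nM₀ : 0 ≤ M₀ := ENNReal.toReal_nonneg
  have e1 : (S₇ + ε * S₈) + t * (C₇ n R + C₈ n R + C₁ R) ≤ G n * (M₀ + t * G m) := by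
    have := mul_le_mul_of_nonneg_left hB ht
    have i2 : M₀ ≤ G n * M₀ := le_mul_of_one_le_left nM₀ g1
    linarith
  have hp0 : 0 < p := by linarith
  calc _ ≤ A n * (G n * (M₀ + t * G m)) := key.trans (mul_le_mul hA' e1 (by positivity)
        (by linarith [hA1 n]))
    _ = _ := by ring

end Nonlinearity

/-- A regularized solution is a flow with the bounds given by its norms. -/
lemma IsRegularizedSolution.flow {f : (Fin 4 → ℝ) → ℝ → ℝ → ℝ} {φ u₀ : ℝ → ℝ} {T₀ T' ε δ t : ℝ}
    {u : ℝ → ℝ → ℝ} (P : Nonlinearity (Set.Icc (-T₀) T₀) f) (hT : T' ≤ T₀)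
    (h : IsRegularizedSolution f φ ε δ T' u₀ u) (hε : 0 ≤ ε) (ht : t ∈ Set.Icc 0 T')
    (hk : lowNorm f u t ≠ ⊤) (hM : highNorm ε u t ≠ ⊤) {n m : ℕ}
    (hn : (2 * Real.pi) ^ 8 * (lowNorm f u t).toReal ≤ n)
    (hm : (2 * Real.pi) ^ 8 * (highNorm ε u t).toReal ≤ m) :
    (∀ s ∈ Set.Icc 0 t, P.LowBound n (u s) s) ∧ ∃ u', P.Flow (n + m) ε t u u' := by
  have hpi : (1 : ℝ) ≤ 2 * Real.pi := by linarith [Real.pi_gt_three]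
  have hsub : Set.Icc 0 t ⊆ Set.Icc 0 T' := Set.Icc_subset_Icc_right ht.2
  have hI : ∀ s ∈ Set.Icc 0 t, s ∈ Set.Icc (-T₀) T₀ := fun s hs =>
    ⟨by linarith [hs.1, hs.2, ht.2], by linarith [hs.2, ht.2]⟩
  have h12 : ∀ s ∈ Set.Icc 0 t, MemH 12 (u s) := fun s hs => h.continuous_H12.1 s (hsub hs)
  have hle : ∀ r ≤ (12 : ℝ), ∀ s ∈ Set.Icc 0 t, MemH r (u s) := fun r hr s hs =>
    (sobolevENorm_mono hr (u s)).trans_lt (h12 s hs)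
  have hsm : ∀ s ∈ Set.Icc 0 t, ContDiff ℝ 11 (u s) := fun s hs => h.smooth s (hsub hs)
  have hmem : ∀ s ∈ Set.Icc 0 t, ∀ j ≤ 11, MemLp (iteratedDeriv j (u s)) 2 volume :=
    fun s hs j hj => memLp_iteratedDeriv (h12 s hs) ((hsm s hs).of_le (by exact_mod_cast hj))
      (by norm_cast; omega)
  have hl2 : ∀ s ∈ Set.Icc 0 t, ∀ r ≤ 8, ∀ j ≤ r, l2 (iteratedDeriv j (u s)) ≤
      (2 * Real.pi) ^ 8 * (sobolevENorm r (u s)).toReal := fun s hs r hr j hj => by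
    refine (l2_iteratedDeriv_le (s := r) ((hsm s hs).of_le
      (by exact_mod_cast (by omega : j ≤ 11))) (by exact_mod_cast hj)
      (hle r (by norm_cast; omega) s hs)).trans ?_
    exact mul_le_mul_of_nonneg_right (pow_le_pow_right₀ hpi (hj.trans hr)) ENNReal.toReal_nonneg
  have hn0 : (0 : ℝ) ≤ n := Nat.cast_nonneg n
  have hm0 : (0 : ℝ) ≤ m := Nat.cast_nonneg m
  have hp0 : (0 : ℝ) ≤ (2 * Real.pi) ^ 8 := by positivity
  have hmax : ∀ s ∈ Set.Icc 0 t,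
      max (sobolevENorm 4 (u s)) (dispersion f (u s) s) ≤ lowNorm f u t := fun s hs =>
    le_iSup₂ (f := fun t' (_ : t' ∈ Set.Icc 0 t) =>
      max (sobolevENorm 4 (u t')) (dispersion f (u t') t')) s hs
  have hdisp : ∀ s ∈ Set.Icc 0 t, ∀ x, 1 ≤ (n : ℝ) * |P.a (jetSeq (u s) x) x s| := by
    intro s hs x
    have h1 := (le_max_right _ _).trans (hmax s hs)
    unfold dispersion at h1
    have e : (fun x => ‖partialZ 3 f (jet 4 (u s) x) x s‖ₑ⁻¹) =
        fun x => ‖P.a (jetSeq (u s) x) x s‖ₑ⁻¹ := by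
      ext x
      rw [P.fam.partialZ_eq (by norm_num) 3 _ x (hI s hs)]
      rfl
    rw [e, ← ENNReal.ofReal_toReal hk] at h1
    have h2 := one_le_mul_abs_of_essSup_le
      (Nonlinearity.continuous_a (hsm s hs) (hI s hs)) h1 x
    refine h2.trans (mul_le_mul_of_nonneg_right (le_trans ?_ hn) (abs_nonneg _))
    exact le_mul_of_one_le_left ENNReal.toReal_nonneg (one_le_pow₀ hpi)
  have hlow : ∀ s ∈ Set.Icc 0 t, P.LowBound n (u s) s := fun s hs => by
    refine ⟨hsm s hs, fun j hj => hmem s hs j (by omega), fun j hj => ?_, hdisp s hs⟩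
    refine (hl2 s hs 4 (by norm_num) j hj).trans (le_trans ?_ hn)
    have := ENNReal.toReal_mono hk ((le_max_left _ _).trans (hmax s hs))
    exact mul_le_mul_of_nonneg_left (by exact_mod_cast this) hp0
  have hhigh : ∀ s ∈ Set.Icc 0 t, _ := fun s hs => toReal_sobolevENorm_le_highNorm hε hs hM
    (hle 7 (by norm_num) s hs) (hle 8 (by norm_num) s hs)
  obtain ⟨u', ⟨-, hu', hd⟩, heq⟩ := h.equation
  refine ⟨hlow, u', ⟨fun s hs => ⟨hI s hs, hsm s hs, hmem s hs, fun j hj => ?_, hε,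
    fun j hj => ?_, fun x => ?_⟩, hle 8 (by norm_num), fun s hs => hu'.1 s (hsub hs),
    fun s hs => (hd s (hsub hs)).mono_left
      (nhdsWithin_mono _ (Set.sdiff_subset_sdiff_left hsub)), fun s hs x => ?_⟩⟩
  · have h1 := hl2 s hs 7 (by norm_num) j hj
    have h2 : (sobolevENorm 7 (u s)).toReal ≤ (highNorm ε u t).toReal := by
      have := mul_nonneg hε (ENNReal.toReal_nonneg (a := sobolevENorm 8 (u s)))
      linarith [hhigh s hs]
    have h3 := mul_le_mul_of_nonneg_left h2 hp0
    simp only [Nat.cast_ofNat] at h1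
    linarith
  · have h1 := mul_le_mul_of_nonneg_left (hl2 s hs 8 le_rfl j hj) hε
    have h2 : ε * (sobolevENorm 8 (u s)).toReal ≤ (highNorm ε u t).toReal := by
      have := ENNReal.toReal_nonneg (a := sobolevENorm 7 (u s))
      linarith [hhigh s hs]
    have h3 := mul_le_mul_of_nonneg_left h2 hp0
    simp only [Nat.cast_ofNat] at h1
    linarith
  · exact (hdisp s hs x).trans (mul_le_mul_of_nonneg_right (by linarith) (abs_nonneg _))
  · have h1 := heq s (hsub hs) x
    have h2 : P.E.Φ 0 (jetSeq (u s) x) x s = f (jet 4 (u s) x) x s := by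
      rw [P.E.Φ_zero]
      exact P.fam.1 _ x s (hI s hs)
    rw [h2]
    linarith

lemma IsRegularizedSolution.highNorm_ne_top {f : (Fin 4 → ℝ) → ℝ → ℝ → ℝ} {φ u₀ : ℝ → ℝ}
    {T' ε δ t : ℝ} {u : ℝ → ℝ → ℝ} (h : IsRegularizedSolution f φ ε δ T' u₀ u) (ht : t ≤ T') :
    highNorm ε u t ≠ ⊤ := by
  obtain ⟨B, hB, hb⟩ := h.continuous_H12.exists_bound
  have hr : ∀ r ≤ (12 : ℝ), (⨆ t' ∈ Set.Icc 0 t, sobolevENorm r (u t')) ≤ B := fun r hr =>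
    iSup₂_le fun s hs => (sobolevENorm_mono hr (u s)).trans (hb s ⟨hs.1, hs.2.trans ht⟩)
  exact ENNReal.add_ne_top.2 ⟨((hr 7 (by norm_num)).trans_lt hB.lt_top).ne,
    ENNReal.mul_ne_top ENNReal.ofReal_ne_top ((hr 8 (by norm_num)).trans_lt hB.lt_top).ne⟩

end KdVType

theorem proposition5p2
    (f : (Fin 4 → ℝ) → ℝ → ℝ → ℝ) (T₀ : ℝ)
    (hA1 : ConditionA1 (Set.Icc (-T₀) T₀) f)
    (hA2 : ConditionA2 (Set.Icc (-T₀) T₀) f)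
    (hA3 : ConditionA3 (Set.Icc (-T₀) T₀) f)
    (T' : ℝ) (hT' : 0 < T') (hT'₀ : T' ≤ T₀) :
    ∃ (C₂ : ℝ → ℝ → ℝ) (C₄ : ℝ → ℝ),
      Monotone (fun p : ℝ × ℝ => C₂ p.1 p.2) ∧ Monotone C₄ ∧
      (∀ a b, 1 ≤ C₂ a b) ∧ (∀ a, 1 ≤ C₄ a) ∧
      ∀ (φ : ℝ → ℝ) (ε δ : ℝ) (u₀ : ℝ → ℝ) (u : ℝ → ℝ → ℝ),
        IsCutoff φ → 0 ≤ ε → 0 < δ → δ ≤ 1 → MemH 7 u₀ →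
        IsRegularizedSolution f φ ε δ T' u₀ u →
        ∀ t ∈ Set.Icc 0 T', lowNorm f u t ≠ ⊤ →
          highNorm ε u t ≠ ⊤ ∧
          (highNorm ε u t).toReal ≤
            C₂ (lowNorm f u t).toReal (t * C₄ (highNorm ε u t).toReal) *
              ((highNorm ε u 0).toReal + t * C₄ (highNorm ε u t).toReal) := by
  obtain ⟨P⟩ := nonempty_nonlinearity (convex_Icc (-T₀) T₀)
    (uniqueDiffOn_Icc (by linarith)) hA1 hA2 hA3
  obtain ⟨A, G, hA, hG, hA1', hG1, hest⟩ := P.exists_highNorm_estimate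
  have hp : (0 : ℝ) ≤ (2 * Real.pi) ^ 8 := by positivity
  have hceil : Monotone fun x : ℝ => ⌈(2 * Real.pi) ^ 8 * x⌉₊ := fun x y hxy =>
    Nat.ceil_mono (mul_le_mul_of_nonneg_left hxy hp)
  -- The factor `(2π)^8` bounds derivatives up to order eight by Sobolev norms, and rounding up
  -- reaches the integral bounds of `exists_highNorm_estimate`. A constant that depends on `k` alone
  -- is stronger than the form required of `C₂`.
  refine ⟨fun a _ => A ⌈(2 * Real.pi) ^ 8 * a⌉₊, fun b => G ⌈(2 * Real.pi) ^ 8 * b⌉₊,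
    fun x y hxy => hA (hceil hxy.1), hG.comp hceil, fun _ _ => hA1' _, fun _ => hG1 _,
    fun φ ε δ u₀ u _ hε _ _ _ hu t ht hk => ?_⟩
  have hM := hu.highNorm_ne_top ht.2
  obtain ⟨hlow, u', hF⟩ := hu.flow P hT'₀ hε ht hk hM (Nat.le_ceil _) (Nat.le_ceil _)
  exact ⟨hM, hest _ _ ε t u u' hε ht.1 hF hlow hM (hu.highNorm_ne_top (ht.1.trans ht.2))⟩
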